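/- **Setting.** Let $d,n\in\mathbb N$, let $A_1,\dots,A_d\in\mathbb R^{n\times n}$ be symmetric, $E\in\mathbb R^{n\times n}$ skew-symmetric, $T:\mathbb R^n\times\mathbb R^n\times\mathbb R^n\to\mathbb R^n$ trilinear (extended trilinearly to $\mathbb C^n$), $\kappa\in\mathbb R^d\setminus\{0\}$ and $\omega\in\mathbb R$. Put $A(\beta)=\sum_\ell\beta_\ell A_\ell$, $A(\partial)=\sum_\ell A_\ell\partial_\ell$, $\mathcal L(\alpha,\beta)=-\alpha I+A(\beta)-\mathrm iE$, and let $W=\{f\in\mathcal S'(\mathbb R^d)^n:\widehat f\in L^1\}$, $\|f\|_W=\|\widehat f\|_{L^1}$, where $\widehat f(k)=(2\pi)^{-d/2}\int f(x)e^{-\mathrm ik\cdot x}\,\mathrm dx$; $W^s$ consists of the $f$ with $\partial^\alpha f\in W$ for $|\alpha|_1\le s$, with norm $\|f\|_{W^s}=\sum_{|\alpha|_1\le s}\|\partial^\alpha f\|_W$. Assume: (a) $\ker\mathcal L(\omega,\kappa)$ is one-dimensional. (b) $\mathcal L(0,\beta)$ has for every $\beta\in\mathbb R^d$ an orthonormal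 basis of eigenvectors $\psi_1(\beta),\dots,\psi_n(\beta)$ with real eigenvalues $\omega_1(\beta),\dots,\omega_n(\beta)$, all of class $C^\infty$ in $\beta\in\mathbb R^d\setminus\{0\}$, with $\omega_1(\kappa)=\omega$; each $\omega_\ell$ is globally Lipschitz continuous on $\mathbb R^d$ with respect to $|\cdot|_1$; and there is $c>0$ with $|\omega-\omega_\ell(\beta)|\ge c$ for all $\beta\in\mathbb R^d$ and $\ell\ge2$. (c) (non-resonance) $\mathcal L(3\omega,3\kappa)$ is regular and has no common eigenvalue with $\mathcal L(\omega,\kappa)$. Let $p_0,p_1\in W^2$ with $p_0(x)\in\ker\mathcal L(\omega,\kappa)$ for a.e. $x$. Let $t_{\mathrm{end}}>0$. For $\varepsilon\in(0,1]$ let $u_1,u_3\in C^1([0,t_{\mathrm{end}}/\varepsilon],W)\cap C([0,t_{\mathrm{end}}/\varepsilon],W^1)$ be a classical solution on $[0,t_{\mathrm{end}}/\varepsilon]$ of $$\partial_tu_j+\tfrac{\mathrm i}{\varepsilon}\mathcal L(j\omega,j\kappa)u_j+A(\partial)u_j=\varepsilon\sum_{j_1+j_2+j_3=j}T(u_{j_1},u_{j_2},u_{j_3}),\qquad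 j\in\{1,3\},$$ (sum over $j_1,j_2,j_3\in\{\pm1,\pm3\}$, $u_{-j}=\overline{u_j}$) with $u_1(0)=p_0+\varepsilon p_1$ and $u_3(0)=0$. Put $\lambda_{j\ell}(\theta)=-j\omega+\omega_\ell(j\kappa+\theta)$, $\psi_{j\ell}(\theta)=\psi_\ell(j\kappa+\theta)$, $\Lambda_j=\mathrm{diag}(\lambda_{j1},\dots,\lambda_{jn})$, $\Psi_j=(\psi_{j1}|\cdots|\psi_{jn})$, $$z_j(t,k)=\exp\big(\tfrac{\mathrm it}{\varepsilon}\Lambda_j(\varepsilon k)\big)\Psi_j(\varepsilon k)^*\,\widehat u_j(t,k),\qquad j\in\{1,3\},$$ $P(w_1,\dots,w_n)=(w_1,0,\dots,0)$, $P^\perp=I-P$, $\mathcal P_\varepsilon(k)=\psi_{11}(\varepsilon k)\psi_{11}(\varepsilon k)^*$, $\mathcal P_\varepsilon^\perp=I-\mathcal P_\varepsilon$. **Claim.** For every sufficiently large $r>0$ there is $t_\star\in(0,t_{\mathrm{end}}]$ such that for all $\varepsilon\in(0,1]$ $$\sup_{t\in[0,t_\star/\varepsilon]}\Big(2\|Pz_1(t)\|_{L^1}+\tfrac2\varepsilon\|P^\perp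 z_1(t)\|_{L^1}+\tfrac2{\varepsilon^2}\|z_3(t)\|_{L^1}\Big)\le r .$$ The number $t_\star$ does not depend on $\varepsilon$. It can be chosen depending only on $d$, $n$, $t_{\mathrm{end}}$, $r$, an upper bound for $\|p_0\|_{W^2}$ and $\|p_1\|_{W^2}$, a constant $C_T$ with $|T(a,b,c)|_2\le C_T|a|_2|b|_2|c|_2$, an upper bound for $|\lambda_{1\ell}(0)|^{-1}$ ($\ell\ge2$), and a Lipschitz constant of the $\omega_\ell$; the threshold for $r$ may in addition depend on $A_1,\dots,A_d$, $E$, $T$, $\kappa$, $\omega$ and the eigendecomposition, but not on $\varepsilon$, and on $p_0,p_1$ only through that bound. Consequently there is a constant $C$ independent of $\varepsilon\in(0,1]$ such that for all $t\in[0,t_\star/\varepsilon]$ $$\|\mathcal P_\varepsilon^\perp\widehat u_1(t)\|_{L^1}=\|P^\perp z_1(t)\|_{L^1}\le C\varepsilon,\qquad \|\widehat u_3(t)\|_{L^1}=\|z_3(t)\|_{L^1}\le C\varepsilon^2 .$$ -/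

import Mathlib

open MeasureTheory Set Filter Topology Complex
open scoped ENNReal Matrix

noncomputable section

namespace Friedrichs

/-- Real `d`-space, both for positions `x` and for wave vectors `k`. -/
abbrev RSpace (d : ℕ) := EuclideanSpace ℝ (Fin d)

/-- Complex `n`-space with the Euclidean norm `|·|₂`. -/
abbrev CSpace (n : ℕ) := EuclideanSpace ℂ (Fin n)

/-- The data of the Friedrichs system
`∂ₜ u + ∑ₗ Aₗ ∂ₗ u + ε⁻¹ E u = ε T(u,u,u)` together with a wave vector `κ` and a frequency `ω`. -/
structure Data (d n : ℕ) where
  A : Fin d → Matrix (Fin n) (Fin n) ℝ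
  A_symm : ∀ l, (A l).IsSymm
  E : Matrix (Fin n) (Fin n) ℝ
  E_skew : Eᵀ = -E
  T : (Fin n → ℝ) →ₗ[ℝ] (Fin n → ℝ) →ₗ[ℝ] (Fin n → ℝ) →ₗ[ℝ] (Fin n → ℝ)
  κ : RSpace d
  κ_ne : κ ≠ 0
  ω : ℝ

/-! ### The Wiener algebra

An element `f` of `W = {f ∈ 𝓢'(ℝᵈ)ⁿ : f̂ ∈ L¹}` is given by its Fourier transform `f̂ ∈ L¹`, with
the convention `f̂(k) = (2π)^(-d/2) ∫ f(x) exp(-i k·x) dx`. The (continuous, bounded) function `f`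
itself is then recovered by the inverse Fourier integral. -/

/-- `L¹(ℝᵈ, ℂⁿ)`, the space of Fourier transforms of elements of `W`; its norm is `‖f‖_W`. -/
abbrev LOne (d n : ℕ) := Lp (CSpace n) 1 (volume : Measure (RSpace d))

/-- The function `f(x) = (2π)^(-d/2) ∫ f̂(k) exp(i k·x) dk` with Fourier transform `f̂ = g`. -/
def wienerFun {d n : ℕ} (g : LOne d n) (x : RSpace d) : CSpace n :=
  (2 * Real.pi) ^ (-(d : ℝ) / 2) • ∫ k, Complex.exp (I * (inner ℝ k x : ℝ)) • g k

/-- The multi-indices `α ∈ ℕ₀ᵈ` with `|α|₁ ≤ s`. -/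
def multiIndices (d s : ℕ) : Finset (Fin d → Fin (s + 1)) :=
  Finset.univ.filter fun α => ∑ i, (α i : ℕ) ≤ s

/-- The Fourier symbol `(i k)^α` of the derivative `∂^α`. -/
def derivSymbol {d s : ℕ} (α : Fin d → Fin (s + 1)) (k : RSpace d) : ℂ :=
  ∏ i, (I * (k i : ℂ)) ^ (α i : ℕ)

/-- `f ∈ W^s`, that is `∂^α f ∈ W` for all `|α|₁ ≤ s`, in terms of `g = f̂`. -/
def MemW {d n : ℕ} (s : ℕ) (g : LOne d n) : Prop :=
  ∀ α ∈ multiIndices d s, Integrable (fun k => derivSymbol α k • g k) volume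

/-- `‖f‖_{W^s} = ∑_{|α|₁ ≤ s} ‖∂^α f‖_W`, in terms of `g = f̂` (used for `f ∈ W^s`). -/
def wNorm {d n : ℕ} (s : ℕ) (g : LOne d n) : ℝ :=
  ∑ α ∈ multiIndices d s, ∫ k, ‖derivSymbol α k • g k‖

/-- `u ∈ C([0,τ], W^s)`, in terms of `U = û`. -/
def ContinuousW {d n : ℕ} (s : ℕ) (τ : ℝ) (U : ℝ → LOne d n) : Prop :=
  (∀ t ∈ Icc 0 τ, MemW s (U t)) ∧
  ∀ t ∈ Icc 0 τ, Tendsto (fun t' => wNorm s (U t' - U t)) (𝓝[Icc 0 τ] t) (𝓝 0)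

/-! ### The system for the coefficient functions -/

/-- Entrywise complex conjugation on `ℂⁿ`. -/
def conjC {n : ℕ} (v : CSpace n) : CSpace n :=
  WithLp.toLp 2 fun i => (starRingEnd ℂ) (v i)

/-- The set `{±1, ±3, …, ±m}` (for odd `m`). -/
def modes (m : ℕ) : Finset ℤ := (Finset.Icc (-(m : ℤ)) m).filter fun j => Odd j

/-- The triples `(j₁,j₂,j₃)` of modes with `j₁ + j₂ + j₃ = j`. -/
def triples (m : ℕ) (j : ℤ) : Finset (ℤ × ℤ × ℤ) :=
  (modes m ×ˢ modes m ×ˢ modes m).filter fun J => J.1 + J.2.1 + J.2.2 = j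

namespace Data

variable {d n : ℕ}

/-- The Hermitian matrix `𝓛(α,β) = -α I + ∑ₗ βₗ Aₗ - i E`. -/
def L (S : Data d n) (α : ℝ) (β : RSpace d) : Matrix (Fin n) (Fin n) ℂ :=
  -((α : ℂ) • (1 : Matrix (Fin n) (Fin n) ℂ)) + ∑ l, (β l : ℂ) • (S.A l).map Complex.ofReal
    - I • S.E.map Complex.ofReal

/-- The complex trilinear extension of `T` to `ℂⁿ`. -/
def TC (S : Data d n) (a b c : CSpace n) : CSpace n :=
  WithLp.toLp 2 fun q => ∑ i₁, ∑ i₂, ∑ i₃, a i₁ * b i₂ * c i₃ *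
    ((S.T (Pi.single i₁ 1) (Pi.single i₂ 1) (Pi.single i₃ 1) q : ℝ) : ℂ)

/-- The coefficient function `u_j(t,x)`, where `u_{-j}` is the complex conjugate of `u_j` and
`U j t` is the Fourier transform of `u_j(t)` for `j > 0`. -/
def field (U : ℤ → ℝ → LOne d n) (j : ℤ) (t : ℝ) (x : RSpace d) : CSpace n :=
  if 0 < j then wienerFun (U j t) x else conjC (wienerFun (U (-j) t) x)

/-- `A(∂) v (x) = ∑ₗ Aₗ ∂ₗ v (x)`. -/
def Adiff (S : Data d n) (v : RSpace d → CSpace n) (x : RSpace d) : CSpace n :=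
  ∑ l, Matrix.toEuclideanLin ((S.A l).map Complex.ofReal)
    (fderiv ℝ v x (EuclideanSpace.single l 1))

/-- `{u_j}`, `j ∈ {1, 3, …, m}`, with Fourier transforms `U j`, is a classical solution on `[0,τ]`
of
`∂ₜ u_j + (i/ε) 𝓛(jω,jκ) u_j + A(∂) u_j = ε ∑_{j₁+j₂+j₃=j} T(u_{j₁},u_{j₂},u_{j₃})`,
`u_1(0) = p`, `u_j(0) = 0` for `j ≠ 1`,
of class `C¹([0,τ],W) ∩ C([0,τ],W¹)`. -/
structure IsClassicalSolution (S : Data d n) (m : ℕ) (ε τ : ℝ) (p : LOne d n)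
    (U : ℤ → ℝ → LOne d n) : Prop where
  contDiff : ∀ j ∈ modes m, 0 < j → ContDiffOn ℝ 1 (U j) (Icc 0 τ)
  continuousW : ∀ j ∈ modes m, 0 < j → ContinuousW 1 τ (U j)
  pde : ∀ j ∈ modes m, 0 < j → ∀ t ∈ Ioc 0 τ, ∀ x,
    HasDerivWithinAt (fun t' => field U j t' x)
      (-((I / (ε : ℂ)) • Matrix.toEuclideanLin (S.L (j * S.ω) ((j : ℝ) • S.κ)) (field U j t x))
        - S.Adiff (field U j t) x
        + (ε : ℂ) • ∑ J ∈ triples m j,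
            S.TC (field U J.1 t x) (field U J.2.1 t x) (field U J.2.2 t x))
      (Icc 0 τ) t
  init_one : U 1 0 = p
  init_other : ∀ j ∈ modes m, 1 < j → U j 0 = 0

/-- `ker 𝓛(ω,κ)` is one-dimensional (in particular `ω` is an eigenvalue of `A(κ) - i E`). -/
def KernelOneDim (S : Data d n) : Prop :=
  Module.finrank ℂ (LinearMap.ker (Matrix.toEuclideanLin (S.L S.ω S.κ))) = 1

/-- `p₀(x) ∈ ker 𝓛(ω,κ)` for almost every `x`, in terms of `g = p̂₀`. -/
def Polarized (S : Data d n) (g : LOne d n) : Prop :=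
  ∀ᵐ x : RSpace d, Matrix.toEuclideanLin (S.L S.ω S.κ) (wienerFun g x) = 0

/-- Non-resonance: `𝓛(3ω,3κ)` is regular and has no common eigenvalue with `𝓛(ω,κ)`. -/
def NonResonant (S : Data d n) : Prop :=
  IsUnit (S.L (3 * S.ω) ((3 : ℝ) • S.κ)) ∧
  Disjoint (spectrum ℂ (S.L (3 * S.ω) ((3 : ℝ) • S.κ))) (spectrum ℂ (S.L S.ω S.κ))

/-- A smooth eigendecomposition of `𝓛(0,β) = A(β) - i E`: eigenvalues `ev ℓ β` and an orthonormal
basis of eigenvectors `vec ℓ β`, smooth on `ℝᵈ ∖ {0}`, enumerated such that the first eigenvalue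
at `κ` is `ω`. -/
structure Eigendecomposition [NeZero n] (S : Data d n) where
  ev : Fin n → RSpace d → ℝ
  vec : Fin n → RSpace d → CSpace n
  orthonormal : ∀ β, Orthonormal ℂ fun ℓ => vec ℓ β
  eigen : ∀ ℓ β, Matrix.toEuclideanLin (S.L 0 β) (vec ℓ β) = (ev ℓ β : ℂ) • vec ℓ β
  ev_smooth : ∀ ℓ, ContDiffOn ℝ ((⊤ : ℕ∞) : WithTop ℕ∞) (ev ℓ) {0}ᶜ
  vec_smooth : ∀ ℓ, ContDiffOn ℝ ((⊤ : ℕ∞) : WithTop ℕ∞) (vec ℓ) {0}ᶜ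
  ev_kappa : ev 0 S.κ = S.ω

namespace Eigendecomposition

variable [NeZero n] {S : Data d n}

/-- All eigenvalues are globally Lipschitz with constant `C` (with respect to `|·|₁`). -/
def LipschitzBound (D : S.Eigendecomposition) (C : ℝ) : Prop :=
  ∀ ℓ β β', |D.ev ℓ β' - D.ev ℓ β| ≤ C * ∑ i, |β' i - β i|

/-- `ω` is bounded away from all eigenvalues `ω_ℓ(β)`, `ℓ ≥ 2`. -/
def Gap (D : S.Eigendecomposition) : Prop :=
  ∃ c > 0, ∀ ℓ, ℓ ≠ 0 → ∀ β, c ≤ |S.ω - D.ev ℓ β|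

/-- The eigenvalues `λ_{jℓ}(θ) = -jω + ω_ℓ(jκ + θ)` of `𝓛_j(θ) = 𝓛(jω, jκ + θ)`. -/
def lam (D : S.Eigendecomposition) (j : ℤ) (ℓ : Fin n) (θ : RSpace d) : ℝ :=
  -(j * S.ω) + D.ev ℓ ((j : ℝ) • S.κ + θ)

/-- The eigenvectors `ψ_{jℓ}(θ) = ψ_ℓ(jκ + θ)` of `𝓛_j(θ)`. -/
def psi (D : S.Eigendecomposition) (j : ℤ) (ℓ : Fin n) (θ : RSpace d) : CSpace n :=
  D.vec ℓ ((j : ℝ) • S.κ + θ)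

/-- The unitary matrix `Ψ_j(θ)` with columns `ψ_{jℓ}(θ)`. -/
def Psi (D : S.Eigendecomposition) (j : ℤ) (θ : RSpace d) : Matrix (Fin n) (Fin n) ℂ :=
  Matrix.of fun i ℓ => D.psi j ℓ θ i

/-- `S_{j,ε}(t,k) = exp((i t/ε) Λ_j(εk)) Ψ_j(εk)*`. -/
def transform (D : S.Eigendecomposition) (j : ℤ) (ε t : ℝ) (k : RSpace d) :
    Matrix (Fin n) (Fin n) ℂ :=
  Matrix.diagonal (fun ℓ => Complex.exp (I * (t / ε) * D.lam j ℓ (ε • k))) *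
    (D.Psi j (ε • k))ᴴ

/-- The transformed function `z_j(t,k) = S_{j,ε}(t,k) û_j(t,k)`, for `j > 0`. -/
def z (D : S.Eigendecomposition) (ε : ℝ) (U : ℤ → ℝ → LOne d n) (j : ℤ) (t : ℝ)
    (k : RSpace d) : CSpace n :=
  Matrix.toEuclideanLin (D.transform j ε t k) (U j t k)

/-- The orthogonal projection `𝓟_ε(k) = ψ₁₁(εk) ψ₁₁(εk)*`, applied to `w`. -/
def PEps (D : S.Eigendecomposition) (ε : ℝ) (k : RSpace d) (w : CSpace n) : CSpace n :=
  inner ℂ (D.psi 1 0 (ε • k)) w • D.psi 1 0 (ε • k)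

/-- `𝓟_ε^⊥(k) = I - 𝓟_ε(k)`, applied to `w`. -/
def PEpsPerp (D : S.Eigendecomposition) (ε : ℝ) (k : RSpace d) (w : CSpace n) : CSpace n :=
  w - D.PEps ε k w

end Eigendecomposition

end Data

/-! ### The scaled norm -/

/-- `P (w₁, …, wₙ) = (w₁, 0, …, 0)`. -/
def P {n : ℕ} [NeZero n] (w : CSpace n) : CSpace n := EuclideanSpace.single 0 (w 0)

/-- `P^⊥ = I - P`. -/
def PPerp {n : ℕ} [NeZero n] (w : CSpace n) : CSpace n := w - P w

/-- The `L¹` norm, with values in `[0,∞]`. -/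
def normL1 {d n : ℕ} (f : RSpace d → CSpace n) : ℝ≥0∞ := eLpNorm f 1 volume

/-- The scaled norm `2‖P y₁‖ + (2/ε)‖P^⊥ y₁‖ + (2/ε²)‖y₃‖` of a pair of functions
(all norms in `L¹`). -/
def scaledNorm {d n : ℕ} [NeZero n] (ε : ℝ) (y₁ y₃ : RSpace d → CSpace n) : ℝ≥0∞ :=
  2 * normL1 (fun k => P (y₁ k)) + ENNReal.ofReal (2 / ε) * normL1 (fun k => PPerp (y₁ k))
    + ENNReal.ofReal (2 / ε ^ 2) * normL1 y₃

end Friedrichs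

end

open Friedrichs

/-! The argument runs on the Fourier transforms `û_j` in `L¹`, where the system reads `∂ₜ û_j =
-(i/ε) 𝓛(jω, jκ+εk) û_j + ε · (convolutions)`. After projecting onto the eigenvectors and removing
the phases `exp(i t λ_{jℓ}(εk)/ε)`, each mode is driven by the nonlinearity alone, with a prefactor
`ε` (`hasDerivAt_mode`). Over times of order `1/ε` this only gives `O(1)`; the additional powers of
`ε` come from oscillation. Three modes of `u_{±1}` drive the mode `(j,m)` with a phase `exp(i s Φ)`,
where `Φ` is close to `1/ε` times a detuning of eigenvalues at `θ = 0`. If the detuning is nonzero,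
then `|Φ| ≥ δ/ε`, and integration by parts in time gains a factor `ε` (`exists_corrector`,
`norm_le_of_nonresonant`).

For the modes `m ≠ 0` of `u_1`, interactions of three leading modes have detuning `λ_{1m}(0)`,
nonzero by the gap; all other interactions contain a mode of size `ε`. For `u_3`, only `1+1+1 = 3`
occurs among triples of `±1`. With at most one non-leading factor the detuning is `λ_{3m}(0)` or
`λ_{3m}(0) - λ_{1ℓ}(0)`, nonzero by non-resonance; with two such factors the term is already
`O(ε²)`. A factor `u_{±3}` also makes a term `O(ε²)`. This produces exactly the orders `ε` and `ε²`
of the claim. For `t = 0`, polarization of `p₀` and a Lipschitz bound for the eigenvectors at `κ`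
make the non-leading modes `O(ε)`.

The phase `Φ` is controlled only where `ε|k| ≤ ρ₀`, so modes are cut off at `|k| ≤ ρ₀/ε` and
frequencies are frozen outside that ball. The discarded part is `O(ε²)` once a norm with weight
comparable to `1+|k|²` is under control. The solution itself need not lie in `W²`: the weight is
truncated to `min(1+|k|², R)` with `R = 1+(ρ₀/ε)²`, which is finite on `L¹` and still large outside
the ball. It is submultiplicative with a constant independent of `R` (`weight_add_le`), so the
weighted norms stay bounded uniformly in `ε`.

All quantities are collected in `energy`. By `exists_energy_bound`, the bounds in `Controlled` with
constant `r` on `[0,t]` together with `ε t r⁵ ≤ 1` imply an energy bound `B` that does not depend on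
`r`, `t` or `ε`. For `r ≥ B + 1` and `t⋆ = min(t_end, r⁻⁵)` the continuation argument
`le_of_bootstrap` closes. -/

noncomputable section

namespace Friedrichs

/-! ### Multiplication operators on `L¹` -/

section Operators

variable {α β : Type*} [MeasurableSpace α] [MeasurableSpace β]
variable {E F G : Type*} [NormedAddCommGroup E] [NormedSpace ℝ E] [NormedAddCommGroup F]
  [NormedSpace ℝ F] [NormedAddCommGroup G] [NormedSpace ℝ G]

/-- `φ` is measurable and bounded by `C`. -/
structure IsBddMul (μ : Measure α) (φ : α → E) (C : ℝ) : Prop where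
  meas : AEStronglyMeasurable φ μ
  nonneg : 0 ≤ C
  bound : ∀ k, ‖φ k‖ ≤ C

omit [NormedSpace ℝ E] in
theorem IsBddMul.memLp {μ : Measure α} {φ : α → E} {C : ℝ} (h : IsBddMul μ φ C) :
    MemLp φ ∞ μ :=
  memLp_top_of_bound h.meas C (ae_of_all _ h.bound)

open Classical in
/-- Multiplication by a bounded measurable family of operators, on `L¹`. -/
def mulOp (μ : Measure α) (φ : α → E →L[ℝ] F) : Lp E 1 μ →L[ℝ] Lp F 1 μ :=
  -- The value `0` is a junk value; all computations assume `IsBddMul`, which excludes this branch.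
  if h : MemLp φ ∞ μ then
    (ContinuousLinearMap.id ℝ (E →L[ℝ] F)).holderL μ ∞ 1 1 (h.toLp φ) else 0

variable {μ : Measure α} {ν : Measure β}

theorem coeFn_mulOp {φ : α → E →L[ℝ] F} {C : ℝ} (h : IsBddMul μ φ C) (f : Lp E 1 μ) :
    mulOp μ φ f =ᵐ[μ] fun k => φ k (f k) := by
  rw [mulOp, dif_pos h.memLp]
  filter_upwards [ContinuousLinearMap.coeFn_holder (r := 1) (ContinuousLinearMap.id ℝ (E →L[ℝ] F))
    (h.memLp.toLp φ) f, h.memLp.coeFn_toLp] with k hk hk'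
  rw [ContinuousLinearMap.holderL_apply_apply, hk, hk']
  rfl

theorem norm_mulOp_apply_le {φ : α → E →L[ℝ] F} {C : ℝ} (h : IsBddMul μ φ C) (f : Lp E 1 μ) :
    ‖mulOp μ φ f‖ ≤ C * ‖f‖ := by
  apply Lp.norm_le_mul_norm_of_ae_le_mul
  filter_upwards [coeFn_mulOp h f] with k hk
  rw [hk]
  exact (φ k).le_of_opNorm_le (h.bound k) _

theorem norm_mulOp_le {φ : α → E →L[ℝ] F} {C : ℝ} (h : IsBddMul μ φ C) : ‖mulOp μ φ‖ ≤ C :=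
  ContinuousLinearMap.opNorm_le_bound _ h.nonneg (norm_mulOp_apply_le h)

theorem mulOp_mulOp {φ : α → F →L[ℝ] G} {ψ : α → E →L[ℝ] F} {χ : α → E →L[ℝ] G} {C C' C'' : ℝ}
    (h : IsBddMul μ φ C) (h' : IsBddMul μ ψ C') (h'' : IsBddMul μ χ C'')
    (heq : ∀ k, φ k ∘L ψ k = χ k) (f : Lp E 1 μ) :
    mulOp μ φ (mulOp μ ψ f) = mulOp μ χ f := by
  apply Lp.ext
  filter_upwards [coeFn_mulOp h (mulOp μ ψ f), coeFn_mulOp h' f, coeFn_mulOp h'' f] with k h1 h2 h3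
  rw [h1, h2, h3, ← heq]
  rfl

theorem mulOp_sub {φ ψ : α → E →L[ℝ] F} {C C' : ℝ} (h : IsBddMul μ φ C) (h' : IsBddMul μ ψ C') :
    mulOp μ (fun k => φ k - ψ k) = mulOp μ φ - mulOp μ ψ := by
  have h'' : IsBddMul μ (fun k => φ k - ψ k) (C + C') :=
    ⟨h.meas.sub h'.meas, add_nonneg h.nonneg h'.nonneg,
      fun k => (norm_sub_le _ _).trans (add_le_add (h.bound k) (h'.bound k))⟩
  ext1 f
  apply Lp.ext
  rw [sub_apply]
  filter_upwards [coeFn_mulOp h f, coeFn_mulOp h' f, coeFn_mulOp h'' f,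
    Lp.coeFn_sub (mulOp μ φ f) (mulOp μ ψ f)] with k h1 h2 h3 h4
  rw [h3, h4, Pi.sub_apply, h1, h2]
  rfl

theorem mulOp_smul {φ : α → E →L[ℝ] F} {C : ℝ} (h : IsBddMul μ φ C) (c : ℝ) :
    mulOp μ (fun k => c • φ k) = c • mulOp μ φ := by
  have h'' : IsBddMul μ (fun k => c • φ k) (|c| * C) :=
    ⟨h.meas.const_smul c, mul_nonneg (abs_nonneg _) h.nonneg,
      fun k => by rw [norm_smul]; exact mul_le_mul_of_nonneg_left (h.bound k) (abs_nonneg _)⟩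
  ext1 f
  apply Lp.ext
  rw [smul_apply]
  filter_upwards [coeFn_mulOp h f, coeFn_mulOp h'' f,
    Lp.coeFn_smul c (mulOp μ φ f)] with k h1 h3 h4
  rw [h3, h4, Pi.smul_apply, h1]
  rfl

/-! ### Tensor products -/

theorem integrable_tens [SFinite ν] (B : E →L[ℝ] F →L[ℝ] G) (f : Lp E 1 μ)
    (g : Lp F 1 ν) : Integrable (fun z : α × β => B (f z.1) (g z.2)) (μ.prod ν) :=
  Integrable.op_fst_snd (op := fun x y => B x y) (by fun_prop)
    ⟨‖B‖, fun x y => B.le_opNorm₂ x y⟩ (L1.integrable_coeFn f) (L1.integrable_coeFn g)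

/-- `(f ⊗ g)(x,y) = B (f x) (g y)`, as a continuous bilinear map between `L¹` spaces. -/
def tens (μ : Measure α) (ν : Measure β) [SFinite μ] [SFinite ν] (B : E →L[ℝ] F →L[ℝ] G) :
    Lp E 1 μ →L[ℝ] Lp F 1 ν →L[ℝ] Lp G 1 (μ.prod ν) :=
  LinearMap.mkContinuous₂
    (LinearMap.mk₂ ℝ (fun f g => (integrable_tens B f g).toL1 _)
      (fun f f' g => by
        rw [← Integrable.toL1_add]
        apply (Integrable.toL1_eq_toL1_iff _ _ _ _).2
        filter_upwards [Measure.quasiMeasurePreserving_fst.ae_eq_comp (Lp.coeFn_add f f')]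
          with z hz
        have : (f + f') z.1 = f z.1 + f' z.1 := hz
        rw [Pi.add_apply, this, map_add, add_apply])
      (fun c f g => by
        rw [← Integrable.toL1_smul]
        apply (Integrable.toL1_eq_toL1_iff _ _ _ _).2
        filter_upwards [Measure.quasiMeasurePreserving_fst.ae_eq_comp (Lp.coeFn_smul c f)]
          with z hz
        have : (c • f) z.1 = c • f z.1 := hz
        rw [this, map_smul, smul_apply])
      (fun f g g' => by
        rw [← Integrable.toL1_add]
        apply (Integrable.toL1_eq_toL1_iff _ _ _ _).2
        filter_upwards [Measure.quasiMeasurePreserving_snd.ae_eq_comp (Lp.coeFn_add g g')]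
          with z hz
        have : (g + g') z.2 = g z.2 + g' z.2 := hz
        rw [Pi.add_apply, this, map_add])
      (fun c f g => by
        rw [← Integrable.toL1_smul]
        apply (Integrable.toL1_eq_toL1_iff _ _ _ _).2
        filter_upwards [Measure.quasiMeasurePreserving_snd.ae_eq_comp (Lp.coeFn_smul c g)]
          with z hz
        have : (c • g) z.2 = c • g z.2 := hz
        rw [this, map_smul])) ‖B‖ (fun f g => by
        simp only [LinearMap.mk₂_apply]
        -- By Fubini, the product of the two `L¹` norms is the integral of `‖f x‖ ‖g y‖` over the
        -- product space, so a pointwise comparison suffices.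
        rw [L1.norm_of_fun_eq_integral_norm (integrable_tens B f g), L1.norm_eq_integral_norm,
          L1.norm_eq_integral_norm, mul_assoc, ← integral_prod_mul, ← integral_const_mul]
        refine integral_mono_of_nonneg (ae_of_all _ fun _ => norm_nonneg _)
          (((L1.integrable_coeFn f).norm.mul_prod (L1.integrable_coeFn g).norm).const_mul _)
          (ae_of_all _ fun z => ?_)
        simpa [mul_assoc] using B.le_opNorm₂ (f z.1) (g z.2))

theorem coeFn_tens [SFinite μ] [SFinite ν] (B : E →L[ℝ] F →L[ℝ] G) (f : Lp E 1 μ) (g : Lp F 1 ν) :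
    tens μ ν B f g =ᵐ[μ.prod ν] fun z => B (f z.1) (g z.2) :=
  (integrable_tens B f g).coeFn_toL1

theorem norm_tens_le [SFinite μ] [SFinite ν] (B : E →L[ℝ] F →L[ℝ] G) (f : Lp E 1 μ)
    (g : Lp F 1 ν) : ‖tens μ ν B f g‖ ≤ ‖B‖ * ‖f‖ * ‖g‖ :=
  ((tens μ ν B).le_opNorm₂ f g).trans <| mul_le_mul_of_nonneg_right
    (mul_le_mul_of_nonneg_right (LinearMap.mkContinuous₂_norm_le _ (norm_nonneg B) _)
      (norm_nonneg _)) (norm_nonneg _)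

/-! ### Marginals -/

/-- Integration over the second variable, as an operator between `L¹` spaces. -/
def marginal (μ : Measure α) (ν : Measure β) [SFinite μ] [SFinite ν] :
    Lp E 1 (μ.prod ν) →L[ℝ] Lp E 1 μ :=
  LinearMap.mkContinuous
    { toFun := fun f => (L1.integrable_coeFn f).integral_prod_left.toL1 _
      map_add' := fun f g => by
        rw [← Integrable.toL1_add]
        apply (Integrable.toL1_eq_toL1_iff _ _ _ _).2
        have h := Measure.ae_ae_of_ae_prod (Lp.coeFn_add f g)
        filter_upwards [h, (L1.integrable_coeFn f).prod_right_ae,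
          (L1.integrable_coeFn g).prod_right_ae] with y hy h1 h2
        rw [Pi.add_apply, ← integral_add h1 h2]
        exact integral_congr_ae hy
      map_smul' := fun c f => by
        rw [RingHom.id_apply, ← Integrable.toL1_smul]
        apply (Integrable.toL1_eq_toL1_iff _ _ _ _).2
        have h := Measure.ae_ae_of_ae_prod (Lp.coeFn_smul c f)
        filter_upwards [h] with y hy
        rw [← integral_smul]
        exact integral_congr_ae hy } 1 (fun f => by
      simp only [LinearMap.coe_mk, AddHom.coe_mk, one_mul]
      rw [L1.norm_of_fun_eq_integral_norm (L1.integrable_coeFn f).integral_prod_left,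
        L1.norm_eq_integral_norm, integral_prod _ (L1.integrable_coeFn f).norm]
      exact integral_mono_of_nonneg (ae_of_all _ fun _ => norm_nonneg _)
        (L1.integrable_coeFn f).norm.integral_prod_left
        (ae_of_all _ fun y => norm_integral_le_integral_norm _))

theorem coeFn_marginal [SFinite μ] [SFinite ν] (f : Lp E 1 (μ.prod ν)) :
    marginal μ ν f =ᵐ[μ] fun x => ∫ y, f (x, y) ∂ν :=
  (L1.integrable_coeFn f).integral_prod_left.coeFn_toL1

theorem norm_marginal_le [SFinite μ] [SFinite ν] (f : Lp E 1 (μ.prod ν)) :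
    ‖marginal μ ν f‖ ≤ ‖f‖ := by
  simpa using (marginal (E := E) μ ν).le_of_opNorm_le
    (LinearMap.mkContinuous_norm_le _ zero_le_one _) f

end Operators

/-! ### Phases -/

section Phases

variable {α : Type*} [MeasurableSpace α] {μ : Measure α} {n : ℕ}

/-- Scalar multiplication by a complex function, as a family of operators. -/
def cmul (n : ℕ) (c : α → ℂ) (k : α) : CSpace n →L[ℝ] CSpace n :=
  c k • ContinuousLinearMap.id ℝ (CSpace n)

omit [MeasurableSpace α] in
theorem cmul_apply (c : α → ℂ) (k : α) (w : CSpace n) : cmul n c k w = c k • w := rfl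

theorem isBddMul_cmul {c : α → ℂ} {C : ℝ} (h : IsBddMul μ c C) : IsBddMul μ (cmul n c) C :=
  ⟨h.meas.smul_const _, h.nonneg, fun k => by
    rw [cmul, norm_smul]
    exact (mul_le_of_le_one_right (norm_nonneg _) ContinuousLinearMap.norm_id_le).trans
      (h.bound k)⟩

/-- The unimodular function `exp(i s q)`. -/
def phase (q : α → ℝ) (s : ℝ) (k : α) : ℂ := exp (I * (s * q k))

omit [MeasurableSpace α] in
theorem norm_phase (q : α → ℝ) (s : ℝ) (k : α) : ‖phase q s k‖ = 1 := by
  rw [phase, mul_comm, ← ofReal_mul, norm_exp_ofReal_mul_I]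

theorem isBddMul_phase {q : α → ℝ} {Q : ℝ} (hq : IsBddMul μ q Q) (s : ℝ) :
    IsBddMul μ (phase q s) 1 := by
  refine ⟨?_, zero_le_one, fun k => (norm_phase q s k).le⟩
  have h := hq.meas
  unfold phase
  exact (by fun_prop : Continuous fun x : ℝ => exp (I * (s * x))).comp_aestronglyMeasurable h

theorem isBddMul_ofReal {q : α → ℝ} {Q : ℝ} (hq : IsBddMul μ q Q) :
    IsBddMul μ (fun k => (q k : ℂ)) Q :=
  ⟨continuous_ofReal.comp_aestronglyMeasurable hq.meas, hq.nonneg, fun k => by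
    simpa using hq.bound k⟩

theorem IsBddMul.mul {c c' : α → ℂ} {C C' : ℝ} (h : IsBddMul μ c C) (h' : IsBddMul μ c' C') :
    IsBddMul μ (fun k => c k * c' k) (C * C') :=
  ⟨h.meas.mul h'.meas, mul_nonneg h.nonneg h'.nonneg, fun k => by
    rw [norm_mul]; exact mul_le_mul (h.bound k) (h'.bound k) (norm_nonneg _) h.nonneg⟩

theorem isBddMul_const (c : ℂ) : IsBddMul μ (fun _ => c) ‖c‖ :=
  ⟨aestronglyMeasurable_const, norm_nonneg _, fun _ => le_rfl⟩

/-- Differentiability holds in operator norm because `q` is bounded: the remainder `|exp(ihq) - 1 -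
ihq|` is at most `(hQ)²` uniformly in `k`. For this reason frequencies are later frozen outside a
ball. -/
theorem hasDerivAt_phase {q : α → ℝ} {Q : ℝ} (hq : IsBddMul μ q Q) (s : ℝ) :
    HasDerivAt (fun s => mulOp μ (cmul n (phase q s)))
      (mulOp μ (cmul n fun k => I * q k * phase q s k)) s := by
  have hd : IsBddMul μ (fun k => I * q k * phase q s k) (‖I‖ * Q * 1) :=
    ((isBddMul_const I).mul (isBddMul_ofReal hq)).mul (isBddMul_phase hq s)
  rw [hasDerivAt_iff_isLittleO_nhds_zero]
  refine Asymptotics.IsBigO.trans_isLittleO (g := fun h : ℝ => h ^ 2) ?_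
    (by simpa using Asymptotics.isLittleO_pow_pow (𝕜 := ℝ) one_lt_two)
  refine Asymptotics.IsBigO.of_bound (Q ^ 2) ?_
  -- The quadratic Taylor bound for `exp` requires the argument to lie in the unit disc.
  have : ∀ᶠ h : ℝ in 𝓝 0, |h| * Q < 1 := by
    have : Tendsto (fun h : ℝ => |h| * Q) (𝓝 0) (𝓝 (|0| * Q)) :=
      (continuous_abs.mul continuous_const).tendsto 0
    exact this.eventually_lt_const (by simp)
  filter_upwards [this] with h hh
  rw [← mulOp_sub (isBddMul_cmul (isBddMul_phase hq _)) (isBddMul_cmul (isBddMul_phase hq _)),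
    ← mulOp_smul (isBddMul_cmul hd), ← mulOp_sub (C := 1 + 1) (C' := |h| * (‖I‖ * Q * 1))]
  rotate_left
  · have h1 := isBddMul_cmul (n := n) (isBddMul_phase hq (s + h))
    have h2 := isBddMul_cmul (n := n) (isBddMul_phase hq s)
    exact ⟨h1.meas.sub h2.meas, by norm_num,
      fun k => (norm_sub_le _ _).trans (add_le_add (h1.bound k) (h2.bound k))⟩
  · have h1 := isBddMul_cmul (n := n) hd
    exact ⟨h1.meas.const_smul h, mul_nonneg (abs_nonneg _) h1.nonneg,
      fun k => by rw [norm_smul]; exact mul_le_mul_of_nonneg_left (h1.bound k) (abs_nonneg _)⟩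
  have key : (fun k => cmul n (phase q (s + h)) k - cmul n (phase q s) k -
      h • cmul n (fun k => I * q k * phase q s k) k) =
      cmul n (fun k => phase q s k * (exp (I * (h * q k)) - 1 - I * (h * q k))) := by
    ext1 k
    ext1 w
    simp only [sub_apply, smul_apply, cmul_apply]
    rw [← sub_smul, ← smul_assoc, ← sub_smul]
    congr 1
    simp only [phase]
    rw [show I * (((s + h : ℝ) : ℂ) * q k) = I * (s * q k) + I * (h * q k) by push_cast; ring,
      Complex.exp_add, real_smul]
    ring
  rw [key]
  refine (norm_mulOp_le (isBddMul_cmul (C := Q ^ 2 * ‖h ^ 2‖)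
    ⟨?_, by positivity, fun k => ?_⟩)).trans_eq rfl
  · exact (isBddMul_phase hq s).meas.mul
      ((by fun_prop : Continuous fun x : ℝ => exp (I * (h * x)) - 1 - I * (h * x)).comp_aestronglyMeasurable
        hq.meas)
  · rw [norm_mul, norm_phase, one_mul]
    have hb : ‖I * ((h : ℂ) * q k)‖ ≤ |h| * Q := by
      simp only [norm_mul, norm_I, one_mul, norm_real, Real.norm_eq_abs]
      exact mul_le_mul_of_nonneg_left (hq.bound k) (abs_nonneg _)
    refine (norm_exp_sub_one_sub_id_le (hb.trans hh.le)).trans ?_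
    calc _ ≤ (|h| * Q) ^ 2 := by gcongr
      _ = _ := by rw [mul_pow, mul_comm]; simp

/-- The primitive `(exp(i s Φ) - exp(i T Φ)) / (i Φ)` of `exp(i s Φ)` that vanishes at `s = T`. -/
def oscPrim (Φ : α → ℝ) (T s : ℝ) (k : α) : ℂ := (I * Φ k)⁻¹ * (phase Φ s k - phase Φ T k)

/-- A difference of two unimodular numbers is divided by something of modulus at least `δ`. With `δ`
of order `1/ε` this is the gain of one power of `ε`. -/
theorem isBddMul_oscPrim {Φ : α → ℝ} {Q δ : ℝ} (hΦ : IsBddMul μ Φ Q) (hδ : 0 < δ)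
    (hlow : ∀ k, δ ≤ |Φ k|) (T s : ℝ) : IsBddMul μ (oscPrim Φ T s) (2 / δ) := by
  refine ⟨?_, by positivity, fun k => ?_⟩
  · have h : Measurable fun x : ℝ => (I * (x : ℂ))⁻¹ := by fun_prop
    exact (h.comp_aemeasurable hΦ.meas.aemeasurable).aestronglyMeasurable.mul
      ((isBddMul_phase hΦ s).meas.sub (isBddMul_phase hΦ T).meas)
  · rw [oscPrim, norm_mul, norm_inv, norm_mul, norm_I, one_mul, norm_real, Real.norm_eq_abs,
      inv_mul_eq_div]
    refine div_le_div₀ (by norm_num) ?_ hδ (hlow k)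
    refine (norm_sub_le _ _).trans ?_
    rw [norm_phase, norm_phase]
    norm_num

theorem hasDerivAt_oscPrim {Φ : α → ℝ} {Q δ : ℝ} (hΦ : IsBddMul μ Φ Q) (hδ : 0 < δ)
    (hlow : ∀ k, δ ≤ |Φ k|) (T s : ℝ) :
    HasDerivAt (fun s => mulOp μ (cmul n (oscPrim Φ T s))) (mulOp μ (cmul n (phase Φ s))) s := by
  have hinv : IsBddMul μ (fun k => (I * (Φ k : ℂ))⁻¹) (1 / δ) := by
    refine ⟨?_, by positivity, fun k => ?_⟩
    · have h : Measurable fun x : ℝ => (I * (x : ℂ))⁻¹ := by fun_prop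
      exact (h.comp_aemeasurable hΦ.meas.aemeasurable).aestronglyMeasurable
    · rw [norm_inv, norm_mul, norm_I, one_mul, norm_real, Real.norm_eq_abs, ← one_div]
      exact one_div_le_one_div_of_le hδ (hlow k)
  have hne : ∀ k, I * (Φ k : ℂ) ≠ 0 := fun k h => by
    have : Φ k = 0 := by simpa using h
    have := hlow k
    simp_all only [abs_zero]
    linarith
  have hd := ((hasDerivAt_phase (n := n) hΦ s).sub_const (mulOp μ (cmul n (phase Φ T))))
  have := (hasDerivAt_const s (mulOp μ (cmul n fun k => (I * (Φ k : ℂ))⁻¹))).clm_comp hd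
  have h1 : IsBddMul μ (fun k => phase Φ s k) 1 := isBddMul_phase hΦ s
  convert! this using 1
  · funext r
    have hsub := mulOp_sub (isBddMul_cmul (n := n) (isBddMul_phase hΦ r))
      (isBddMul_cmul (n := n) (isBddMul_phase hΦ T))
    rw [← hsub]
    ext1 f
    rw [ContinuousLinearMap.comp_apply]
    refine (mulOp_mulOp (isBddMul_cmul hinv) (C' := 1 + 1) ⟨?_, by norm_num, ?_⟩
      (isBddMul_cmul (isBddMul_oscPrim hΦ hδ hlow T r)) (fun k => ?_) f).symm
    · exact (isBddMul_cmul (n := n) (isBddMul_phase hΦ r)).meas.sub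
        (isBddMul_cmul (n := n) (isBddMul_phase hΦ T)).meas
    · exact fun k => (norm_sub_le _ _).trans (add_le_add
        ((isBddMul_cmul (n := n) (isBddMul_phase hΦ r)).bound k)
        ((isBddMul_cmul (n := n) (isBddMul_phase hΦ T)).bound k))
    · ext1 w
      simp only [ContinuousLinearMap.comp_apply, sub_apply, cmul_apply, oscPrim]
      rw [← sub_smul, smul_smul]
  · rw [ContinuousLinearMap.zero_comp, zero_add]
    ext1 f
    rw [ContinuousLinearMap.comp_apply]
    refine (mulOp_mulOp (isBddMul_cmul hinv) (isBddMul_cmul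
      (((isBddMul_const I).mul (isBddMul_ofReal hΦ)).mul h1))
      (isBddMul_cmul h1) (fun k => ?_) f).symm
    ext1 w
    simp only [ContinuousLinearMap.comp_apply, cmul_apply, smul_smul]
    rw [← mul_assoc, inv_mul_cancel₀ (hne k), one_mul]

/-- This normalization removes the boundary term at the final time, so only the one at `t = 0` has
to be estimated. -/
theorem oscPrim_self (Φ : α → ℝ) (T : ℝ) : mulOp μ (cmul n (oscPrim Φ T T)) = 0 := by
  have : IsBddMul μ (cmul n (oscPrim Φ T T)) 0 := by
    have h : oscPrim Φ T T = fun _ => (0 : ℂ) := by funext k; simp [oscPrim]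
    rw [h]
    simpa using isBddMul_cmul (n := n) (isBddMul_const (μ := μ) 0)
  have := norm_mulOp_le this
  rwa [norm_le_zero_iff] at this

end Phases

/-! ### Push-forward under addition -/

section Push

variable {d : ℕ} {E F : Type*} [NormedAddCommGroup E] [NormedSpace ℝ E]
  [NormedAddCommGroup F] [NormedSpace ℝ F]

/-- Triples of wave vectors. -/
abbrev Triple (d : ℕ) := (RSpace d × RSpace d) × RSpace d

/-- Lebesgue measure on triples of wave vectors. -/
abbrev vol₃ (d : ℕ) : Measure (Triple d) := (volume.prod volume).prod volume

/-- The sum of the three wave vectors. -/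
def tsum₃ (K : Triple d) : RSpace d := K.1.1 + K.1.2 + K.2

/-- The triple with given sum and given first two components. -/
def shear (x : RSpace d × (RSpace d × RSpace d)) : Triple d := (x.2, x.1 - (x.2.1 + x.2.2))

theorem tsum₃_shear (x : RSpace d × (RSpace d × RSpace d)) : tsum₃ (shear x) = x.1 := by
  simp [tsum₃, shear]

/-- On each fibre over the first two components the map is a translation; a swap of factors puts the
sum in front. -/
theorem measurePreserving_shear :
    MeasurePreserving (shear (d := d)) (volume.prod (volume.prod volume)) (vol₃ d) := by
  have h : MeasurePreserving (fun y : (RSpace d × RSpace d) × RSpace d =>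
      (y.1, y.2 - (y.1.1 + y.1.2))) (vol₃ d) (vol₃ d) :=
    (MeasurePreserving.id (volume.prod volume : Measure (RSpace d × RSpace d))).skew_product
      (g := fun p x => x - (p.1 + p.2)) (by unfold Function.uncurry; fun_prop)
      (ae_of_all _ fun p => (measurePreserving_sub_right volume (p.1 + p.2)).map_eq)
  exact h.comp Measure.measurePreserving_swap

theorem quasiMeasurePreserving_tsum₃ :
    Measure.QuasiMeasurePreserving (tsum₃ (d := d)) (vol₃ d) volume := by
  have h : MeasurePreserving (fun y : (RSpace d × RSpace d) × RSpace d =>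
      (y.1, y.2 + (y.1.1 + y.1.2))) (vol₃ d) (vol₃ d) :=
    (MeasurePreserving.id (volume.prod volume : Measure (RSpace d × RSpace d))).skew_product
      (g := fun p x => x + (p.1 + p.2)) (by unfold Function.uncurry; fun_prop)
      (ae_of_all _ fun p => (measurePreserving_add_right volume (p.1 + p.2)).map_eq)
  have h2 := Measure.quasiMeasurePreserving_snd.comp h.quasiMeasurePreserving
  have h3 : tsum₃ (d := d) = Prod.snd ∘ fun y : (RSpace d × RSpace d) × RSpace d =>
      (y.1, y.2 + (y.1.1 + y.1.2)) := by
    funext y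
    simp only [tsum₃, Function.comp]
    abel
  rw [h3]
  exact h2

/-- Push-forward of an integrable function on triples under addition. -/
def push : Lp E 1 (vol₃ d) →L[ℝ] Lp E 1 (volume : Measure (RSpace d)) :=
  marginal volume (volume.prod volume) ∘L
    (Lp.compMeasurePreservingₗᵢ ℝ (shear (d := d)) measurePreserving_shear).toContinuousLinearMap

theorem norm_push_le (f : Lp E 1 (vol₃ d)) : ‖push f‖ ≤ ‖f‖ := by
  rw [push, ContinuousLinearMap.comp_apply]
  refine (norm_marginal_le _).trans_eq ?_
  exact LinearIsometry.norm_map _ _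

theorem coeFn_push (f : Lp E 1 (vol₃ d)) :
    push f =ᵐ[volume] fun k => ∫ p, f (shear (k, p)) ∂(volume.prod volume) := by
  have h1 := coeFn_marginal (μ := (volume : Measure (RSpace d))) (ν := volume.prod volume)
    (Lp.compMeasurePreservingₗᵢ ℝ (shear (d := d)) measurePreserving_shear f)
  have h2 := Measure.ae_ae_of_ae_prod (Lp.coeFn_compMeasurePreserving f
    (measurePreserving_shear (d := d)))
  filter_upwards [h1, h2] with k hk hk'
  exact hk.trans (integral_congr_ae hk')

omit [NormedSpace ℝ E] in
theorem integrable_shear (f : Lp E 1 (vol₃ d)) :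
    Integrable (fun x => f (shear x)) (volume.prod (volume.prod volume)) :=
  (measurePreserving_shear (d := d)).integrable_comp_of_integrable (L1.integrable_coeFn f)

omit [NormedSpace ℝ E] in
theorem IsBddMul.comp_tsum₃ {φ : RSpace d → E} {C : ℝ} (h : IsBddMul volume φ C) :
    IsBddMul (vol₃ d) (fun K => φ (tsum₃ K)) C :=
  ⟨h.meas.comp_quasiMeasurePreserving quasiMeasurePreserving_tsum₃, h.nonneg, fun _ => h.bound _⟩

/-- The multiplier is constant on the fibres `k₁ + k₂ + k₃ = k` and passes through the integral. In
this way a phase or weight at the output frequency is combined with those at the three input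
frequencies. -/
theorem mulOp_push [CompleteSpace E] [CompleteSpace F] {φ : RSpace d → E →L[ℝ] F} {C : ℝ}
    (h : IsBddMul volume φ C) (f : Lp E 1 (vol₃ d)) :
    mulOp volume φ (push f) = push (mulOp (vol₃ d) (fun K => φ (tsum₃ K)) f) := by
  apply Lp.ext
  have h1 := Measure.ae_ae_of_ae_prod ((measurePreserving_shear (d := d)).quasiMeasurePreserving.ae
    (coeFn_mulOp h.comp_tsum₃ f))
  filter_upwards [coeFn_mulOp h (push f), coeFn_push f,
    coeFn_push (mulOp (vol₃ d) (fun K => φ (tsum₃ K)) f), h1, (integrable_shear f).prod_right_ae]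
    with k e1 e2 e3 e4 e5
  rw [e1, e2, e3, ← ContinuousLinearMap.integral_comp_comm _ e5]
  refine integral_congr_ae ?_
  filter_upwards [e4] with p hp
  rw [hp, tsum₃_shear]

end Push

/-! ### Trilinear tensor products on `L¹` -/

section Trilinear

variable {α : Type*} [MeasurableSpace α] {μ : Measure α} [SFinite μ]
  {E F G H : Type*} [NormedAddCommGroup E] [NormedSpace ℝ E] [NormedAddCommGroup F]
  [NormedSpace ℝ F] [NormedAddCommGroup G] [NormedSpace ℝ G] [NormedAddCommGroup H]
  [NormedSpace ℝ H] {M : Type*} [NormedAddCommGroup M] [NormedSpace ℝ M]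

/-- A norm bound of the trilinear map `B₂ (B₁ a b) c`. -/
def trilinearNorm (B₁ : E →L[ℝ] F →L[ℝ] M) (B₂ : M →L[ℝ] G →L[ℝ] H) : ℝ := ‖B₂‖ * ‖B₁‖

theorem trilinearNorm_nonneg (B₁ : E →L[ℝ] F →L[ℝ] M) (B₂ : M →L[ℝ] G →L[ℝ] H) :
    0 ≤ trilinearNorm B₁ B₂ :=
  mul_nonneg (norm_nonneg B₂) (norm_nonneg B₁)

/-- The tensor product `(x,y,z) ↦ B₂ (B₁ (f₁ x) (f₂ y)) (f₃ z)`. -/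
def trilinearTens (μ : Measure α) [SFinite μ] (B₁ : E →L[ℝ] F →L[ℝ] M) (B₂ : M →L[ℝ] G →L[ℝ] H)
    (f₁ : Lp E 1 μ) (f₂ : Lp F 1 μ) (f₃ : Lp G 1 μ) : Lp H 1 ((μ.prod μ).prod μ) :=
  tens (μ.prod μ) μ B₂ (tens μ μ B₁ f₁ f₂) f₃

theorem coeFn_trilinearTens (B₁ : E →L[ℝ] F →L[ℝ] M) (B₂ : M →L[ℝ] G →L[ℝ] H) (f₁ : Lp E 1 μ)
    (f₂ : Lp F 1 μ) (f₃ : Lp G 1 μ) :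
    trilinearTens μ B₁ B₂ f₁ f₂ f₃ =ᵐ[(μ.prod μ).prod μ]
      fun K => B₂ (B₁ (f₁ K.1.1) (f₂ K.1.2)) (f₃ K.2) := by
  have h := Measure.quasiMeasurePreserving_fst (ν := μ).ae_eq_comp
    (coeFn_tens (μ := μ) (ν := μ) B₁ f₁ f₂)
  filter_upwards [coeFn_tens B₂ (tens μ μ B₁ f₁ f₂) f₃, h] with K h1 h2
  have h3 : tens μ μ B₁ f₁ f₂ K.1 = B₁ (f₁ K.1.1) (f₂ K.1.2) := h2
  rw [trilinearTens, h1, h3]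

theorem norm_trilinearTens_le (B₁ : E →L[ℝ] F →L[ℝ] M) (B₂ : M →L[ℝ] G →L[ℝ] H) (f₁ : Lp E 1 μ)
    (f₂ : Lp F 1 μ) (f₃ : Lp G 1 μ) :
    ‖trilinearTens μ B₁ B₂ f₁ f₂ f₃‖ ≤ trilinearNorm B₁ B₂ * ‖f₁‖ * ‖f₂‖ * ‖f₃‖ := by
  refine (norm_tens_le _ _ _).trans ?_
  refine mul_le_mul_of_nonneg_right ?_ (norm_nonneg _)
  refine (mul_le_mul_of_nonneg_left (norm_tens_le _ _ _) (norm_nonneg B₂)).trans_eq ?_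
  rw [trilinearNorm]
  ring

theorem hasDerivAt_trilinearTens (B₁ : E →L[ℝ] F →L[ℝ] M) (B₂ : M →L[ℝ] G →L[ℝ] H)
    {g₁ : ℝ → Lp E 1 μ}
    {g₂ : ℝ → Lp F 1 μ} {g₃ : ℝ → Lp G 1 μ} {g₁' : Lp E 1 μ} {g₂' : Lp F 1 μ} {g₃' : Lp G 1 μ}
    {s : ℝ} (h₁ : HasDerivAt g₁ g₁' s) (h₂ : HasDerivAt g₂ g₂' s) (h₃ : HasDerivAt g₃ g₃' s) :
    HasDerivAt (fun s => trilinearTens μ B₁ B₂ (g₁ s) (g₂ s) (g₃ s))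
      (trilinearTens μ B₁ B₂ g₁' (g₂ s) (g₃ s) + trilinearTens μ B₁ B₂ (g₁ s) g₂' (g₃ s) +
        trilinearTens μ B₁ B₂ (g₁ s) (g₂ s) g₃') s := by
  have hA := (((tens μ μ B₁).hasFDerivAt.comp_hasDerivAt s h₁).clm_apply h₂)
  have hB := ((tens (μ.prod μ) μ B₂).hasFDerivAt.comp_hasDerivAt s hA).clm_apply h₃
  convert! hB using 1
  simp only [trilinearTens, map_add, add_apply, Function.comp]

theorem continuousOn_trilinearTens (B₁ : E →L[ℝ] F →L[ℝ] M) (B₂ : M →L[ℝ] G →L[ℝ] H)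
    {g₁ : ℝ → Lp E 1 μ}
    {g₂ : ℝ → Lp F 1 μ} {g₃ : ℝ → Lp G 1 μ} {s : Set ℝ}
    (h₁ : ContinuousOn g₁ s) (h₂ : ContinuousOn g₂ s) (h₃ : ContinuousOn g₃ s) :
    ContinuousOn (fun s => trilinearTens μ B₁ B₂ (g₁ s) (g₂ s) (g₃ s)) s :=
  ((tens (μ.prod μ) μ B₂).continuous.comp_continuousOn
    (((tens μ μ B₁).continuous.comp_continuousOn h₁).clm_apply h₂)).clm_apply h₃

theorem trilinearTens_sum {ι κ l : Type*} (B₁ : E →L[ℝ] F →L[ℝ] M) (B₂ : M →L[ℝ] G →L[ℝ] H)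
    (s : Finset ι) (t : Finset κ) (u : Finset l) (f : ι → Lp E 1 μ) (g : κ → Lp F 1 μ)
    (h : l → Lp G 1 μ) :
    trilinearTens μ B₁ B₂ (∑ i ∈ s, f i) (∑ i ∈ t, g i) (∑ i ∈ u, h i) =
      ∑ k ∈ u, ∑ j ∈ t, ∑ i ∈ s, trilinearTens μ B₁ B₂ (f i) (g j) (h k) := by
  simp only [trilinearTens, map_sum, sum_apply]

theorem trilinearTens_sub_left (B₁ : E →L[ℝ] F →L[ℝ] M) (B₂ : M →L[ℝ] G →L[ℝ] H)
    (f f' : Lp E 1 μ) (g : Lp F 1 μ)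
    (h : Lp G 1 μ) : trilinearTens μ B₁ B₂ (f - f') g h =
      trilinearTens μ B₁ B₂ f g h - trilinearTens μ B₁ B₂ f' g h := by
  simp only [trilinearTens, map_sub, sub_apply]

theorem trilinearTens_sub_mid (B₁ : E →L[ℝ] F →L[ℝ] M) (B₂ : M →L[ℝ] G →L[ℝ] H)
    (f : Lp E 1 μ) (g g' : Lp F 1 μ)
    (h : Lp G 1 μ) : trilinearTens μ B₁ B₂ f (g - g') h =
      trilinearTens μ B₁ B₂ f g h - trilinearTens μ B₁ B₂ f g' h := by
  simp only [trilinearTens, map_sub, sub_apply]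

theorem trilinearTens_sub_right (B₁ : E →L[ℝ] F →L[ℝ] M) (B₂ : M →L[ℝ] G →L[ℝ] H)
    (f : Lp E 1 μ) (g : Lp F 1 μ)
    (h h' : Lp G 1 μ) : trilinearTens μ B₁ B₂ f g (h - h') =
      trilinearTens μ B₁ B₂ f g h - trilinearTens μ B₁ B₂ f g h' := by
  simp only [trilinearTens, map_sub]

end Trilinear

/-! ### The trilinear term on frequency triples and its convolution -/

variable {d n : ℕ}

namespace Data

theorem TC_smul_left (S : Data d n) (z : ℂ) (a b c : CSpace n) :
    S.TC (z • a) b c = z • S.TC a b c := by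
  ext q
  simp [TC, Finset.mul_sum, mul_assoc]

theorem TC_smul_mid (S : Data d n) (z : ℂ) (a b c : CSpace n) :
    S.TC a (z • b) c = z • S.TC a b c := by
  ext q
  simp only [TC, PiLp.smul_apply, smul_eq_mul, Finset.mul_sum]
  refine Finset.sum_congr rfl fun _ _ => Finset.sum_congr rfl fun _ _ =>
    Finset.sum_congr rfl fun _ _ => by ring

theorem TC_smul_right (S : Data d n) (z : ℂ) (a b c : CSpace n) :
    S.TC a b (z • c) = z • S.TC a b c := by
  ext q
  simp only [TC, PiLp.smul_apply, smul_eq_mul, Finset.mul_sum]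
  refine Finset.sum_congr rfl fun _ _ => Finset.sum_congr rfl fun _ _ =>
    Finset.sum_congr rfl fun _ _ => by ring

/-- The outer product of two vectors. -/
def outerL (n : ℕ) : CSpace n →L[ℝ] CSpace n →L[ℝ] EuclideanSpace ℂ (Fin n × Fin n) :=
  LinearMap.toContinuousBilinearMap
    (LinearMap.mk₂ ℝ (fun a b => WithLp.toLp 2 fun i => a i.1 * b i.2)
      (fun a a' b => by ext i; simp [add_mul])
      (fun r a b => by ext i; simp [mul_assoc])
      (fun a b b' => by ext i; simp [mul_add])
      (fun r a b => by ext i; simp; ring))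

/-- Contraction of the trilinear extension of `T` with a matrix and a vector. -/
def contractL (S : Data d n) :
    EuclideanSpace ℂ (Fin n × Fin n) →L[ℝ] CSpace n →L[ℝ] CSpace n :=
  LinearMap.toContinuousBilinearMap
    (LinearMap.mk₂ ℝ (fun m c => WithLp.toLp 2 fun q => ∑ i₁, ∑ i₂, ∑ i₃, m (i₁, i₂) * c i₃ *
        ((S.T (Pi.single i₁ 1) (Pi.single i₂ 1) (Pi.single i₃ 1) q : ℝ) : ℂ))
      (fun a a' b => by ext i; simp [add_mul, Finset.sum_add_distrib])
      (fun r a b => by ext i; simp [mul_assoc, Finset.mul_sum])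
      (fun a b b' => by ext i; simp [mul_add, add_mul, Finset.sum_add_distrib])
      (fun r a b => by
        ext i
        simp only [PiLp.smul_apply, real_smul, Finset.mul_sum]
        refine Finset.sum_congr rfl fun _ _ => Finset.sum_congr rfl fun _ _ =>
          Finset.sum_congr rfl fun _ _ => by ring))

/-- Factoring the trilinear map through the outer product reduces it to two bilinear maps, to which
`tens` applies. -/
theorem contractL_outerL (S : Data d n) (a b c : CSpace n) :
    S.contractL (outerL n a b) c = S.TC a b c := rfl

/-- The tensor product `(k₁,k₂,k₃) ↦ T(f₁(k₁), f₂(k₂), f₃(k₃))`. -/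
def tens₃ (S : Data d n) (f₁ f₂ f₃ : LOne d n) : Lp (CSpace n) 1 (vol₃ d) :=
  trilinearTens volume (outerL n) S.contractL f₁ f₂ f₃

theorem coeFn_tens₃ (S : Data d n) (f₁ f₂ f₃ : LOne d n) :
    S.tens₃ f₁ f₂ f₃ =ᵐ[vol₃ d] fun K => S.TC (f₁ K.1.1) (f₂ K.1.2) (f₃ K.2) :=
  coeFn_trilinearTens _ _ _ _ _

theorem norm_tens₃_le (S : Data d n) (f₁ f₂ f₃ : LOne d n) :
    ‖S.tens₃ f₁ f₂ f₃‖ ≤ trilinearNorm (outerL n) S.contractL * ‖f₁‖ * ‖f₂‖ * ‖f₃‖ :=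
  norm_trilinearTens_le _ _ _ _ _

theorem hasDerivAt_tens₃ (S : Data d n) {g₁ g₂ g₃ : ℝ → LOne d n} {g₁' g₂' g₃' : LOne d n}
    {s : ℝ} (h₁ : HasDerivAt g₁ g₁' s) (h₂ : HasDerivAt g₂ g₂' s) (h₃ : HasDerivAt g₃ g₃' s) :
    HasDerivAt (fun s => S.tens₃ (g₁ s) (g₂ s) (g₃ s))
      (S.tens₃ g₁' (g₂ s) (g₃ s) + S.tens₃ (g₁ s) g₂' (g₃ s) + S.tens₃ (g₁ s) (g₂ s) g₃') s :=
  hasDerivAt_trilinearTens (outerL n) S.contractL h₁ h₂ h₃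

theorem continuousOn_tens₃ (S : Data d n) {g₁ g₂ g₃ : ℝ → LOne d n} {s : Set ℝ}
    (h₁ : ContinuousOn g₁ s) (h₂ : ContinuousOn g₂ s) (h₃ : ContinuousOn g₃ s) :
    ContinuousOn (fun s => S.tens₃ (g₁ s) (g₂ s) (g₃ s)) s :=
  continuousOn_trilinearTens (outerL n) S.contractL h₁ h₂ h₃

end Data

theorem quasiMeasurePreserving_fst_fst :
    Measure.QuasiMeasurePreserving (fun K : Triple d => K.1.1) (vol₃ d) volume :=
  Measure.quasiMeasurePreserving_fst.comp Measure.quasiMeasurePreserving_fst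

theorem quasiMeasurePreserving_fst_snd :
    Measure.QuasiMeasurePreserving (fun K : Triple d => K.1.2) (vol₃ d) volume :=
  Measure.quasiMeasurePreserving_snd.comp Measure.quasiMeasurePreserving_fst

theorem quasiMeasurePreserving_snd' :
    Measure.QuasiMeasurePreserving (fun K : Triple d => K.2) (vol₃ d) volume :=
  Measure.quasiMeasurePreserving_snd

theorem IsBddMul.comp_qmp {α β E : Type*} [MeasurableSpace α] [MeasurableSpace β]
    [NormedAddCommGroup E] {μ : Measure α} {ν : Measure β} {φ : β → E} {C : ℝ}
    (h : IsBddMul ν φ C) {f : α → β} (hf : Measure.QuasiMeasurePreserving f μ ν) :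
    IsBddMul μ (fun K => φ (f K)) C :=
  ⟨h.meas.comp_quasiMeasurePreserving hf, h.nonneg, fun _ => h.bound _⟩

theorem IsBddMul.sub' {α E : Type*} [MeasurableSpace α] [NormedAddCommGroup E] {μ : Measure α}
    {φ ψ : α → E} {C C' : ℝ} (h : IsBddMul μ φ C) (h' : IsBddMul μ ψ C') :
    IsBddMul μ (fun k => φ k - ψ k) (C + C') :=
  ⟨h.meas.sub h'.meas, add_nonneg h.nonneg h'.nonneg,
    fun k => (norm_sub_le _ _).trans (add_le_add (h.bound k) (h'.bound k))⟩

namespace Data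

theorem tens₃_cmul (S : Data d n) {c₁ c₂ c₃ : RSpace d → ℂ} {C₁ C₂ C₃ : ℝ}
    (h₁ : IsBddMul volume c₁ C₁) (h₂ : IsBddMul volume c₂ C₂) (h₃ : IsBddMul volume c₃ C₃)
    (f₁ f₂ f₃ : LOne d n) :
    S.tens₃ (mulOp volume (cmul n c₁) f₁) (mulOp volume (cmul n c₂) f₂)
        (mulOp volume (cmul n c₃) f₃) =
      mulOp (vol₃ d) (cmul n fun K => c₁ K.1.1 * c₂ K.1.2 * c₃ K.2) (S.tens₃ f₁ f₂ f₃) := by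
  apply Lp.ext
  have hb : IsBddMul (vol₃ d) (fun K : Triple d => c₁ K.1.1 * c₂ K.1.2 * c₃ K.2) (C₁ * C₂ * C₃) :=
    ((h₁.comp_qmp quasiMeasurePreserving_fst_fst).mul
      (h₂.comp_qmp quasiMeasurePreserving_fst_snd)).mul (h₃.comp_qmp quasiMeasurePreserving_snd')
  filter_upwards [S.coeFn_tens₃ f₁ f₂ f₃, S.coeFn_tens₃ (mulOp volume (cmul n c₁) f₁)
      (mulOp volume (cmul n c₂) f₂) (mulOp volume (cmul n c₃) f₃),
    coeFn_mulOp (isBddMul_cmul hb) (S.tens₃ f₁ f₂ f₃),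
    quasiMeasurePreserving_fst_fst.ae (coeFn_mulOp (isBddMul_cmul h₁) f₁),
    quasiMeasurePreserving_fst_snd.ae (coeFn_mulOp (isBddMul_cmul h₂) f₂),
    quasiMeasurePreserving_snd'.ae (coeFn_mulOp (isBddMul_cmul h₃) f₃)]
    with K e1 e2 e3 e4 e5 e6
  rw [e3, e2, e1, e4, e5, e6, cmul_apply, cmul_apply, cmul_apply, cmul_apply, TC_smul_left,
    TC_smul_mid, TC_smul_right, smul_smul, smul_smul]

/-- The constant `(2π)^(-d)` relating products and convolutions. -/
def convConst (d : ℕ) : ℝ := ((2 * Real.pi) ^ (-(d : ℝ) / 2)) ^ 2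

theorem convConst_nonneg : 0 ≤ convConst d := sq_nonneg _

/-- The Fourier transform of `T(f₁,f₂,f₃)`, in terms of the Fourier transforms of the `fᵢ`. -/
def conv (S : Data d n) (f₁ f₂ f₃ : LOne d n) : LOne d n :=
  convConst d • push (S.tens₃ f₁ f₂ f₃)

/-- The norm bound of the trilinear map `conv`. -/
def convBound (S : Data d n) : ℝ := convConst d * trilinearNorm (outerL n) S.contractL

theorem convBound_nonneg (S : Data d n) : 0 ≤ S.convBound :=
  mul_nonneg convConst_nonneg (trilinearNorm_nonneg _ _)

theorem norm_convConst_smul_push_le (f : Lp (CSpace n) 1 (vol₃ d)) :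
    ‖convConst d • push f‖ ≤ convConst d * ‖f‖ := by
  rw [norm_smul, Real.norm_of_nonneg convConst_nonneg]
  exact mul_le_mul_of_nonneg_left (norm_push_le f) convConst_nonneg

theorem norm_conv_le (S : Data d n) (f₁ f₂ f₃ : LOne d n) :
    ‖S.conv f₁ f₂ f₃‖ ≤ S.convBound * ‖f₁‖ * ‖f₂‖ * ‖f₃‖ := by
  refine (norm_convConst_smul_push_le _).trans ?_
  refine (mul_le_mul_of_nonneg_left (S.norm_tens₃_le f₁ f₂ f₃) convConst_nonneg).trans_eq ?_
  rw [convBound]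
  ring

theorem conv_sum {ι : Type*} (S : Data d n) (s t u : Finset ι) (f g h : ι → LOne d n) :
    S.conv (∑ i ∈ s, f i) (∑ i ∈ t, g i) (∑ i ∈ u, h i) =
      ∑ k ∈ u, ∑ j ∈ t, ∑ i ∈ s, S.conv (f i) (g j) (h k) := by
  simp only [conv, tens₃, trilinearTens_sum, map_sum, Finset.smul_sum]

/-- Telescoping: the arguments are exchanged one at a time. -/
theorem norm_conv_sub_conv_le (S : Data d n) (f₁ f₂ f₃ g₁ g₂ g₃ : LOne d n) :
    ‖S.conv f₁ f₂ f₃ - S.conv g₁ g₂ g₃‖ ≤ S.convBound * (‖f₁ - g₁‖ * ‖f₂‖ * ‖f₃‖ +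
      ‖g₁‖ * ‖f₂ - g₂‖ * ‖f₃‖ + ‖g₁‖ * ‖g₂‖ * ‖f₃ - g₃‖) := by
  have h : S.conv f₁ f₂ f₃ - S.conv g₁ g₂ g₃ = S.conv (f₁ - g₁) f₂ f₃ + S.conv g₁ (f₂ - g₂) f₃ +
      S.conv g₁ g₂ (f₃ - g₃) := by
    simp only [conv, tens₃, trilinearTens_sub_left, trilinearTens_sub_mid,
      trilinearTens_sub_right, map_sub, smul_sub]
    abel
  rw [h]
  refine norm_add₃_le.trans ((add_le_add (add_le_add (S.norm_conv_le _ _ _)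
    (S.norm_conv_le _ _ _)) (S.norm_conv_le _ _ _)).trans_eq ?_)
  ring

/-- On triples, `m(k₁+k₂+k₃)` is the product of the three individual weights times a multiplier
bounded by `M`. The bound `R` of the weight enters only as a qualitative hypothesis, so the constant
is uniform in it. -/
theorem norm_weight_conv_le (S : Data d n) {m : RSpace d → ℝ} {R M : ℝ} (hm : IsBddMul volume m R)
    (hpos : ∀ k, 1 ≤ m k) (hM : 0 ≤ M)
    (hsub : ∀ k₁ k₂ k₃, m (k₁ + k₂ + k₃) ≤ M * (m k₁ * m k₂ * m k₃)) (f₁ f₂ f₃ : LOne d n) :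
    ‖mulOp volume (cmul n fun k => (m k : ℂ)) (S.conv f₁ f₂ f₃)‖ ≤
      M * S.convBound * ‖mulOp volume (cmul n fun k => (m k : ℂ)) f₁‖ *
        ‖mulOp volume (cmul n fun k => (m k : ℂ)) f₂‖ *
        ‖mulOp volume (cmul n fun k => (m k : ℂ)) f₃‖ := by
  have hmc : IsBddMul volume (fun k => (m k : ℂ)) R := isBddMul_ofReal hm
  have hb : IsBddMul (vol₃ d) (fun K : Triple d => (m K.1.1 : ℂ) * m K.1.2 * m K.2) (R * R * R) :=
    ((hmc.comp_qmp quasiMeasurePreserving_fst_fst).mul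
      (hmc.comp_qmp quasiMeasurePreserving_fst_snd)).mul (hmc.comp_qmp quasiMeasurePreserving_snd')
  have hpos' : ∀ K : Triple d, 0 < m K.1.1 * m K.1.2 * m K.2 := fun K =>
    mul_pos (mul_pos (zero_lt_one.trans_le (hpos _)) (zero_lt_one.trans_le (hpos _)))
      (zero_lt_one.trans_le (hpos _))
  have hθ : IsBddMul (vol₃ d)
      (fun K : Triple d => (m (tsum₃ K) : ℂ) * ((m K.1.1 : ℂ) * m K.1.2 * m K.2)⁻¹) M := by
    refine ⟨(hmc.comp_tsum₃).meas.mul (hb.meas.aemeasurable.inv).aestronglyMeasurable, hM,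
      fun K => ?_⟩
    rw [← ofReal_mul, ← ofReal_mul, ← ofReal_inv, ← ofReal_mul, norm_real, Real.norm_eq_abs,
      abs_of_nonneg (mul_nonneg (zero_le_one.trans (hpos _)) (inv_nonneg.2 (hpos' K).le)),
      ← div_eq_mul_inv, div_le_iff₀ (hpos' K)]
    exact hsub _ _ _
  have key : mulOp volume (cmul n fun k => (m k : ℂ)) (S.conv f₁ f₂ f₃) =
      convConst d • push (mulOp (vol₃ d) (cmul n fun K : Triple d =>
        (m (tsum₃ K) : ℂ) * ((m K.1.1 : ℂ) * m K.1.2 * m K.2)⁻¹) (S.tens₃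
        (mulOp volume (cmul n fun k => (m k : ℂ)) f₁)
        (mulOp volume (cmul n fun k => (m k : ℂ)) f₂)
        (mulOp volume (cmul n fun k => (m k : ℂ)) f₃))) := by
    rw [conv, map_smul, mulOp_push (isBddMul_cmul hmc), S.tens₃_cmul hmc hmc hmc,
      mulOp_mulOp (isBddMul_cmul hθ) (isBddMul_cmul hb) (isBddMul_cmul hmc.comp_tsum₃)]
    · rfl
    · intro K
      ext1 w
      simp only [ContinuousLinearMap.comp_apply, cmul_apply, smul_smul]
      congr 1
      have : (m K.1.1 : ℂ) * m K.1.2 * m K.2 ≠ 0 := by exact_mod_cast (hpos' K).ne'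
      rw [mul_assoc, inv_mul_cancel₀ this, mul_one]
  rw [key]
  refine (norm_convConst_smul_push_le _).trans ?_
  refine (mul_le_mul_of_nonneg_left ((norm_mulOp_apply_le (isBddMul_cmul hθ) _).trans
    (mul_le_mul_of_nonneg_left (S.norm_tens₃_le _ _ _) hM)) convConst_nonneg).trans_eq ?_
  rw [convBound]
  ring

/-- A primitive of the oscillating trilinear term. -/
theorem exists_corrector (S : Data d n) {q₀ q₁ q₂ q₃ : RSpace d → ℝ} {Q₀ Q₁ Q₂ Q₃ δ : ℝ}
    (h₀ : IsBddMul volume q₀ Q₀) (h₁ : IsBddMul volume q₁ Q₁) (h₂ : IsBddMul volume q₂ Q₂)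
    (h₃ : IsBddMul volume q₃ Q₃) (hδ : 0 < δ)
    (hlow : ∀ k₁ k₂ k₃, δ ≤ |q₀ (k₁ + k₂ + k₃) - q₁ k₁ - q₂ k₂ - q₃ k₃|)
    (g₁ g₂ g₃ : ℝ → LOne d n) (T : ℝ) :
    ∃ c : ℝ → LOne d n, c T = 0 ∧
      (∀ s, ‖c s‖ ≤ 2 / δ * S.convBound * ‖g₁ s‖ * ‖g₂ s‖ * ‖g₃ s‖) ∧
      (∀ A : Set ℝ, ContinuousOn g₁ A → ContinuousOn g₂ A → ContinuousOn g₃ A →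
        ContinuousOn c A) ∧
      ∀ s g₁' g₂' g₃', HasDerivAt g₁ g₁' s → HasDerivAt g₂ g₂' s → HasDerivAt g₃ g₃' s →
        ∃ e, HasDerivAt c (mulOp volume (cmul n (phase q₀ s))
            (S.conv (mulOp volume (cmul n (phase q₁ (-s))) (g₁ s))
              (mulOp volume (cmul n (phase q₂ (-s))) (g₂ s))
              (mulOp volume (cmul n (phase q₃ (-s))) (g₃ s))) + e) s ∧
          ‖e‖ ≤ 2 / δ * S.convBound * (‖g₁'‖ * ‖g₂ s‖ * ‖g₃ s‖ + ‖g₁ s‖ * ‖g₂'‖ * ‖g₃ s‖ +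
            ‖g₁ s‖ * ‖g₂ s‖ * ‖g₃'‖) := by
  -- Once all four phases are moved to triples they merge into `exp(i s Φ)`. The corrector is the
  -- same convolution with this factor replaced by its primitive `oscPrim Φ T s`.
  let Φ : Triple d → ℝ := fun K => q₀ (tsum₃ K) - q₁ K.1.1 - q₂ K.1.2 - q₃ K.2
  have hΦ : IsBddMul (vol₃ d) Φ (Q₀ + Q₁ + Q₂ + Q₃) :=
    ((h₀.comp_tsum₃.sub' (h₁.comp_qmp quasiMeasurePreserving_fst_fst)).sub'
      (h₂.comp_qmp quasiMeasurePreserving_fst_snd)).sub' (h₃.comp_qmp quasiMeasurePreserving_snd')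
  have hlow' : ∀ K, δ ≤ |Φ K| := fun K => hlow _ _ _
  have hosc := fun s => isBddMul_oscPrim hΦ hδ hlow' T s
  have hbd : ∀ s, ∀ f : Lp (CSpace n) 1 (vol₃ d),
      ‖convConst d • push (mulOp (vol₃ d) (cmul n (oscPrim Φ T s)) f)‖ ≤
        2 / δ * convConst d * ‖f‖ := fun s f =>
    (norm_convConst_smul_push_le _).trans ((mul_le_mul_of_nonneg_left
      (norm_mulOp_apply_le (isBddMul_cmul (hosc s)) f) convConst_nonneg).trans_eq (by ring))
  have hcoef : 0 ≤ 2 / δ * convConst d := mul_nonneg (by positivity) convConst_nonneg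
  refine ⟨fun s => convConst d • push (mulOp (vol₃ d) (cmul n (oscPrim Φ T s))
    (S.tens₃ (g₁ s) (g₂ s) (g₃ s))), ?_, fun s => ?_, fun A c₁ c₂ c₃ => ?_,
    fun s g₁' g₂' g₃' d₁ d₂ d₃ => ?_⟩
  · simp only [oscPrim_self, zero_apply, map_zero, smul_zero]
  · refine (hbd s _).trans ?_
    refine (mul_le_mul_of_nonneg_left (S.norm_tens₃_le _ _ _) hcoef).trans_eq ?_
    rw [convBound]
    ring
  · have hc : Continuous fun s => mulOp (vol₃ d) (cmul n (oscPrim Φ T s)) :=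
      continuous_iff_continuousAt.2 fun s => (hasDerivAt_oscPrim hΦ hδ hlow' T s).continuousAt
    exact (push.continuous.comp_continuousOn
      (hc.continuousOn.clm_apply (S.continuousOn_tens₃ c₁ c₂ c₃))).const_smul (convConst d)
  · have hd := ((push (E := CSpace n)).hasFDerivAt.comp_hasDerivAt s
      ((hasDerivAt_oscPrim (n := n) hΦ hδ hlow' T s).clm_apply
        (S.hasDerivAt_tens₃ d₁ d₂ d₃))).const_smul (convConst d)
    -- Product rule: differentiating the primitive returns the oscillating term, and `e` collects
    -- the three terms in which a slow factor `gᵢ` is differentiated.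
    refine ⟨convConst d • push (mulOp (vol₃ d) (cmul n (oscPrim Φ T s))
      (S.tens₃ g₁' (g₂ s) (g₃ s) + S.tens₃ (g₁ s) g₂' (g₃ s) + S.tens₃ (g₁ s) (g₂ s) g₃')), ?_, ?_⟩
    · convert! hd using 1
      rw [(push (E := CSpace n)).map_add, smul_add]
      congr 1
      have hb := ((isBddMul_phase h₁ (-s)).comp_qmp quasiMeasurePreserving_fst_fst).mul
        ((isBddMul_phase h₂ (-s)).comp_qmp quasiMeasurePreserving_fst_snd) |>.mul
        ((isBddMul_phase h₃ (-s)).comp_qmp quasiMeasurePreserving_snd')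
      rw [conv, S.tens₃_cmul (isBddMul_phase h₁ (-s)) (isBddMul_phase h₂ (-s))
        (isBddMul_phase h₃ (-s)), map_smul, mulOp_push (isBddMul_cmul (isBddMul_phase h₀ s)),
        mulOp_mulOp (isBddMul_cmul (isBddMul_phase h₀ s)).comp_tsum₃ (isBddMul_cmul hb)
          (isBddMul_cmul (isBddMul_phase hΦ s))]
      intro K
      ext1 w
      simp only [ContinuousLinearMap.comp_apply, cmul_apply, smul_smul]
      congr 1
      simp only [phase, ← Complex.exp_add, Φ]
      congr 1
      push_cast
      ring
    · refine (hbd s _).trans ?_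
      refine (mul_le_mul_of_nonneg_left ((norm_add₃_le).trans (add_le_add (add_le_add
        (S.norm_tens₃_le _ _ _) (S.norm_tens₃_le _ _ _)) (S.norm_tens₃_le _ _ _))) hcoef).trans_eq ?_
      rw [convBound]
      ring

end Data

theorem integral_trilinear {α : Type*} [MeasurableSpace α] {μ : Measure α} [SFinite μ]
    {E F G H M : Type*} [NormedAddCommGroup E] [NormedSpace ℝ E] [NormedAddCommGroup F]
    [NormedSpace ℝ F] [NormedAddCommGroup G] [NormedSpace ℝ G] [NormedAddCommGroup H]
    [NormedSpace ℝ H] [NormedAddCommGroup M] [NormedSpace ℝ M] [CompleteSpace E] [CompleteSpace F]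
    [CompleteSpace G] [CompleteSpace M] [CompleteSpace H]
    (B₁ : E →L[ℝ] F →L[ℝ] M) (B₂ : M →L[ℝ] G →L[ℝ] H) {f : α → E} {g : α → F} {h : α → G}
    (hf : Integrable f μ) (hg : Integrable g μ) (hh : Integrable h μ) :
    ∫ K, B₂ (B₁ (f K.1.1) (g K.1.2)) (h K.2) ∂((μ.prod μ).prod μ) =
      B₂ (B₁ (∫ x, f x ∂μ) (∫ x, g x ∂μ)) (∫ x, h x ∂μ) := by
  have i12 : Integrable (fun z : α × α => B₁ (f z.1) (g z.2)) (μ.prod μ) :=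
    Integrable.op_fst_snd (op := fun x y => B₁ x y) (by fun_prop)
      ⟨‖B₁‖, fun x y => B₁.le_opNorm₂ x y⟩ hf hg
  rw [integral_prod_bilin B₂ i12 hh, integral_prod_bilin B₁ hf hg]

/-! ### Inverse Fourier integrals -/

/-- The inverse Fourier integral of a function. -/
def wfun (h : RSpace d → CSpace n) (x : RSpace d) : CSpace n :=
  (2 * Real.pi) ^ (-(d : ℝ) / 2) • ∫ k, Complex.exp (I * (inner ℝ k x : ℝ)) • h k

theorem norm_exp_inner (k x : RSpace d) : ‖Complex.exp (I * (inner ℝ k x : ℝ))‖ = 1 := by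
  rw [mul_comm, norm_exp_ofReal_mul_I]

theorem integrable_exp_smul {h : RSpace d → CSpace n} (hh : Integrable h) (x : RSpace d) :
    Integrable fun k => Complex.exp (I * (inner ℝ k x : ℝ)) • h k := by
  have hc : Continuous fun k : RSpace d => Complex.exp (I * (inner ℝ k x : ℝ)) := by fun_prop
  refine hh.norm.mono' (hc.aestronglyMeasurable.smul hh.1) (ae_of_all _ fun k => ?_)
  rw [norm_smul, norm_exp_inner, one_mul]

theorem wfun_congr {h h' : RSpace d → CSpace n} (e : h =ᵐ[volume] h') (x : RSpace d) :
    wfun h x = wfun h' x := by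
  unfold wfun
  congr 1
  refine integral_congr_ae ?_
  filter_upwards [e] with k hk
  rw [hk]

theorem wfun_add {h h' : RSpace d → CSpace n} (hh : Integrable h) (hh' : Integrable h')
    (x : RSpace d) : wfun (fun k => h k + h' k) x = wfun h x + wfun h' x := by
  unfold wfun
  rw [← smul_add, ← integral_add (integrable_exp_smul hh x) (integrable_exp_smul hh' x)]
  simp only [smul_add]

theorem wfun_sum {ι : Type*} (s : Finset ι) {h : ι → RSpace d → CSpace n}
    (hh : ∀ i ∈ s, Integrable (h i)) (x : RSpace d) :
    wfun (fun k => ∑ i ∈ s, h i k) x = ∑ i ∈ s, wfun (h i) x := by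
  unfold wfun
  rw [← Finset.smul_sum, ← integral_finsetSum _ fun i hi => integrable_exp_smul (hh i hi) x]
  simp only [Finset.smul_sum]

theorem wfun_clm {h : RSpace d → CSpace n} (hh : Integrable h) (M : CSpace n →ₗ[ℂ] CSpace n)
    (x : RSpace d) : wfun (fun k => M (h k)) x = M (wfun h x) := by
  unfold wfun
  rw [← coe_smul, ← coe_smul, map_smul]
  congr 1
  have := (LinearMap.toContinuousLinearMap M).integral_comp_comm (integrable_exp_smul hh x)
  simpa using this

theorem wfun_smul (h : RSpace d → CSpace n) (z : ℂ)
    (x : RSpace d) : wfun (fun k => z • h k) x = z • wfun h x := by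
  unfold wfun
  rw [smul_comm z]
  congr 1
  rw [← integral_smul]
  exact integral_congr_ae (ae_of_all _ fun k => smul_comm _ _ _)

theorem wienerFun_eq (g : LOne d n) (x : RSpace d) : wienerFun g x = wfun g x := rfl

theorem wienerFun_toL1 {h : RSpace d → CSpace n} (hh : Integrable h) (x : RSpace d) :
    wienerFun (hh.toL1 h) x = wfun h x :=
  wfun_congr hh.coeFn_toL1 x

/-- `wienerFun` at a fixed point, as a continuous linear map. -/
def wienerL (x : RSpace d) : LOne d n →L[ℝ] CSpace n :=
  LinearMap.mkContinuous
    { toFun := fun g => wienerFun g x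
      map_add' := fun g g' => by
        rw [wienerFun_eq, wfun_congr (Lp.coeFn_add g g')]
        exact wfun_add (L1.integrable_coeFn g) (L1.integrable_coeFn g') x
      map_smul' := fun r g => by
        rw [wienerFun_eq, wfun_congr (Lp.coeFn_smul r g), RingHom.id_apply, ← coe_smul]
        exact wfun_smul g r x } ((2 * Real.pi) ^ (-(d : ℝ) / 2)) (fun g => by
      simp only [LinearMap.coe_mk, AddHom.coe_mk]
      rw [wienerFun, norm_smul, Real.norm_of_nonneg (by positivity), L1.norm_eq_integral_norm]
      refine mul_le_mul_of_nonneg_left ((norm_integral_le_integral_norm _).trans_eq ?_)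
        (by positivity)
      simp only [norm_smul, norm_exp_inner, one_mul])

theorem wienerL_apply (x : RSpace d) (g : LOne d n) : wienerL x g = wienerFun g x := rfl

/-- The kernel `exp(i k·x)` turns into `exp(2π i k·y)` after the rescaling `y = x/(2π)`. -/
theorem wfun_eq_fourierInv (h : RSpace d → CSpace n) (x : RSpace d) :
    wfun h x = (2 * Real.pi) ^ (-(d : ℝ) / 2) • FourierTransformInv.fourierInv h ((2 * Real.pi)⁻¹ • x) := by
  rw [wfun, Real.fourierInv_eq']
  congr 1
  refine integral_congr_ae (ae_of_all _ fun k => ?_)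
  simp only [inner_smul_right]
  rw [mul_inv_cancel_left₀ (by positivity), mul_comm]

theorem continuous_wfun {h : RSpace d → CSpace n} (hh : Integrable h) : Continuous (wfun h) := by
  have : Continuous fun x => ∫ k, Complex.exp (I * (inner ℝ k x : ℝ)) • h k := by
    refine continuous_of_dominated (F := fun x k => Complex.exp (I * (inner ℝ k x : ℝ)) • h k)
      (fun x => (integrable_exp_smul hh x).1) (bound := fun k => ‖h k‖)
      (fun x => ae_of_all _ fun k => ?_) hh.norm (ae_of_all _ fun k => by fun_prop)
    rw [norm_smul, norm_exp_inner, one_mul]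
  exact this.const_smul ((2 * Real.pi) ^ (-(d : ℝ) / 2) : ℝ)

/-- Uniqueness for the Fourier transform on `L¹`. -/
theorem eq_zero_of_wienerFun {g : LOne d n} (hg : ∀ᵐ x, wienerFun g x = 0) : g = 0 := by
  have hall : ∀ x, wfun g x = 0 := by
    have : wfun g = fun _ => 0 :=
      (continuous_wfun (L1.integrable_coeFn g)).ae_eq_iff_eq volume continuous_const |>.1 hg
    exact fun x => congrFun this x
  have hF : ∀ ξ, FourierTransformInv.fourierInv (g : RSpace d → CSpace n) ξ = 0 := by
    intro ξ
    have := hall ((2 * Real.pi) • ξ)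
    rw [wfun_eq_fourierInv, smul_smul, inv_mul_cancel₀ (by positivity), one_smul] at this
    exact (smul_eq_zero.1 this).resolve_left (by positivity)
  rw [Lp.eq_zero_iff_ae_eq_zero]
  refine ae_eq_zero_of_integral_contDiff_smul_eq_zero
    ((L1.integrable_coeFn g).locallyIntegrable) fun φ φ_smooth φ_cpt => ?_
  have hφ₁ : HasCompactSupport (Complex.ofRealCLM ∘ φ) := φ_cpt.comp_left rfl
  have hφ₂ : ContDiff ℝ ((⊤ : ℕ∞) : WithTop ℕ∞) (Complex.ofRealCLM ∘ φ) := by fun_prop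
  let ψ : SchwartzMap (RSpace d) ℂ := hφ₁.toSchwartzMap hφ₂
  have hψ : ∀ k, (FourierTransformInv.fourierInv (FourierTransform.fourier ψ)) k = (φ k : ℂ) := by
    intro k
    rw [FourierTransform.fourierInv_fourier_eq]
    rfl
  -- The test function is written as an inverse transform of `ψ̂`, and the transform is moved onto
  -- `g` by duality, where it vanishes. The sign in `-innerₗ` selects the inverse kernel.
  have key := VectorFourier.integral_fourierIntegral_smul_eq_flip (e := Real.fourierChar)
    (μ := (volume : Measure (RSpace d))) (ν := (volume : Measure (RSpace d)))
    (L := -innerₗ (RSpace d)) (f := (FourierTransform.fourier ψ)) (g := (g : RSpace d → CSpace n))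
    Real.continuous_fourierChar (by
      have : Continuous fun p : RSpace d × RSpace d => -(inner ℝ p.1 p.2 : ℝ) := by fun_prop
      exact this)
    (FourierTransform.fourier ψ).integrable (L1.integrable_coeFn g)
  have e1 : ∀ k, VectorFourier.fourierIntegral Real.fourierChar volume (-innerₗ (RSpace d))
      (FourierTransform.fourier ψ) k = (φ k : ℂ) := by
    intro k
    rw [← hψ k, SchwartzMap.fourierInv_coe]
    rfl
  have e2 : ∀ k, VectorFourier.fourierIntegral Real.fourierChar volume (-innerₗ (RSpace d)).flip
      (g : RSpace d → CSpace n) k = 0 := by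
    intro k
    rw [← hF k]
    have : (-innerₗ (RSpace d)).flip = -innerₗ (RSpace d) := by
      ext x y
      simp [real_inner_comm]
    rw [this]
    rfl
  simp only [e1, e2, smul_zero, integral_zero] at key
  simpa using key

/-! ### Conjugation -/

/-- `v ↦ v̄` as a continuous real-linear map. -/
def conjL (n : ℕ) : CSpace n →L[ℝ] CSpace n :=
  LinearMap.toContinuousLinearMap
    { toFun := conjC
      map_add' := fun v w => by ext i; simp [conjC]
      map_smul' := fun r v => by ext i; simp [conjC] }

theorem conjL_apply (v : CSpace n) : conjL n v = conjC v := rfl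

theorem norm_conjC (v : CSpace n) : ‖conjC v‖ = ‖v‖ := by
  simp [conjC, EuclideanSpace.norm_eq]

theorem conjC_smul (z : ℂ) (v : CSpace n) : conjC (z • v) = (starRingEnd ℂ) z • conjC v := by
  ext i
  simp [conjC]

theorem measurePreserving_neg' : MeasurePreserving (fun k : RSpace d => -k) volume volume :=
  Measure.measurePreserving_neg volume

/-- The Fourier transform of the complex conjugate, `k ↦ conj(f(-k))`. -/
def conjRefl : LOne d n →L[ℝ] LOne d n :=
  (conjL n).compLpL 1 volume ∘L
    (Lp.compMeasurePreservingₗᵢ ℝ (fun k : RSpace d => -k)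
      measurePreserving_neg').toContinuousLinearMap

theorem coeFn_conjRefl (f : LOne d n) : conjRefl f =ᵐ[volume] fun k => conjC (f (-k)) := by
  have h1 := (conjL n).coeFn_compLpL (p := 1) (μ := volume)
    (Lp.compMeasurePreservingₗᵢ ℝ (fun k : RSpace d => -k) measurePreserving_neg' f)
  have h2 := Lp.coeFn_compMeasurePreserving f (measurePreserving_neg' (d := d))
  filter_upwards [h1, h2] with k hk hk'
  have e : conjRefl f k = (conjL n) ((Lp.compMeasurePreservingₗᵢ ℝ (fun k : RSpace d => -k)
    measurePreserving_neg' f) k) := hk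
  have e' : (Lp.compMeasurePreservingₗᵢ ℝ (fun k : RSpace d => -k)
    measurePreserving_neg' f) k = f (-k) := hk'
  rw [e, e', conjL_apply]

theorem norm_conjRefl (f : LOne d n) : ‖conjRefl f‖ = ‖f‖ := by
  rw [L1.norm_eq_integral_norm, L1.norm_eq_integral_norm,
    ← integral_neg_eq_self (fun k => ‖f k‖) volume]
  refine integral_congr_ae ?_
  filter_upwards [coeFn_conjRefl f] with k hk
  rw [hk, norm_conjC]

theorem conjRefl_cmul {c c' : RSpace d → ℂ} {C C' : ℝ} (h : IsBddMul volume c C)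
    (h' : IsBddMul volume c' C') (hc : ∀ k, c' k = (starRingEnd ℂ) (c (-k))) (f : LOne d n) :
    conjRefl (mulOp volume (cmul n c) f) = mulOp volume (cmul n c') (conjRefl f) := by
  apply Lp.ext
  filter_upwards [coeFn_conjRefl (mulOp volume (cmul n c) f),
    coeFn_mulOp (isBddMul_cmul h') (conjRefl f), coeFn_conjRefl f,
    (measurePreserving_neg' (d := d)).quasiMeasurePreserving.ae
      (coeFn_mulOp (isBddMul_cmul h) f)] with k e1 e2 e3 e4
  rw [e1, e2, e3, e4, cmul_apply, cmul_apply, conjC_smul, hc]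

theorem wienerFun_conjRefl (f : LOne d n) (x : RSpace d) :
    wienerFun (conjRefl f) x = conjC (wienerFun f x) := by
  rw [wienerFun_eq, wfun_congr (coeFn_conjRefl f), wienerFun, wfun, ← conjL_apply, map_smul,
    ← ContinuousLinearMap.integral_comp_comm _ (integrable_exp_smul (L1.integrable_coeFn f) x),
    ← integral_neg_eq_self]
  congr 1
  refine integral_congr_ae (ae_of_all _ fun k => ?_)
  simp only [conjL_apply, conjC_smul, neg_neg]
  congr 1
  rw [← Complex.exp_conj]
  congr 1
  simp [inner_neg_left]

/-! ### The nonlinearity -/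

namespace Data

/-- The convolution theorem: `k ↦ exp(i k·x)` is a character, so the integral over triples
factorizes. With `c = (2π)^(-d/2)`, the factor `c²` from `convConst` and the `c` of the outer
transform supply one `c` for each of the three arguments. -/
theorem wienerFun_conv (S : Data d n) (f₁ f₂ f₃ : LOne d n) (x : RSpace d) :
    wienerFun (S.conv f₁ f₂ f₃) x =
      S.TC (wienerFun f₁ x) (wienerFun f₂ x) (wienerFun f₃ x) := by
  set c : ℝ := (2 * Real.pi) ^ (-(d : ℝ) / 2) with hc
  let E : RSpace d → ℂ := fun k => Complex.exp (I * (inner ℝ k x : ℝ))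
  have hEc : Continuous E := by
    change Continuous fun k : RSpace d => Complex.exp (I * (inner ℝ k x : ℝ))
    fun_prop
  have hE : ∀ k l, E (k + l) = E k * E l := fun k l => by
    simp only [E, inner_add_left, ← Complex.exp_add]
    congr 1
    push_cast
    ring
  have hI : Integrable (fun K : Triple d => E (tsum₃ K) • S.tens₃ f₁ f₂ f₃ K) (vol₃ d) := by
    refine (L1.integrable_coeFn (S.tens₃ f₁ f₂ f₃)).norm.mono' ?_ (ae_of_all _ fun K => ?_)
    · have h1 : AEStronglyMeasurable (fun K : Triple d => E (tsum₃ K)) (vol₃ d) :=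
        hEc.aestronglyMeasurable.comp_quasiMeasurePreserving quasiMeasurePreserving_tsum₃
      exact h1.smul (L1.integrable_coeFn (S.tens₃ f₁ f₂ f₃)).1
    · rw [norm_smul, norm_exp_inner, one_mul]
  have step1 : wienerFun (push (S.tens₃ f₁ f₂ f₃)) x =
      c • ∫ K, E (tsum₃ K) • S.tens₃ f₁ f₂ f₃ K ∂(vol₃ d) := by
    rw [wienerFun_eq, wfun_congr (coeFn_push _), wfun]
    congr 1
    have hmap := integral_map (μ := (volume : Measure (RSpace d)).prod
      ((volume : Measure (RSpace d)).prod (volume : Measure (RSpace d))))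
      (φ := shear) measurePreserving_shear.measurable.aemeasurable
      (f := fun K : Triple d => E (tsum₃ K) • S.tens₃ f₁ f₂ f₃ K)
      (by rw [measurePreserving_shear.map_eq]; exact hI.1)
    rw [measurePreserving_shear.map_eq] at hmap
    have hI' : Integrable (fun y : RSpace d × (RSpace d × RSpace d) =>
        E (tsum₃ (shear y)) • S.tens₃ f₁ f₂ f₃ (shear y)) (volume.prod (volume.prod volume)) :=
      measurePreserving_shear.integrable_comp_of_integrable hI
    rw [hmap, integral_prod _ hI']
    refine integral_congr_ae (ae_of_all _ fun k => ?_)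
    simp only [tsum₃_shear]
    rw [integral_smul]
  have step2 : ∫ K, E (tsum₃ K) • S.tens₃ f₁ f₂ f₃ K ∂(vol₃ d) =
      S.TC (∫ k, E k • f₁ k) (∫ k, E k • f₂ k) (∫ k, E k • f₃ k) := by
    have i1 := integrable_exp_smul (L1.integrable_coeFn f₁) x
    have i2 := integrable_exp_smul (L1.integrable_coeFn f₂) x
    have i3 := integrable_exp_smul (L1.integrable_coeFn f₃) x
    rw [← contractL_outerL, ← integral_trilinear (outerL n) S.contractL i1 i2 i3]
    refine integral_congr_ae ?_
    filter_upwards [S.coeFn_tens₃ f₁ f₂ f₃] with K hK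
    rw [hK, contractL_outerL, TC_smul_left, TC_smul_mid, TC_smul_right, smul_smul, smul_smul,
      tsum₃, hE, hE]
  have hlin : wienerFun (S.conv f₁ f₂ f₃) x =
      convConst d • wienerFun (push (S.tens₃ f₁ f₂ f₃)) x := by
    rw [conv, ← wienerL_apply, map_smul, wienerL_apply]
  rw [hlin, step1, step2]
  change _ = S.TC (c • _) (c • _) (c • _)
  rw [← coe_smul, ← coe_smul, ← coe_smul c, ← coe_smul c, ← coe_smul c, TC_smul_left, TC_smul_mid,
    TC_smul_right, smul_smul, smul_smul, smul_smul, convConst]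
  congr 1
  push_cast [hc]
  ring

end Data

/-! ### Derivatives of inverse Fourier integrals -/

/-- Differentiation under the integral sign, justified by the integrable first moment. -/
theorem fderiv_wfun {h : RSpace d → CSpace n} (hh : Integrable h)
    (hh' : Integrable fun k => ‖k‖ * ‖h k‖) (x v : RSpace d) :
    fderiv ℝ (wfun h) x v = wfun (fun k => (I * (inner ℝ k v : ℝ)) • h k) x := by
  -- The scaling turns the kernel `exp(-2π i L(k,y))` into `exp(i k·y)`.
  let L : RSpace d →L[ℝ] RSpace d →L[ℝ] ℝ := (-(2 * Real.pi)⁻¹) • innerSL ℝ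
  have hL : ∀ k y, L k y = -((2 * Real.pi)⁻¹ * inner ℝ k y) := fun k y => by
    simp only [L, smul_apply, smul_eq_mul, neg_mul]
    rfl
  have hexp : ∀ k y, (Real.fourierChar (-L k y) : ℂ) = Complex.exp (I * (inner ℝ k y : ℝ)) := by
    intro k y
    rw [Real.fourierChar_apply, hL, neg_neg, mul_inv_cancel_left₀ (by positivity), mul_comm]
  have hD := VectorFourier.hasFDerivAt_fourierIntegral L hh hh' x
  have e1 : wfun h = ((2 * Real.pi) ^ (-(d : ℝ) / 2) : ℝ) •
      VectorFourier.fourierIntegral Real.fourierChar volume L.toLinearMap₁₂ h := by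
    funext y
    rw [Pi.smul_apply]
    unfold wfun VectorFourier.fourierIntegral
    congr 1
    refine integral_congr_ae (ae_of_all _ fun k => ?_)
    simp only
    rw [← hexp]
    rfl
  have hint : Integrable (VectorFourier.fourierSMulRight L h) := by
    refine (hh'.const_mul (2 * Real.pi * ‖L‖)).mono' hh.1.fourierSMulRight (ae_of_all _ fun k => ?_)
    rw [← mul_assoc]
    exact VectorFourier.norm_fourierSMulRight_le L h k
  rw [e1, (hD.const_smul ((2 * Real.pi) ^ (-(d : ℝ) / 2) : ℝ)).fderiv, smul_apply,
    Real.fourierIntegral_continuousLinearMap_apply' hint, wfun]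
  congr 1
  refine integral_congr_ae (ae_of_all _ fun k => ?_)
  simp only
  rw [← hexp, VectorFourier.fourierSMulRight_apply, hL]
  change (Real.fourierChar (-L k x) : ℂ) • (-(2 * Real.pi * I) • -((2 * Real.pi)⁻¹ * inner ℝ k v) •
    h k) = _
  congr 1
  rw [← coe_smul, smul_smul]
  congr 1
  have : (Real.pi : ℂ) ≠ 0 := by exact_mod_cast Real.pi_ne_zero
  push_cast
  field_simp

theorem derivSymbol_single {s : ℕ} (l : Fin d) (a : Fin (s + 1)) (k : RSpace d) :
    derivSymbol (Pi.single l a) k = (I * (k l : ℂ)) ^ (a : ℕ) := by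
  rw [derivSymbol, Finset.prod_eq_single l]
  · simp
  · intro i _ hi
    simp [Pi.single_eq_of_ne hi]
  · simp

theorem single_mem_multiIndices {s : ℕ} (l : Fin d) (a : Fin (s + 1)) :
    Pi.single l a ∈ multiIndices d s := by
  rw [multiIndices, Finset.mem_filter]
  refine ⟨Finset.mem_univ _, ?_⟩
  rw [Finset.sum_eq_single l]
  · simpa using Nat.lt_succ_iff.1 a.2
  · intro i _ hi
    simp [Pi.single_eq_of_ne hi]
  · simp

theorem norm_le_sum_abs (k : RSpace d) : ‖k‖ ≤ ∑ l, |k l| := by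
  have h : k = ∑ l, EuclideanSpace.single l (k l) := by
    ext i
    simp [Finset.sum_apply]
  calc ‖k‖ = ‖∑ l, EuclideanSpace.single l (k l)‖ := by rw [← h]
    _ ≤ ∑ l, ‖EuclideanSpace.single l (k l)‖ := norm_sum_le _ _
    _ = _ := by simp

theorem MemW.integrable_coord {g : LOne d n} (hg : MemW 1 g) (l : Fin d) :
    Integrable fun k => (I * (k l : ℂ)) • g k := by
  have := hg _ (single_mem_multiIndices l (1 : Fin 2))
  simpa only [derivSymbol_single, Fin.val_one, pow_one] using this

theorem MemW.integrable_norm {g : LOne d n} (hg : MemW 1 g) :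
    Integrable fun k => ‖k‖ * ‖g k‖ := by
  have h : Integrable fun k => ∑ l, ‖(I * (k l : ℂ)) • g k‖ :=
    integrable_finsetSum _ fun l _ => (hg.integrable_coord l).norm
  refine h.mono' ?_ (ae_of_all _ fun k => ?_)
  · exact continuous_norm.aestronglyMeasurable.mul (L1.integrable_coeFn g).1.norm
  · rw [Real.norm_of_nonneg (by positivity)]
    simp only [norm_smul, norm_mul, norm_I, one_mul, norm_real, Real.norm_eq_abs]
    rw [← Finset.sum_mul]
    exact mul_le_mul_of_nonneg_right (norm_le_sum_abs k) (norm_nonneg _)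

/-! ### The system in Fourier space -/

/-- The Fourier transform of `u_j`, with `u_{-j}` the complex conjugate of `u_j`. -/
def signedMode (U : ℤ → ℝ → LOne d n) (j : ℤ) (t : ℝ) : LOne d n :=
  if 0 < j then U j t else conjRefl (U (-j) t)

namespace Data

theorem field_eq (U : ℤ → ℝ → LOne d n) (j : ℤ) (t : ℝ) (x : RSpace d) :
    field U j t x = wienerFun (signedMode U j t) x := by
  unfold field signedMode
  split_ifs
  · rfl
  · rw [wienerFun_conjRefl]

/-- The Fourier transform of the nonlinearity. -/
def nonlin (S : Data d n) (U : ℤ → ℝ → LOne d n) (j : ℤ) (t : ℝ) : LOne d n :=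
  ∑ J ∈ triples 3 j, S.conv (signedMode U J.1 t) (signedMode U J.2.1 t) (signedMode U J.2.2 t)

theorem toEuclideanLin_L_add (S : Data d n) (α : ℝ) (β β' : RSpace d) (w : CSpace n) :
    Matrix.toEuclideanLin (S.L α (β + β')) w = Matrix.toEuclideanLin (S.L α β) w +
      ∑ l, (β' l : ℂ) • Matrix.toEuclideanLin ((S.A l).map Complex.ofReal) w := by
  have : S.L α (β + β') = S.L α β + ∑ l, (β' l : ℂ) • (S.A l).map Complex.ofReal := by
    simp only [L, PiLp.add_apply, ofReal_add, add_smul, Finset.sum_add_distrib]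
    abel
  rw [this, map_add, map_sum, LinearMap.add_apply, LinearMap.sum_apply]
  simp only [map_smul, LinearMap.smul_apply]

/-- Evaluation at a fixed `x` is a continuous linear functional of `û_j`, so the pointwise equation
identifies the inverse transform of the time derivative at every `x`; uniqueness of the Fourier
transform then gives the equation in `k`. The derivative `A(∂)` becomes `i A(k)` and shifts the wave
vector `jκ` to `jκ + εk`. -/
theorem IsClassicalSolution.hasDerivAt {S : Data d n} {ε τ : ℝ} {p : LOne d n}
    {U : ℤ → ℝ → LOne d n} (hU : S.IsClassicalSolution 3 ε τ p U) (hε : 0 < ε) {j : ℤ}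
    (hj : j ∈ modes 3) (hj0 : 0 < j) {t : ℝ} (ht : t ∈ Ioo 0 τ) :
    ∃ V, HasDerivAt (U j) V t ∧ ∀ᵐ k, V k =
      -((I / (ε : ℂ)) • Matrix.toEuclideanLin (S.L (j * S.ω) ((j : ℝ) • S.κ + ε • k)) (U j t k)) +
        (ε : ℂ) • S.nonlin U j t k := by
  have hnhds : Icc 0 τ ∈ 𝓝 t := Icc_mem_nhds ht.1 ht.2
  have hW : MemW 1 (U j t) := (hU.continuousW j hj hj0).1 t ⟨ht.1.le, ht.2.le⟩
  have hd : HasDerivAt (U j) (deriv (U j) t) t :=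
    (((hU.contDiff j hj hj0).differentiableOn one_ne_zero).differentiableAt hnhds).hasDerivAt
  set g := U j t with hg
  have ig := L1.integrable_coeFn g
  let M := Matrix.toEuclideanLin (S.L (j * S.ω) ((j : ℝ) • S.κ))
  let A := fun l => Matrix.toEuclideanLin ((S.A l).map Complex.ofReal)
  let h₀ : RSpace d → CSpace n := fun k => (-(I / (ε : ℂ))) • M (g k)
  let h₁ : Fin d → RSpace d → CSpace n := fun l k => A l ((-(I * (k l : ℂ))) • g k)
  let h₂ : RSpace d → CSpace n := fun k => (ε : ℂ) • S.nonlin U j t k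
  have i₀ : Integrable h₀ := ((LinearMap.toContinuousLinearMap M).integrable_comp ig).smul (-(I / (ε : ℂ)))
  have i₁' : ∀ l, Integrable fun k => (-(I * ((k : RSpace d) l : ℂ))) • g k := fun l => by
    have := (hW.integrable_coord l).neg
    refine this.congr (ae_of_all _ fun k => ?_)
    exact (neg_smul _ _).symm
  have i₁ : ∀ l, Integrable (h₁ l) := fun l =>
    (LinearMap.toContinuousLinearMap (A l)).integrable_comp (i₁' l)
  have i₂ : Integrable h₂ := (L1.integrable_coeFn _).smul (ε : ℂ)
  have isum : Integrable fun k => ∑ l, h₁ l k := integrable_finsetSum _ fun l _ => i₁ l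
  have i₀₁ : Integrable fun k => h₀ k + ∑ l, h₁ l k := i₀.add isum
  have i₃ : Integrable fun k => (h₀ k + ∑ l, h₁ l k) + h₂ k := i₀₁.add i₂
  have hV : deriv (U j) t = i₃.toL1 _ := by
    rw [← sub_eq_zero]
    refine eq_zero_of_wienerFun (ae_of_all _ fun x => ?_)
    rw [← wienerL_apply, map_sub, wienerL_apply, wienerL_apply, wienerFun_toL1, sub_eq_zero]
    have hfield : (fun t' => field U j t' x) = fun t' => wienerL x (U j t') := by
      funext t'
      rw [field_eq, signedMode, if_pos hj0, wienerL_apply]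
    have d1 : HasDerivAt (fun t' => field U j t' x) (wienerFun (deriv (U j) t) x) t := by
      rw [hfield]
      exact (wienerL x).hasFDerivAt.comp_hasDerivAt t hd
    have d2 := (hU.pde j hj hj0 t ⟨ht.1, ht.2.le⟩ x).hasDerivAt hnhds
    rw [d1.unique d2, wfun_add i₀₁ i₂, wfun_add i₀ isum, wfun_sum _ fun l _ => i₁ l]
    have hf : field U j t = wfun g := by
      funext y
      rw [field_eq, signedMode, if_pos hj0]
      rfl
    have e0 : wfun h₀ x = -((I / (ε : ℂ)) • M (field U j t x)) := by
      change wfun (fun k => (-(I / (ε : ℂ))) • M (g k)) x = _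
      rw [wfun_smul (fun k => M (g k)), wfun_clm ig, hf, neg_smul]
    have e1 : ∀ l, wfun (h₁ l) x = -A l (fderiv ℝ (field U j t) x (EuclideanSpace.single l 1)) := by
      intro l
      change wfun (fun k => A l ((-(I * (k l : ℂ))) • g k)) x = _
      rw [wfun_clm (i₁' l), hf, fderiv_wfun ig hW.integrable_norm, ← map_neg]
      congr 1
      rw [← neg_one_smul ℂ, ← wfun_smul]
      congr 1
      funext k
      rw [smul_smul, EuclideanSpace.inner_single_right]
      simp
    have e2 : wfun h₂ x = (ε : ℂ) • ∑ J ∈ triples 3 j,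
        S.TC (field U J.1 t x) (field U J.2.1 t x) (field U J.2.2 t x) := by
      change wfun (fun k => (ε : ℂ) • S.nonlin U j t k) x = _
      rw [wfun_smul]
      congr 1
      rw [← wienerFun_eq, nonlin, ← wienerL_apply, map_sum]
      simp only [wienerL_apply, wienerFun_conv, field_eq]
    rw [e0, e2, Finset.sum_congr rfl fun l _ => e1 l, Finset.sum_neg_distrib, ← sub_eq_add_neg]
    rfl
  refine ⟨_, hd, ?_⟩
  rw [hV]
  filter_upwards [i₃.coeFn_toL1] with k hk
  rw [hk, toEuclideanLin_L_add]
  simp only [h₀, h₁, h₂]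
  congr 1
  rw [smul_add, neg_add, neg_smul]
  congr 1
  rw [Finset.smul_sum, ← Finset.sum_neg_distrib]
  refine Finset.sum_congr rfl fun l _ => ?_
  rw [map_smul, smul_smul, ← neg_smul]
  congr 1
  have : (ε : ℂ) ≠ 0 := by exact_mod_cast hε.ne'
  simp only [PiLp.smul_apply, smul_eq_mul, ofReal_mul]
  field_simp

end Data

/-! ### Rank-one projections -/

/-- The operator `w ↦ ⟨ψ,w⟩ ψ`. -/
def rankOneL (ψ : CSpace n) : CSpace n →L[ℝ] CSpace n :=
  ((innerSL ℂ ψ).smulRight ψ).restrictScalars ℝ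

theorem rankOneL_apply (ψ w : CSpace n) : rankOneL ψ w = (inner ℂ ψ w : ℂ) • ψ := rfl

theorem rankOneL_smul (ψ : CSpace n) (z : ℂ) (w : CSpace n) :
    rankOneL ψ (z • w) = z • rankOneL ψ w := by
  rw [rankOneL_apply, rankOneL_apply, inner_smul_right, smul_smul]

theorem norm_rankOneL_apply {ψ : CSpace n} (hψ : ‖ψ‖ = 1) (w : CSpace n) :
    ‖rankOneL ψ w‖ = ‖(inner ℂ ψ w : ℂ)‖ := by
  rw [rankOneL_apply, norm_smul, hψ, mul_one]

theorem norm_rankOneL_le {ψ : CSpace n} (hψ : ‖ψ‖ = 1) : ‖rankOneL ψ‖ ≤ 1 :=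
  ContinuousLinearMap.opNorm_le_bound _ zero_le_one fun w => by
    rw [norm_rankOneL_apply hψ]
    exact (norm_inner_le_norm _ _).trans_eq (by rw [hψ])

theorem continuous_rankOneL : Continuous (rankOneL (n := n)) := by
  have h1 : Continuous fun ψ : CSpace n => (innerSL ℂ ψ).smulRight ψ :=
    (ContinuousLinearMap.smulRightL ℂ (CSpace n) (CSpace n)).continuous₂.comp
      ((innerSL ℂ).continuous.prodMk continuous_id)
  exact (ContinuousLinearMap.restrictScalarsL ℂ (CSpace n) (CSpace n) ℝ ℝ).continuous.comp h1

namespace Data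

theorem toEuclideanLin_L_eq (S : Data d n) (α : ℝ) (β : RSpace d) (w : CSpace n) :
    Matrix.toEuclideanLin (S.L α β) w = Matrix.toEuclideanLin (S.L 0 β) w - (α : ℂ) • w := by
  have : S.L α β = S.L 0 β - (α : ℂ) • (1 : Matrix (Fin n) (Fin n) ℂ) := by
    simp only [L, ofReal_zero, zero_smul, neg_zero, zero_add]
    abel
  rw [this, map_sub, LinearMap.sub_apply, map_smul, LinearMap.smul_apply]
  congr 2
  ext i
  simp

theorem nontrivial_rspace (S : Data d n) : Nontrivial (RSpace d) := ⟨S.κ, 0, S.κ_ne⟩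

/-- Continuity fails at most where `β + εk = 0`, a single point. It is a null set because `κ ≠ 0`
rules out dimension zero. -/
theorem aestronglyMeasurable_comp_affine {E : Type*} [NormedAddCommGroup E] (S : Data d n)
    {f : RSpace d → E} (hf : ContinuousOn f {0}ᶜ) (β : RSpace d) {ε : ℝ} (hε : ε ≠ 0) :
    AEStronglyMeasurable (fun k => f (β + ε • k)) volume := by
  have := S.nontrivial_rspace
  have h : ContinuousOn (fun k : RSpace d => f (β + ε • k)) {-(ε⁻¹ • β)}ᶜ := by
    refine hf.comp (by fun_prop) fun k hk h0 => hk ?_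
    have h0' : ε • k = -β := eq_neg_of_add_eq_zero_right h0
    rw [mem_singleton_iff, ← smul_neg, ← h0', smul_smul, inv_mul_cancel₀ hε, one_smul]
  have h2 := h.aestronglyMeasurable (μ := volume) (measurableSet_singleton _).compl
  have h3 : (volume : Measure (RSpace d)).restrict {-(ε⁻¹ • β)}ᶜ = volume :=
    Measure.restrict_eq_self_of_ae_mem (compl_mem_ae_iff.2 (measure_singleton _))
  rwa [h3] at h2

namespace Eigendecomposition

variable [NeZero n] {S : Data d n}

theorem exists_onb (D : S.Eigendecomposition) (β : RSpace d) :
    ∃ b : OrthonormalBasis (Fin n) ℂ (CSpace n), ∀ ℓ, b ℓ = D.vec ℓ β := by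
  have h : Orthonormal ℂ ((univ : Set (Fin n)).domRestrict fun ℓ => D.vec ℓ β) :=
    (D.orthonormal β).comp _ Subtype.val_injective
  obtain ⟨b, hb⟩ := h.exists_orthonormalBasis_extension_of_card_eq (by simp)
  exact ⟨b, fun ℓ => hb ℓ (mem_univ _)⟩

theorem norm_vec (D : S.Eigendecomposition) (ℓ : Fin n) (β : RSpace d) : ‖D.vec ℓ β‖ = 1 :=
  (D.orthonormal β).1 ℓ

theorem sum_rankOneL (D : S.Eigendecomposition) (β : RSpace d) (w : CSpace n) :
    ∑ ℓ, rankOneL (D.vec ℓ β) w = w := by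
  obtain ⟨b, hb⟩ := D.exists_onb β
  have := b.sum_repr' w
  simpa only [hb, rankOneL_apply] using this

theorem sum_norm_inner_sq (D : S.Eigendecomposition) (β : RSpace d) (w : CSpace n) :
    ∑ ℓ, ‖(inner ℂ (D.vec ℓ β) w : ℂ)‖ ^ 2 = ‖w‖ ^ 2 := by
  obtain ⟨b, hb⟩ := D.exists_onb β
  have := b.sum_sq_norm_inner_right w
  simpa only [hb] using this

/-- Expanding `w` in the eigenbasis leaves only the `ℓ`-th term, by orthonormality. -/
theorem rankOneL_L (D : S.Eigendecomposition) (ℓ : Fin n) (α : ℝ) (β : RSpace d) (w : CSpace n) :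
    rankOneL (D.vec ℓ β) (Matrix.toEuclideanLin (S.L α β) w) =
      ((D.ev ℓ β - α : ℝ) : ℂ) • rankOneL (D.vec ℓ β) w := by
  have h0 : (inner ℂ (D.vec ℓ β) (Matrix.toEuclideanLin (S.L 0 β) w) : ℂ) =
      D.ev ℓ β * inner ℂ (D.vec ℓ β) w := by
    conv_lhs => rw [← D.sum_rankOneL β w]
    simp only [map_sum, rankOneL_apply, map_smul, D.eigen, inner_sum, inner_smul_right]
    rw [Finset.sum_eq_single ℓ]
    · rw [inner_self_eq_norm_sq_to_K, norm_vec]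
      simp [mul_comm]
    · intro m _ hm
      rw [(D.orthonormal β).2 hm.symm]
      simp
    · simp
  rw [toEuclideanLin_L_eq, map_sub, rankOneL_smul]
  rw [rankOneL_apply, h0, mul_smul, ← rankOneL_apply, ← sub_smul]
  push_cast
  rfl

theorem rankOneL_psi_L (D : S.Eigendecomposition) (j : ℤ) (ℓ : Fin n) (θ : RSpace d)
    (w : CSpace n) :
    rankOneL (D.psi j ℓ θ) (Matrix.toEuclideanLin (S.L (j * S.ω) ((j : ℝ) • S.κ + θ)) w) =
      (D.lam j ℓ θ : ℂ) • rankOneL (D.psi j ℓ θ) w := by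
  rw [psi, rankOneL_L, lam]
  congr 3
  ring

/-! ### Measurability -/

theorem aestronglyMeasurable_psi (D : S.Eigendecomposition) (j : ℤ) (ℓ : Fin n) {ε : ℝ}
    (hε : ε ≠ 0) : AEStronglyMeasurable (fun k => D.psi j ℓ (ε • k)) volume :=
  aestronglyMeasurable_comp_affine S (D.vec_smooth ℓ).continuousOn _ hε

theorem aestronglyMeasurable_lam (D : S.Eigendecomposition) (j : ℤ) (ℓ : Fin n) {ε : ℝ}
    (hε : ε ≠ 0) : AEStronglyMeasurable (fun k => D.lam j ℓ (ε • k)) volume :=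
  (aestronglyMeasurable_comp_affine S (D.ev_smooth ℓ).continuousOn _ hε).const_add _

theorem isBddMul_rankOneL (D : S.Eigendecomposition) (j : ℤ) (ℓ : Fin n) {ε : ℝ}
    (hε : ε ≠ 0) : IsBddMul volume (fun k => rankOneL (D.psi j ℓ (ε • k))) 1 :=
  ⟨continuous_rankOneL.comp_aestronglyMeasurable (D.aestronglyMeasurable_psi j ℓ hε), zero_le_one,
    fun _ => norm_rankOneL_le (D.norm_vec _ _)⟩

/-! ### Norms of the transformed functions -/

theorem transform_apply (D : S.Eigendecomposition) (j : ℤ) (ε t : ℝ) (k : RSpace d)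
    (w : CSpace n) (ℓ : Fin n) :
    Matrix.toEuclideanLin (D.transform j ε t k) w ℓ =
      Complex.exp (I * (t / ε) * D.lam j ℓ (ε • k)) * inner ℂ (D.psi j ℓ (ε • k)) w := by
  rw [transform, Matrix.toLpLin_apply, ← Matrix.mulVec_mulVec, PiLp.toLp_apply,
    Matrix.mulVec_diagonal]
  congr 1
  rw [PiLp.inner_apply, Matrix.mulVec, dotProduct]
  refine Finset.sum_congr rfl fun i _ => ?_
  simp [Psi, mul_comm]

theorem norm_transform_coord (D : S.Eigendecomposition) (j : ℤ) (ε t : ℝ) (k : RSpace d)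
    (w : CSpace n) (ℓ : Fin n) :
    ‖Matrix.toEuclideanLin (D.transform j ε t k) w ℓ‖ =
      ‖(inner ℂ (D.psi j ℓ (ε • k)) w : ℂ)‖ := by
  rw [transform_apply, norm_mul]
  have : I * (t / ε : ℂ) * D.lam j ℓ (ε • k) = ((t / ε * D.lam j ℓ (ε • k) : ℝ) : ℂ) * I := by
    push_cast; ring
  rw [this, norm_exp_ofReal_mul_I, one_mul]

theorem norm_transform (D : S.Eigendecomposition) (j : ℤ) (ε t : ℝ) (k : RSpace d)
    (w : CSpace n) : ‖Matrix.toEuclideanLin (D.transform j ε t k) w‖ = ‖w‖ := by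
  rw [← sq_eq_sq₀ (norm_nonneg _) (norm_nonneg _), EuclideanSpace.norm_sq_eq,
    ← D.sum_norm_inner_sq ((j : ℝ) • S.κ + ε • k) w]
  exact Finset.sum_congr rfl fun ℓ _ => by rw [norm_transform_coord]; rfl

theorem norm_P_transform (D : S.Eigendecomposition) (ε t : ℝ) (k : RSpace d) (w : CSpace n) :
    ‖P (Matrix.toEuclideanLin (D.transform 1 ε t k) w)‖ =
      ‖rankOneL (D.psi 1 0 (ε • k)) w‖ := by
  rw [P, PiLp.norm_single, norm_transform_coord]
  exact (norm_rankOneL_apply (ψ := D.psi 1 0 (ε • k)) (D.norm_vec _ _) w).symm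

theorem norm_PPerp_transform (D : S.Eigendecomposition) (ε t : ℝ) (k : RSpace d) (w : CSpace n) :
    ‖PPerp (Matrix.toEuclideanLin (D.transform 1 ε t k) w)‖ =
      ‖w - rankOneL (D.psi 1 0 (ε • k)) w‖ := by
  rw [← sq_eq_sq₀ (norm_nonneg _) (norm_nonneg _), EuclideanSpace.norm_sq_eq,
    ← D.sum_norm_inner_sq (((1 : ℤ) : ℝ) • S.κ + ε • k)]
  refine Finset.sum_congr rfl fun ℓ _ => ?_
  rw [inner_sub_right, rankOneL_apply, inner_smul_right, PPerp, PiLp.sub_apply, P]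
  by_cases h : ℓ = 0
  · subst h
    have h1 : (inner ℂ (D.psi 1 0 (ε • k)) (D.psi 1 0 (ε • k)) : ℂ) = 1 := by
      rw [inner_self_eq_norm_sq_to_K, psi, norm_vec]
      simp
    change _ = ‖inner ℂ (D.psi 1 0 (ε • k)) w -
      inner ℂ (D.psi 1 0 (ε • k)) w * inner ℂ (D.psi 1 0 (ε • k)) (D.psi 1 0 (ε • k))‖ ^ 2
    rw [h1]
    simp
  · have h1 : (inner ℂ (D.psi 1 ℓ (ε • k)) (D.psi 1 0 (ε • k)) : ℂ) = 0 :=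
      (D.orthonormal _).2 h
    change _ = ‖inner ℂ (D.psi 1 ℓ (ε • k)) w -
      inner ℂ (D.psi 1 0 (ε • k)) w * inner ℂ (D.psi 1 ℓ (ε • k)) (D.psi 1 0 (ε • k))‖ ^ 2
    rw [h1, mul_zero, sub_zero, ← norm_transform_coord D 1 ε t k w ℓ]
    simp [h]

end Eigendecomposition

end Data

theorem normL1_congr {f g : RSpace d → CSpace n} (h : ∀ᵐ k, ‖f k‖ = ‖g k‖) :
    normL1 f = normL1 g :=
  eLpNorm_congr_norm_ae h

theorem normL1_coe (f : LOne d n) : normL1 f = ENNReal.ofReal ‖f‖ := by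
  rw [normL1, Lp.norm_def, ENNReal.ofReal_toReal (Lp.eLpNorm_ne_top f)]

namespace Data.Eigendecomposition

variable [NeZero n] {S : Data d n}

/-- Multiplication by the projection onto the `ℓ`-th eigenspace of `𝓛_j(εk)`. -/
def projOp (D : S.Eigendecomposition) (j : ℤ) (ℓ : Fin n) (ε : ℝ) : LOne d n →L[ℝ] LOne d n :=
  mulOp volume fun k => rankOneL (D.psi j ℓ (ε • k))

theorem norm_projOp_le (D : S.Eigendecomposition) (j : ℤ) (ℓ : Fin n) {ε : ℝ} (hε : ε ≠ 0)
    (f : LOne d n) : ‖D.projOp j ℓ ε f‖ ≤ ‖f‖ :=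
  (norm_mulOp_apply_le (D.isBddMul_rankOneL j ℓ hε) f).trans_eq (one_mul _)

theorem sum_projOp (D : S.Eigendecomposition) (j : ℤ) {ε : ℝ} (hε : ε ≠ 0) (f : LOne d n) :
    ∑ ℓ, D.projOp j ℓ ε f = f := by
  apply Lp.ext
  have h : ∀ᵐ k, ∀ ℓ, D.projOp j ℓ ε f k = rankOneL (D.psi j ℓ (ε • k)) (f k) :=
    ae_all_iff.2 fun ℓ => coeFn_mulOp (D.isBddMul_rankOneL j ℓ hε) f
  have h2 : ⇑(∑ ℓ, D.projOp j ℓ ε f) =ᵐ[volume] ∑ ℓ, ⇑(D.projOp j ℓ ε f) :=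
    Lp.coeFn_finsetSum _ _
  filter_upwards [h, h2] with k hk h2k
  rw [h2k, Finset.sum_apply, Finset.sum_congr rfl fun ℓ _ => hk ℓ]
  exact D.sum_rankOneL _ _

theorem normL1_P (D : S.Eigendecomposition) {ε : ℝ} (hε : ε ≠ 0) (U : ℤ → ℝ → LOne d n) (t : ℝ) :
    normL1 (fun k => P (D.z ε U 1 t k)) = ENNReal.ofReal ‖D.projOp 1 0 ε (U 1 t)‖ := by
  rw [← normL1_coe]
  refine normL1_congr ?_
  filter_upwards [coeFn_mulOp (D.isBddMul_rankOneL 1 0 hε) (U 1 t)] with k hk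
  rw [projOp, hk, ← D.norm_P_transform ε t k]
  rfl

theorem normL1_PEpsPerp (D : S.Eigendecomposition) {ε : ℝ} (hε : ε ≠ 0) (U : ℤ → ℝ → LOne d n)
    (t : ℝ) : normL1 (fun k => D.PEpsPerp ε k (U 1 t k)) =
      ENNReal.ofReal ‖U 1 t - D.projOp 1 0 ε (U 1 t)‖ := by
  rw [← normL1_coe]
  refine normL1_congr ?_
  filter_upwards [coeFn_mulOp (D.isBddMul_rankOneL 1 0 hε) (U 1 t),
    Lp.coeFn_sub (U 1 t) (D.projOp 1 0 ε (U 1 t))] with k hk hk'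
  rw [hk', Pi.sub_apply, projOp, hk]
  rfl

theorem normL1_PEpsPerp_eq (D : S.Eigendecomposition) (ε : ℝ) (U : ℤ → ℝ → LOne d n)
    (t : ℝ) : normL1 (fun k => D.PEpsPerp ε k (U 1 t k)) =
      normL1 (fun k => PPerp (D.z ε U 1 t k)) :=
  normL1_congr (ae_of_all _ fun k => (D.norm_PPerp_transform ε t k (U 1 t k)).symm)

theorem normL1_z (D : S.Eigendecomposition) (ε : ℝ) (U : ℤ → ℝ → LOne d n) (j : ℤ) (t : ℝ) :
    normL1 (D.z ε U j t) = normL1 (U j t) :=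
  normL1_congr (ae_of_all _ fun k => D.norm_transform j ε t k (U j t k))

/-- The transformation to `z` is unitary for each `k` and carries `𝓟_ε` to `P`. From here on only
`û_j` and its spectral projections are needed. -/
theorem scaledNorm_z (D : S.Eigendecomposition) {ε : ℝ} (hε : 0 < ε) (U : ℤ → ℝ → LOne d n)
    (t : ℝ) : scaledNorm ε (D.z ε U 1 t) (D.z ε U 3 t) =
      ENNReal.ofReal (2 * ‖D.projOp 1 0 ε (U 1 t)‖ +
        2 / ε * ‖U 1 t - D.projOp 1 0 ε (U 1 t)‖ + 2 / ε ^ 2 * ‖U 3 t‖) := by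
  rw [scaledNorm, D.normL1_P hε.ne', ← D.normL1_PEpsPerp_eq, D.normL1_PEpsPerp hε.ne', D.normL1_z,
    normL1_coe, ENNReal.ofReal_add (by positivity) (by positivity),
    ENNReal.ofReal_add (by positivity) (by positivity), ENNReal.ofReal_mul (by positivity),
    ENNReal.ofReal_mul (by positivity), ENNReal.ofReal_mul (by positivity)]
  simp

/-! ### Polarized data -/

/-- A constant matrix commutes with the Fourier transform, so `p̂₀(k)` lies in the kernel for almost
every `k`; the gap makes the eigenvalues with `ℓ ≠ 0` nonzero. -/
theorem rankOneL_polarized (D : S.Eigendecomposition) (hgap : D.Gap) {p : LOne d n}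
    (hp : S.Polarized p) {ℓ : Fin n} (hℓ : ℓ ≠ 0) :
    ∀ᵐ k, rankOneL (D.psi 1 ℓ 0) (p k) = 0 := by
  let M := Matrix.toEuclideanLin (S.L S.ω S.κ)
  have ip := L1.integrable_coeFn p
  have iM : Integrable fun k => M (p k) := (LinearMap.toContinuousLinearMap M).integrable_comp ip
  have h0 : iM.toL1 _ = (0 : LOne d n) := by
    refine eq_zero_of_wienerFun ?_
    filter_upwards [hp] with x hx
    rw [wienerFun_toL1, wfun_clm ip]
    exact hx
  have h1 : ∀ᵐ k, M (p k) = 0 := by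
    have h2 := iM.coeFn_toL1
    rw [h0] at h2
    filter_upwards [h2, Lp.coeFn_zero (CSpace n) 1 (volume : Measure (RSpace d))] with k hk hk'
    rw [← hk, hk']
    rfl
  filter_upwards [h1] with k hk
  have h3 := D.rankOneL_L ℓ S.ω S.κ (p k)
  have h4 : Matrix.toEuclideanLin (S.L S.ω S.κ) (p k) = 0 := hk
  rw [h4, map_zero] at h3
  obtain ⟨c, hc, hcb⟩ := hgap
  have hne : D.ev ℓ S.κ - S.ω ≠ 0 := fun h => by
    have := hcb ℓ hℓ S.κ
    rw [abs_sub_comm, h, abs_zero] at this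
    linarith
  have : D.psi 1 ℓ 0 = D.vec ℓ S.κ := by simp [psi]
  rw [this]
  exact (smul_eq_zero.1 h3.symm).resolve_left (by exact_mod_cast hne)

/-- Differentiability at `κ ≠ 0` gives the bound for small `θ`. For `‖θ‖ ≥ δ` the difference of unit
vectors is at most `2 ≤ (2/δ)‖θ‖`, so the possible singularity at the origin is harmless. -/
theorem exists_psi_lipschitz (D : S.Eigendecomposition) :
    ∃ K ≥ 0, ∀ ℓ θ, ‖D.psi 1 ℓ θ - D.psi 1 ℓ 0‖ ≤ K * ‖θ‖ := by
  have h : ∀ ℓ, ∃ K ≥ 0, ∀ θ, ‖D.psi 1 ℓ θ - D.psi 1 ℓ 0‖ ≤ K * ‖θ‖ := by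
    intro ℓ
    have hd : DifferentiableAt ℝ (D.vec ℓ) S.κ :=
      ((D.vec_smooth ℓ).differentiableOn (by simp)).differentiableAt
        (isOpen_compl_singleton.mem_nhds S.κ_ne)
    obtain ⟨C, hC⟩ := hd.isBigO_sub.bound
    obtain ⟨δ, hδ, hball⟩ := Metric.eventually_nhds_iff_ball.1 hC
    refine ⟨max C 0 + 2 / δ, by positivity, fun θ => ?_⟩
    have e1 : ∀ θ, D.psi 1 ℓ θ = D.vec ℓ (S.κ + θ) := fun θ => by simp [psi]
    rw [e1, e1, add_zero, add_mul]
    by_cases hθ : ‖θ‖ < δ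
    · have := hball (S.κ + θ) (by simpa using hθ)
      simp only [add_sub_cancel_left] at this
      refine this.trans ?_
      have h2 : 0 ≤ 2 / δ * ‖θ‖ := by positivity
      have h3 := mul_le_mul_of_nonneg_right (le_max_left C 0) (norm_nonneg θ)
      linarith
    · have h1 : ‖D.vec ℓ (S.κ + θ) - D.vec ℓ S.κ‖ ≤ 2 := by
        refine (norm_sub_le _ _).trans ?_
        rw [norm_vec, norm_vec]
        norm_num
      have h2 : 2 ≤ 2 / δ * ‖θ‖ := by
        rw [div_mul_eq_mul_div, le_div_iff₀ hδ]
        linarith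
      have h3 : 0 ≤ max C 0 * ‖θ‖ := by positivity
      linarith
  choose K hK hb using h
  refine ⟨∑ ℓ, K ℓ, Finset.sum_nonneg fun ℓ _ => hK ℓ, fun ℓ θ => (hb ℓ θ).trans ?_⟩
  exact mul_le_mul_of_nonneg_right
    (Finset.single_le_sum (fun m _ => hK m) (Finset.mem_univ ℓ)) (norm_nonneg _)

end Data.Eigendecomposition

/-! ### Weights -/

/-- The multi-indices `0` and `2e_l` alone already give `1 + ∑ k_l²`. -/
theorem weight_le_sum (k : RSpace d) :
    1 + ‖k‖ ^ 2 ≤ ∑ α ∈ multiIndices d 2, ‖derivSymbol α k‖ := by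
  classical
  let s : Finset (Fin d → Fin 3) := Finset.univ.image fun l : Fin d => Pi.single l (2 : Fin 3)
  have hinj : Function.Injective fun l : Fin d => (Pi.single l (2 : Fin 3) : Fin d → Fin 3) := by
    intro l m h
    by_contra hne
    have := congrFun h l
    simp [Pi.single_eq_of_ne hne] at this
  have h0 : (0 : Fin d → Fin 3) ∉ s := by
    intro h
    obtain ⟨l, _, hl⟩ := Finset.mem_image.1 h
    have := congrFun hl l
    simp at this
  have hsub : insert 0 s ⊆ multiIndices d 2 := by
    intro α hα
    rcases Finset.mem_insert.1 hα with rfl | h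
    · simp [multiIndices]
    · obtain ⟨l, _, rfl⟩ := Finset.mem_image.1 h
      exact single_mem_multiIndices l 2
  refine le_trans (le_of_eq ?_)
    (Finset.sum_le_sum_of_subset_of_nonneg hsub fun _ _ _ => norm_nonneg _)
  rw [Finset.sum_insert h0, Finset.sum_image fun l _ m _ h => hinj h, EuclideanSpace.norm_sq_eq]
  congr 1
  · simp [derivSymbol]
  · refine Finset.sum_congr rfl fun l _ => ?_
    rw [derivSymbol_single]
    simp

theorem MemW.integrable_weight {g : LOne d n} (hg : MemW 2 g) :
    Integrable fun k => (1 + ‖k‖ ^ 2) * ‖g k‖ := by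
  have h : Integrable fun k => ∑ α ∈ multiIndices d 2, ‖derivSymbol α k • g k‖ :=
    integrable_finsetSum _ fun α hα => (hg α hα).norm
  refine h.mono' ?_ (ae_of_all _ fun k => ?_)
  · exact (by fun_prop : Continuous fun k : RSpace d => 1 + ‖k‖ ^ 2).aestronglyMeasurable.mul
      (L1.integrable_coeFn g).1.norm
  · rw [Real.norm_of_nonneg (by positivity)]
    simp only [norm_smul]
    rw [← Finset.sum_mul]
    exact mul_le_mul_of_nonneg_right (weight_le_sum k) (norm_nonneg _)

theorem MemW.integral_weight_le {g : LOne d n} (hg : MemW 2 g) :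
    ∫ k, (1 + ‖k‖ ^ 2) * ‖g k‖ ≤ wNorm 2 g := by
  rw [wNorm, ← integral_finsetSum _ fun α hα => (hg α hα).norm]
  refine integral_mono hg.integrable_weight
    (integrable_finsetSum _ fun α hα => (hg α hα).norm) fun k => ?_
  simp only [norm_smul]
  rw [← Finset.sum_mul]
  exact mul_le_mul_of_nonneg_right (weight_le_sum k) (norm_nonneg _)

/-! ### Cut-offs and weights -/

theorem mulOp_comm {α E : Type*} [MeasurableSpace α] [NormedAddCommGroup E] [NormedSpace ℝ E]
    {μ : Measure α} {φ ψ : α → E →L[ℝ] E} {C C' : ℝ} (h : IsBddMul μ φ C) (h' : IsBddMul μ ψ C')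
    (heq : ∀ k, φ k ∘L ψ k = ψ k ∘L φ k) (f : Lp E 1 μ) :
    mulOp μ φ (mulOp μ ψ f) = mulOp μ ψ (mulOp μ φ f) := by
  apply Lp.ext
  filter_upwards [coeFn_mulOp h (mulOp μ ψ f), coeFn_mulOp h' f, coeFn_mulOp h' (mulOp μ φ f),
    coeFn_mulOp h f] with k h1 h2 h3 h4
  rw [h1, h2, h3, h4]
  exact DFunLike.congr_fun (heq k) _

theorem cmul_comm {α : Type*} [MeasurableSpace α] {μ : Measure α} {c c' : α → ℂ} {C C' : ℝ}
    (h : IsBddMul μ c C) (h' : IsBddMul μ c' C') (f : Lp (CSpace n) 1 μ) :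
    mulOp μ (cmul n c) (mulOp μ (cmul n c') f) = mulOp μ (cmul n c') (mulOp μ (cmul n c) f) :=
  mulOp_comm (isBddMul_cmul h) (isBddMul_cmul h') (fun k => by
    ext1 w
    simp only [ContinuousLinearMap.comp_apply, cmul_apply, smul_smul, mul_comm]) f

theorem norm_phase_mulOp {α : Type*} [MeasurableSpace α] {μ : Measure α} {q : α → ℝ} {Q : ℝ}
    (hq : IsBddMul μ q Q) (s : ℝ) (f : Lp (CSpace n) 1 μ) :
    ‖mulOp μ (cmul n (phase q s)) f‖ = ‖f‖ := by
  have h : ∀ᵐ k ∂μ, ‖mulOp μ (cmul n (phase q s)) f k‖ = ‖f k‖ := by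
    filter_upwards [coeFn_mulOp (isBddMul_cmul (isBddMul_phase hq s)) f] with k hk
    rw [hk, cmul_apply, norm_smul, norm_phase, one_mul]
  exact le_antisymm (Lp.norm_le_norm_of_ae_le (h.mono fun _ hk => hk.le))
    (Lp.norm_le_norm_of_ae_le (h.mono fun _ hk => hk.ge))

theorem phase_neg_mulOp_phase {q : RSpace d → ℝ} {Q : ℝ} (hq : IsBddMul volume q Q) (s : ℝ)
    (f : LOne d n) : mulOp volume (cmul n (phase q (-s))) (mulOp volume (cmul n (phase q s)) f) =
      f := by
  apply Lp.ext
  filter_upwards [coeFn_mulOp (isBddMul_cmul (isBddMul_phase hq (-s)))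
    (mulOp volume (cmul n (phase q s)) f), coeFn_mulOp (isBddMul_cmul (isBddMul_phase hq s)) f]
    with k h1 h2
  rw [h1, h2, cmul_apply, cmul_apply, smul_smul, phase, phase, ← Complex.exp_add]
  have : I * (((-s : ℝ) : ℂ) * q k) + I * (s * q k) = 0 := by push_cast; ring
  rw [this, Complex.exp_zero, one_smul]

/-- The indicator function of the ball of radius `ρ`. -/
def cut (ρ : ℝ) (k : RSpace d) : ℝ := if ‖k‖ ≤ ρ then 1 else 0

theorem cut_of_le {ρ : ℝ} {k : RSpace d} (h : ‖k‖ ≤ ρ) : cut ρ k = 1 := if_pos h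

theorem cut_of_lt {ρ : ℝ} {k : RSpace d} (h : ρ < ‖k‖) : cut ρ k = 0 := if_neg h.not_ge

theorem isBddMul_cut (ρ : ℝ) : IsBddMul volume (fun k : RSpace d => (cut ρ k : ℂ)) 1 := by
  refine isBddMul_ofReal ⟨?_, zero_le_one, fun k => ?_⟩
  · exact (Measurable.ite (measurableSet_le measurable_norm measurable_const) measurable_const
      measurable_const).aestronglyMeasurable
  · unfold cut
    split_ifs <;> simp

/-- Restriction to the ball of radius `ρ`. -/
def cutOp (ρ : ℝ) : LOne d n →L[ℝ] LOne d n := mulOp volume (cmul n fun k => (cut ρ k : ℂ))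

theorem coeFn_cutOp (ρ : ℝ) (f : LOne d n) : cutOp ρ f =ᵐ[volume] fun k => (cut ρ k : ℂ) • f k :=
  coeFn_mulOp (isBddMul_cmul (isBddMul_cut ρ)) f

theorem norm_cutOp_le (ρ : ℝ) (f : LOne d n) : ‖cutOp ρ f‖ ≤ ‖f‖ :=
  (norm_mulOp_apply_le (isBddMul_cmul (isBddMul_cut ρ)) f).trans_eq (one_mul _)

/-- Dominated convergence along balls exhausting the space. -/
theorem norm_le_of_norm_cutOp_le {f : LOne d n} {c : ℝ} (h : ∀ ρ > 0, ‖cutOp ρ f‖ ≤ c) :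
    ‖f‖ ≤ c := by
  have hi := L1.integrable_coeFn f
  have h1 : Tendsto (fun N : ℕ => ∫ k, ‖((cut ((N : ℝ) + 1) k : ℝ) : ℂ) • f k‖) atTop
      (𝓝 (∫ k, ‖f k‖)) := by
    refine tendsto_integral_of_dominated_convergence (fun k => ‖f k‖) (fun N => ?_) hi.norm
      (fun N => ae_of_all _ fun k => ?_) (ae_of_all _ fun k => ?_)
    · exact ((isBddMul_cut _).meas.smul hi.1).norm
    · rw [norm_norm, norm_smul]
      exact mul_le_of_le_one_left (norm_nonneg _) ((isBddMul_cut _).bound k)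
    · refine tendsto_const_nhds.congr' ?_
      filter_upwards [eventually_ge_atTop ⌈‖k‖⌉₊] with N hN
      have : ‖k‖ ≤ (N : ℝ) + 1 := ((Nat.le_ceil _).trans (Nat.cast_le.2 hN)).trans (by simp)
      rw [cut_of_le this, ofReal_one, one_smul]
  rw [L1.norm_eq_integral_norm]
  refine le_of_tendsto' h1 fun N => ?_
  have h2 := h ((N : ℝ) + 1) (by positivity)
  rw [L1.norm_eq_integral_norm] at h2
  refine le_trans (le_of_eq (integral_congr_ae ?_)) h2
  filter_upwards [coeFn_cutOp ((N : ℝ) + 1) f] with k hk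
  rw [hk]

theorem conjRefl_cutOp (ρ : ℝ) (f : LOne d n) : conjRefl (cutOp ρ f) = cutOp ρ (conjRefl f) :=
  conjRefl_cmul (isBddMul_cut ρ) (isBddMul_cut ρ) (fun k => by simp [cut]) f

/-- The bounded weight `min(1 + |k|², R)`. -/
def weight (R : ℝ) (k : RSpace d) : ℝ := min (1 + ‖k‖ ^ 2) R

theorem one_le_weight {R : ℝ} (hR : 1 ≤ R) (k : RSpace d) : 1 ≤ weight R k :=
  le_min (le_add_of_nonneg_right (sq_nonneg _)) hR

theorem isBddMul_weight {R : ℝ} (hR : 1 ≤ R) : IsBddMul volume (weight R : RSpace d → ℝ) R :=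
  ⟨(by unfold weight; fun_prop : Continuous (weight R : RSpace d → ℝ)).aestronglyMeasurable,
    zero_le_one.trans hR, fun k => by
      rw [Real.norm_of_nonneg (zero_le_one.trans (one_le_weight hR k))]
      exact min_le_right _ _⟩

/-- If no weight on the right is truncated, this is `(a+b+c)² ≤ 3(a²+b²+c²)`. If one is, the product
is at least `R` because the other factors are at least `1`. The constant `3` does not depend on `R`.
-/
theorem weight_add_le {R : ℝ} (hR : 1 ≤ R) (k₁ k₂ k₃ : RSpace d) :
    weight R (k₁ + k₂ + k₃) ≤ 3 * (weight R k₁ * weight R k₂ * weight R k₃) := by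
  have h1 := one_le_weight hR k₁
  have h2 := one_le_weight hR k₂
  have h3 := one_le_weight hR k₃
  have h12 : 1 ≤ weight R k₁ * weight R k₂ := one_le_mul_of_one_le_of_one_le h1 h2
  have h13 : 1 ≤ weight R k₁ * weight R k₃ := one_le_mul_of_one_le_of_one_le h1 h3
  have h23 : 1 ≤ weight R k₂ * weight R k₃ := one_le_mul_of_one_le_of_one_le h2 h3
  have hle : weight R (k₁ + k₂ + k₃) ≤ R := min_le_right _ _
  rcases le_total (1 + ‖k₁‖ ^ 2) R with c1 | c1
  · rcases le_total (1 + ‖k₂‖ ^ 2) R with c2 | c2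
    · rcases le_total (1 + ‖k₃‖ ^ 2) R with c3 | c3
      · refine (min_le_left _ _).trans ?_
        rw [weight, weight, weight, min_eq_left c1, min_eq_left c2, min_eq_left c3]
        have hn : ‖k₁ + k₂ + k₃‖ ≤ ‖k₁‖ + ‖k₂‖ + ‖k₃‖ := norm_add₃_le
        have hs : ‖k₁ + k₂ + k₃‖ ^ 2 ≤ (‖k₁‖ + ‖k₂‖ + ‖k₃‖) ^ 2 :=
          pow_le_pow_left₀ (norm_nonneg _) hn 2
        have p12 := mul_nonneg (sq_nonneg ‖k₁‖) (sq_nonneg ‖k₂‖)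
        have p13 := mul_nonneg (sq_nonneg ‖k₁‖) (sq_nonneg ‖k₃‖)
        have p23 := mul_nonneg (sq_nonneg ‖k₂‖) (sq_nonneg ‖k₃‖)
        have p123 := mul_nonneg p12 (sq_nonneg ‖k₃‖)
        nlinarith [sq_nonneg (‖k₁‖ - ‖k₂‖), sq_nonneg (‖k₁‖ - ‖k₃‖), sq_nonneg (‖k₂‖ - ‖k₃‖)]
      · have : weight R k₃ = R := min_eq_right c3
        rw [this]
        nlinarith
    · have : weight R k₂ = R := min_eq_right c2
      rw [this] at h12 h23 ⊢
      nlinarith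
  · have : weight R k₁ = R := min_eq_right c1
    rw [this] at h12 h13 ⊢
    nlinarith

/-- Multiplication by the weight. -/
def weightOp (R : ℝ) : LOne d n →L[ℝ] LOne d n :=
  mulOp volume (cmul n fun k => (weight R k : ℂ))

theorem isBddMul_weight' {R : ℝ} (hR : 1 ≤ R) :
    IsBddMul volume (fun k : RSpace d => (weight R k : ℂ)) R :=
  isBddMul_ofReal (isBddMul_weight hR)

theorem norm_weightOp_coeFn {R : ℝ} (hR : 1 ≤ R) (f : LOne d n) :
    ∀ᵐ k, ‖weightOp R f k‖ = weight R k * ‖f k‖ := by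
  filter_upwards [coeFn_mulOp (isBddMul_cmul (isBddMul_weight' hR)) f] with k hk
  rw [weightOp, hk, cmul_apply, norm_smul, norm_real,
    Real.norm_of_nonneg (zero_le_one.trans (one_le_weight hR k))]

theorem norm_le_norm_weightOp {R : ℝ} (hR : 1 ≤ R) (f : LOne d n) : ‖f‖ ≤ ‖weightOp R f‖ := by
  refine Lp.norm_le_norm_of_ae_le ?_
  filter_upwards [norm_weightOp_coeFn hR f] with k hk
  rw [hk]
  exact le_mul_of_one_le_left (norm_nonneg _) (one_le_weight hR k)

/-- Outside the ball the truncated weight equals `1 + ρ²`. For `ρ = ρ₀/ε` the prefactor is `ε²/ρ₀²`,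
which is the order required of `u_3`. -/
theorem norm_sub_cutOp_le {ρ : ℝ} (hρ : 0 < ρ) (f : LOne d n) :
    ‖f - cutOp ρ f‖ ≤ (ρ ^ 2)⁻¹ * ‖weightOp (1 + ρ ^ 2) f‖ := by
  have hR : 1 ≤ 1 + ρ ^ 2 := le_add_of_nonneg_right (sq_nonneg _)
  refine Lp.norm_le_mul_norm_of_ae_le_mul ?_
  filter_upwards [norm_weightOp_coeFn hR f, coeFn_cutOp ρ f, Lp.coeFn_sub f (cutOp ρ f)]
    with k hk hk' hk''
  rw [hk'', Pi.sub_apply, hk', hk]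
  by_cases h : ‖k‖ ≤ ρ
  · rw [cut_of_le h, ofReal_one, one_smul, sub_self, norm_zero]
    exact mul_nonneg (by positivity)
      (mul_nonneg (zero_le_one.trans (one_le_weight hR k)) (norm_nonneg _))
  · have h := not_le.1 h
    have hw : weight (1 + ρ ^ 2) k = 1 + ρ ^ 2 :=
      min_eq_right (by gcongr)
    rw [cut_of_lt h, ofReal_zero, zero_smul, sub_zero, hw, ← mul_assoc]
    refine le_mul_of_one_le_left (norm_nonneg _) ?_
    rw [inv_mul_eq_div, le_div_iff₀ (by positivity)]
    linarith

theorem norm_weightOp_conjRefl {R : ℝ} (hR : 1 ≤ R) (f : LOne d n) :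
    ‖weightOp R (conjRefl f)‖ = ‖weightOp R f‖ := by
  rw [← norm_conjRefl (weightOp R f), weightOp,
    conjRefl_cmul (isBddMul_weight' hR) (isBddMul_weight' hR) (fun k => by simp [weight]) f]

theorem norm_weightOp_le_wNorm {R : ℝ} (hR : 1 ≤ R) {g : LOne d n} (hg : MemW 2 g) :
    ‖weightOp R g‖ ≤ wNorm 2 g := by
  refine le_trans ?_ hg.integral_weight_le
  rw [L1.norm_eq_integral_norm]
  refine integral_mono_ae (L1.integrable_coeFn _).norm hg.integrable_weight ?_
  filter_upwards [norm_weightOp_coeFn hR g] with k hk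
  rw [hk]
  exact mul_le_mul_of_nonneg_right (min_le_left _ _) (norm_nonneg _)

/-! ### Modes -/

namespace Data.Eigendecomposition

variable [NeZero n] {S : Data d n}

theorem projOp_cmul (D : S.Eigendecomposition) (j : ℤ) (ℓ : Fin n) {ε : ℝ} (hε : ε ≠ 0)
    {c : RSpace d → ℂ} {C : ℝ} (h : IsBddMul volume c C) (f : LOne d n) :
    D.projOp j ℓ ε (mulOp volume (cmul n c) f) = mulOp volume (cmul n c) (D.projOp j ℓ ε f) :=
  mulOp_comm (D.isBddMul_rankOneL j ℓ hε) (isBddMul_cmul h) (fun k => by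
    ext1 w
    simp only [ContinuousLinearMap.comp_apply, cmul_apply, rankOneL_smul]) f

/-- The eigenvalue `λ_{jℓ}(εk)`, frozen outside the ball of radius `ρ`. -/
def cutLam (D : S.Eigendecomposition) (j : ℤ) (ℓ : Fin n) (ε ρ : ℝ) (k : RSpace d) : ℝ :=
  if ‖k‖ ≤ ρ then D.lam j ℓ (ε • k) else D.lam j ℓ 0

/-- On the ball each of the `d` coordinates of `εk` is at most `ερ`; outside, the difference
vanishes by freezing. The modulus `|C|` appears because the sign of `C` is not prescribed. -/
theorem abs_cutLam_sub_le (D : S.Eigendecomposition) {C : ℝ} (hL : D.LipschitzBound C) (j : ℤ)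
    (ℓ : Fin n) {ε ρ : ℝ} (hε : 0 ≤ ε) (hρ : 0 ≤ ρ) (k : RSpace d) :
    |D.cutLam j ℓ ε ρ k - D.lam j ℓ 0| ≤ |C| * d * (ε * ρ) := by
  unfold cutLam
  split_ifs with h
  · have h1 := hL ℓ ((j : ℝ) • S.κ + 0) ((j : ℝ) • S.κ + ε • k)
    have h2 : D.lam j ℓ (ε • k) - D.lam j ℓ 0 =
        D.ev ℓ ((j : ℝ) • S.κ + ε • k) - D.ev ℓ ((j : ℝ) • S.κ + 0) := by
      simp only [lam]
      ring
    rw [h2]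
    have h3 : ∑ i, |((j : ℝ) • S.κ + ε • k) i - ((j : ℝ) • S.κ + 0) i| ≤ d * (ε * ρ) := by
      refine (Finset.sum_le_card_nsmul _ _ (ε * ρ) fun i _ => ?_).trans_eq (by simp)
      have : ((j : ℝ) • S.κ + ε • k) i - ((j : ℝ) • S.κ + 0) i = ε * k i := by simp
      rw [this, abs_mul, abs_of_nonneg hε]
      exact mul_le_mul_of_nonneg_left ((PiLp.norm_apply_le k i).trans h) hε
    have h4 : 0 ≤ ∑ i, |((j : ℝ) • S.κ + ε • k) i - ((j : ℝ) • S.κ + 0) i| :=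
      Finset.sum_nonneg fun _ _ => abs_nonneg _
    calc _ ≤ _ := h1
      _ ≤ |C| * ∑ i, |((j : ℝ) • S.κ + ε • k) i - ((j : ℝ) • S.κ + 0) i| :=
        mul_le_mul_of_nonneg_right (le_abs_self C) h4
      _ ≤ |C| * (d * (ε * ρ)) := mul_le_mul_of_nonneg_left h3 (abs_nonneg _)
      _ = _ := by ring
  · rw [sub_self, abs_zero]
    positivity

/-- The frequency `λ_{jℓ}(εk)/ε`, frozen outside the ball of radius `ρ`. -/
def freq (D : S.Eigendecomposition) (j : ℤ) (ℓ : Fin n) (ε ρ : ℝ) (k : RSpace d) : ℝ :=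
  D.cutLam j ℓ ε ρ k / ε

theorem abs_freq_sub_le (D : S.Eigendecomposition) {C : ℝ} (hL : D.LipschitzBound C) (j : ℤ)
    (ℓ : Fin n) {ε ρ : ℝ} (hε : 0 < ε) (hρ : 0 ≤ ρ) (k : RSpace d) :
    |D.freq j ℓ ε ρ k - D.lam j ℓ 0 / ε| ≤ |C| * d * (ε * ρ) / ε := by
  rw [freq, ← sub_div, abs_div, abs_of_pos hε]
  exact div_le_div_of_nonneg_right (D.abs_cutLam_sub_le hL j ℓ hε.le hρ k) hε.le

theorem isBddMul_freq (D : S.Eigendecomposition) {C : ℝ} (hL : D.LipschitzBound C) (j : ℤ)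
    (ℓ : Fin n) {ε ρ : ℝ} (hε : 0 < ε) (hρ : 0 ≤ ρ) :
    IsBddMul volume (D.freq j ℓ ε ρ) (|C| * d * (ε * ρ) / ε + |D.lam j ℓ 0 / ε|) := by
  refine ⟨?_, by positivity, fun k => ?_⟩
  · have h1 : AEStronglyMeasurable (D.cutLam j ℓ ε ρ) :=
      AEStronglyMeasurable.piecewise (s := {k : RSpace d | ‖k‖ ≤ ρ})
        (measurableSet_le measurable_norm measurable_const)
        (D.aestronglyMeasurable_lam j ℓ hε.ne').restrict aestronglyMeasurable_const
    exact (h1.aemeasurable.div_const ε).aestronglyMeasurable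
  · have h1 := D.abs_freq_sub_le hL j ℓ hε hρ k
    have h2 := abs_add_le (D.freq j ℓ ε ρ k - D.lam j ℓ 0 / ε) (D.lam j ℓ 0 / ε)
    rw [sub_add_cancel] at h2
    rw [Real.norm_eq_abs]
    linarith

/-- The `ℓ`-th mode of `U j`, restricted to the ball of radius `ρ`, in the rotating frame. -/
def mode (D : S.Eigendecomposition) (U : ℤ → ℝ → LOne d n) (j : ℤ) (ℓ : Fin n) (ε ρ s : ℝ) :
    LOne d n :=
  mulOp volume (cmul n (phase (D.freq j ℓ ε ρ) s)) (D.projOp j ℓ ε (cutOp ρ (U j s)))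

theorem phase_neg_mode (D : S.Eigendecomposition) {C : ℝ} (hL : D.LipschitzBound C)
    (U : ℤ → ℝ → LOne d n) (j : ℤ) (ℓ : Fin n) {ε ρ : ℝ} (hε : 0 < ε) (hρ : 0 ≤ ρ) (s : ℝ) :
    mulOp volume (cmul n (phase (D.freq j ℓ ε ρ) (-s))) (D.mode U j ℓ ε ρ s) =
      D.projOp j ℓ ε (cutOp ρ (U j s)) :=
  phase_neg_mulOp_phase (D.isBddMul_freq hL j ℓ hε hρ) s _

theorem norm_mode (D : S.Eigendecomposition) {C : ℝ} (hL : D.LipschitzBound C)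
    (U : ℤ → ℝ → LOne d n) (j : ℤ) (ℓ : Fin n) {ε ρ : ℝ} (hε : 0 < ε) (hρ : 0 ≤ ρ) (s : ℝ) :
    ‖D.mode U j ℓ ε ρ s‖ = ‖D.projOp j ℓ ε (cutOp ρ (U j s))‖ :=
  norm_phase_mulOp (D.isBddMul_freq hL j ℓ hε hρ) s _

theorem continuousOn_mode (D : S.Eigendecomposition) {C : ℝ} (hL : D.LipschitzBound C)
    {U : ℤ → ℝ → LOne d n} {j : ℤ} (ℓ : Fin n) {ε ρ : ℝ} (hε : 0 < ε) (hρ : 0 ≤ ρ) {A : Set ℝ}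
    (hU : ContinuousOn (U j) A) : ContinuousOn (D.mode U j ℓ ε ρ) A := by
  have hc : Continuous fun s => mulOp volume (cmul n (phase (D.freq j ℓ ε ρ) s)) :=
    continuous_iff_continuousAt.2 fun s =>
      (hasDerivAt_phase (D.isBddMul_freq hL j ℓ hε hρ) s).continuousAt
  exact hc.continuousOn.clm_apply
    ((D.projOp j ℓ ε ∘L cutOp ρ).continuous.comp_continuousOn hU)

/-- On the ball the frozen frequency is the true one, and the derivative of the phase cancels the
linear part of the equation. Off the ball both sides vanish because of the cut-off. -/
theorem hasDerivAt_mode (D : S.Eigendecomposition) {C : ℝ} (hL : D.LipschitzBound C)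
    {ε τ : ℝ} {p : LOne d n} {U : ℤ → ℝ → LOne d n} (hU : S.IsClassicalSolution 3 ε τ p U)
    {j : ℤ} (hj : j ∈ modes 3) (hj0 : 0 < j) (ℓ : Fin n) {ρ : ℝ} (hε : 0 < ε) (hρ : 0 ≤ ρ)
    {s : ℝ} (hs : s ∈ Ioo 0 τ) :
    HasDerivAt (D.mode U j ℓ ε ρ) (mulOp volume (cmul n (phase (D.freq j ℓ ε ρ) s))
      (ε • D.projOp j ℓ ε (cutOp ρ (S.nonlin U j s)))) s := by
  obtain ⟨V, hV, hVe⟩ := hU.hasDerivAt hε hj hj0 hs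
  have hq := D.isBddMul_freq hL j ℓ hε hρ
  have h1 := (hasDerivAt_phase (n := n) hq s).clm_apply
    ((D.projOp j ℓ ε ∘L cutOp ρ).hasFDerivAt.comp_hasDerivAt s hV)
  have hb : IsBddMul volume (fun k => I * (D.freq j ℓ ε ρ k : ℂ) * phase (D.freq j ℓ ε ρ) s k) _ :=
    ((isBddMul_const I).mul (isBddMul_ofReal hq)).mul (isBddMul_phase hq s)
  convert! h1 using 1
  simp only [ContinuousLinearMap.comp_apply, Function.comp_apply]
  apply Lp.ext
  filter_upwards [hVe, Lp.coeFn_add (mulOp volume (cmul n fun k =>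
      I * (D.freq j ℓ ε ρ k : ℂ) * phase (D.freq j ℓ ε ρ) s k) (D.projOp j ℓ ε (cutOp ρ (U j s))))
      (mulOp volume (cmul n (phase (D.freq j ℓ ε ρ) s)) (D.projOp j ℓ ε (cutOp ρ V))),
    coeFn_mulOp (isBddMul_cmul hb) (D.projOp j ℓ ε (cutOp ρ (U j s))),
    coeFn_mulOp (isBddMul_cmul (isBddMul_phase hq s)) (D.projOp j ℓ ε (cutOp ρ V)),
    coeFn_mulOp (isBddMul_cmul (isBddMul_phase hq s))
      (ε • D.projOp j ℓ ε (cutOp ρ (S.nonlin U j s))),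
    Lp.coeFn_smul ε (D.projOp j ℓ ε (cutOp ρ (S.nonlin U j s))),
    coeFn_mulOp (D.isBddMul_rankOneL j ℓ hε.ne') (cutOp ρ (U j s)),
    coeFn_mulOp (D.isBddMul_rankOneL j ℓ hε.ne') (cutOp ρ V),
    coeFn_mulOp (D.isBddMul_rankOneL j ℓ hε.ne') (cutOp ρ (S.nonlin U j s)),
    coeFn_cutOp ρ (U j s), coeFn_cutOp ρ V, coeFn_cutOp ρ (S.nonlin U j s)]
    with k eV e0 e1 e2 e3 e4 e5 e6 e7 e8 e9 e10
  rw [e0, Pi.add_apply, e1, e2, e3, e4, Pi.smul_apply, projOp, e5, e6, e7, e8, e9, e10, eV]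
  simp only [cmul_apply, rankOneL_smul]
  by_cases h : ‖k‖ ≤ ρ
  · rw [cut_of_le h, map_add, map_neg, rankOneL_smul, rankOneL_psi_L, rankOneL_smul, freq, cutLam,
      if_pos h]
    have hε' : (ε : ℂ) ≠ 0 := by exact_mod_cast hε.ne'
    simp only [ofReal_one, one_smul, smul_add, smul_neg, smul_smul, ofReal_div]
    rw [← add_assoc, ← sub_eq_add_neg, ← sub_smul]
    have : I * ((D.lam j ℓ (ε • k) : ℂ) / ε) * phase (D.freq j ℓ ε ρ) s k -
        phase (D.freq j ℓ ε ρ) s k * (1 * (I / ε * D.lam j ℓ (ε • k))) = 0 := by ring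
    rw [this, zero_smul, zero_add, one_mul, mul_smul, Complex.coe_smul]
  · rw [cut_of_lt (not_le.1 h)]
    simp

end Data.Eigendecomposition

/-! ### Growth of weighted norms -/

/-- The mean value inequality is applied on `[a,t]` with `a > 0`, and `a → 0` by continuity; no
derivative at the end points is required. -/
theorem norm_sub_le_of_hasDerivAt_Ioo {E : Type*} [NormedAddCommGroup E] [NormedSpace ℝ E]
    {f : ℝ → E} {t C : ℝ} (ht : 0 ≤ t) (hc : ContinuousOn f (Icc 0 t))
    (hd : ∀ s ∈ Ioo 0 t, ∃ f', HasDerivAt f f' s ∧ ‖f'‖ ≤ C) : ‖f t - f 0‖ ≤ C * t := by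
  rcases ht.eq_or_lt with rfl | ht
  · simp
  have h1 : ∀ a ∈ Ioo 0 t, ‖f t - f a‖ ≤ C * (t - a) := by
    intro a ha
    refine norm_image_sub_le_of_norm_deriv_right_le_segment (f' := deriv f)
      (hc.mono (Icc_subset_Icc_left ha.1.le)) (fun s hs => ?_) (fun s hs => ?_) t
      ⟨ha.2.le, le_rfl⟩
    · obtain ⟨f', hf, -⟩ := hd s ⟨ha.1.trans_le hs.1, hs.2⟩
      exact hf.differentiableAt.hasDerivAt.hasDerivWithinAt
    · obtain ⟨f', hf, hb⟩ := hd s ⟨ha.1.trans_le hs.1, hs.2⟩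
      rwa [hf.deriv]
  have hne : (𝓝[Ioo 0 t] (0 : ℝ)).NeBot := by
    rw [nhdsWithin_Ioo_eq_nhdsGT ht]
    infer_instance
  have hf0 : Tendsto f (𝓝[Ioo 0 t] 0) (𝓝 (f 0)) :=
    (hc 0 ⟨le_rfl, ht.le⟩).mono Ioo_subset_Icc_self
  have h2 : Tendsto (fun a => ‖f t - f a‖) (𝓝[Ioo 0 t] 0) (𝓝 ‖f t - f 0‖) :=
    (tendsto_const_nhds.sub hf0).norm
  have h3 : Tendsto (fun a : ℝ => C * (t - a)) (𝓝[Ioo 0 t] 0) (𝓝 (C * (t - 0))) :=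
    ((by fun_prop : Continuous fun a : ℝ => C * (t - a)).tendsto 0).mono_left nhdsWithin_le_nhds
  rw [sub_zero] at h3
  exact le_of_tendsto_of_tendsto h2 h3 (eventually_nhdsWithin_of_forall h1)

theorem Data.IsClassicalSolution.continuousOn {S : Data d n} {m : ℕ} {ε τ : ℝ} {p : LOne d n}
    {U : ℤ → ℝ → LOne d n} (hU : S.IsClassicalSolution m ε τ p U) {j : ℤ} (hj : j ∈ modes m)
    (hj0 : 0 < j) {t : ℝ} (ht : t ≤ τ) : ContinuousOn (U j) (Icc 0 t) :=
  (hU.contDiff j hj hj0).continuousOn.mono (Icc_subset_Icc_right ht)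

namespace Data.Eigendecomposition

variable [NeZero n] {S : Data d n}

theorem norm_projOp_cutOp_le (D : S.Eigendecomposition) (j : ℤ) (ℓ : Fin n) {ε : ℝ} (hε : ε ≠ 0)
    (ρ : ℝ) (f : LOne d n) : ‖D.projOp j ℓ ε (cutOp ρ f)‖ ≤ ‖f‖ :=
  (D.norm_projOp_le j ℓ hε _).trans (norm_cutOp_le ρ f)

theorem projOp_cutOp_cmul (D : S.Eigendecomposition) (j : ℤ) (ℓ : Fin n) {ε : ℝ} (hε : ε ≠ 0)
    (ρ : ℝ) {c : RSpace d → ℂ} {C : ℝ} (h : IsBddMul volume c C) (f : LOne d n) :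
    mulOp volume (cmul n c) (D.projOp j ℓ ε (cutOp ρ f)) =
      D.projOp j ℓ ε (cutOp ρ (mulOp volume (cmul n c) f)) := by
  rw [← D.projOp_cmul j ℓ hε h, cutOp, cmul_comm h (isBddMul_cut ρ)]

theorem norm_weightOp_phase (D : S.Eigendecomposition) {C : ℝ} (hL : D.LipschitzBound C)
    (j : ℤ) (ℓ : Fin n) {ε ρ R : ℝ} (hε : 0 < ε) (hρ : 0 ≤ ρ) (hR : 1 ≤ R) (s : ℝ)
    (f : LOne d n) :
    ‖weightOp R (mulOp volume (cmul n (phase (D.freq j ℓ ε ρ) s)) (D.projOp j ℓ ε (cutOp ρ f)))‖ =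
      ‖D.projOp j ℓ ε (cutOp ρ (weightOp R f))‖ := by
  have hq := D.isBddMul_freq hL j ℓ hε hρ
  rw [weightOp, cmul_comm (isBddMul_weight' hR) (isBddMul_phase hq s), norm_phase_mulOp hq,
    D.projOp_cutOp_cmul j ℓ hε.ne' ρ (isBddMul_weight' hR)]

/-- Weights commute with phases and projections, so the linear flow does not increase the weighted
norm of a mode. Summing over the modes costs the factor `n`; the radius `ρ` is arbitrary and is
removed at the end. -/
theorem norm_weightOp_le (D : S.Eigendecomposition) {C : ℝ} (hL : D.LipschitzBound C)
    {ε τ : ℝ} {p : LOne d n} {U : ℤ → ℝ → LOne d n} (hU : S.IsClassicalSolution 3 ε τ p U)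
    {j : ℤ} (hj : j ∈ modes 3) (hj0 : 0 < j) (hε : 0 < ε) {R M t : ℝ} (hR : 1 ≤ R)
    (ht : t ∈ Icc 0 τ) (hM : ∀ s ∈ Ioo 0 t, ‖weightOp R (S.nonlin U j s)‖ ≤ M) :
    ‖weightOp R (U j t)‖ ≤ n * (‖weightOp R (U j 0)‖ + ε * M * t) := by
  refine norm_le_of_norm_cutOp_le fun ρ hρ => ?_
  rw [← D.sum_projOp j hε.ne' (cutOp ρ (weightOp R (U j t)))]
  refine (norm_sum_le _ _).trans ((Finset.sum_le_card_nsmul _ _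
    (‖weightOp R (U j 0)‖ + ε * M * t) fun ℓ _ => ?_).trans_eq (by simp [mul_add]))
  rw [← D.norm_weightOp_phase hL j ℓ hε hρ.le hR t]
  have h1 := norm_sub_le_of_hasDerivAt_Ioo (f := fun s => weightOp R (D.mode U j ℓ ε ρ s))
    (C := ε * M) ht.1 ((weightOp R).continuous.comp_continuousOn
      (D.continuousOn_mode hL ℓ hε hρ.le (hU.continuousOn hj hj0 ht.2))) fun s hs =>
      ⟨_, (weightOp R).hasFDerivAt.comp_hasDerivAt s
        (D.hasDerivAt_mode hL hU hj hj0 ℓ hε hρ.le ⟨hs.1, hs.2.trans_le ht.2⟩), ?_⟩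
  · have h2 : ‖weightOp R (D.mode U j ℓ ε ρ 0)‖ ≤ ‖weightOp R (U j 0)‖ :=
      (D.norm_weightOp_phase hL j ℓ hε hρ.le hR 0 _).trans_le
        (D.norm_projOp_cutOp_le j ℓ hε.ne' ρ _)
    have h3 := norm_sub_norm_le (weightOp R (D.mode U j ℓ ε ρ t)) (weightOp R (D.mode U j ℓ ε ρ 0))
    exact (by linarith : ‖weightOp R (D.mode U j ℓ ε ρ t)‖ ≤ ‖weightOp R (U j 0)‖ + ε * M * t)
  · rw [map_smul, map_smul, norm_smul, Real.norm_of_nonneg hε.le]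
    refine mul_le_mul_of_nonneg_left ?_ hε.le
    exact (D.norm_weightOp_phase hL j ℓ hε hρ.le hR s _).trans_le
      ((D.norm_projOp_cutOp_le j ℓ hε.ne' ρ _).trans (hM s hs))

end Data.Eigendecomposition

/-! ### Elimination of non-resonant terms -/

/-- Normal-form step: subtracting the correctors from `y` cancels the interactions in `G`, leaving
the remainder `R` and terms with differentiated factors. Keeping the initial bound `K` separate from
the running bound `r` matters: the boundary term sees only `K`, so every power of `r` comes with a
factor `t`. -/
theorem Data.norm_le_of_nonresonant (S : Data d n) {ι : Type*} (G : Finset ι)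
    {q₀ : RSpace d → ℝ} {q₁ q₂ q₃ : ι → RSpace d → ℝ} {Q₀ : ℝ} {Q₁ Q₂ Q₃ : ι → ℝ}
    {ε δ R K r r' t : ℝ} {y N : ℝ → LOne d n} {g₁ g₂ g₃ : ι → ℝ → LOne d n}
    {Pr : LOne d n →L[ℝ] LOne d n}
    (h₀ : IsBddMul volume q₀ Q₀) (h₁ : ∀ i ∈ G, IsBddMul volume (q₁ i) (Q₁ i))
    (h₂ : ∀ i ∈ G, IsBddMul volume (q₂ i) (Q₂ i)) (h₃ : ∀ i ∈ G, IsBddMul volume (q₃ i) (Q₃ i))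
    (hε : 0 ≤ ε) (hδ : 0 < δ) (ht : 0 ≤ t)
    (hlow : ∀ i ∈ G, ∀ k₁ k₂ k₃, δ ≤ |q₀ (k₁ + k₂ + k₃) - q₁ i k₁ - q₂ i k₂ - q₃ i k₃|)
    (hPr : ∀ f, ‖Pr f‖ ≤ ‖f‖)
    (hPr' : ∀ s f, mulOp volume (cmul n (phase q₀ s)) (Pr f) =
      Pr (mulOp volume (cmul n (phase q₀ s)) f))
    (hyc : ContinuousOn y (Icc 0 t))
    (hy : ∀ s ∈ Ioo 0 t, HasDerivAt y (mulOp volume (cmul n (phase q₀ s)) (ε • Pr (N s))) s)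
    (hN : ∀ s ∈ Ioo 0 t, ‖N s - ∑ i ∈ G, S.conv (mulOp volume (cmul n (phase (q₁ i) (-s))) (g₁ i s))
      (mulOp volume (cmul n (phase (q₂ i) (-s))) (g₂ i s))
      (mulOp volume (cmul n (phase (q₃ i) (-s))) (g₃ i s))‖ ≤ R)
    (hg₁ : ∀ i ∈ G, ContinuousOn (g₁ i) (Icc 0 t)) (hg₂ : ∀ i ∈ G, ContinuousOn (g₂ i) (Icc 0 t))
    (hg₃ : ∀ i ∈ G, ContinuousOn (g₃ i) (Icc 0 t))
    (hd₁ : ∀ i ∈ G, ∀ s ∈ Ioo 0 t, ∃ g', HasDerivAt (g₁ i) g' s ∧ ‖g'‖ ≤ r')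
    (hd₂ : ∀ i ∈ G, ∀ s ∈ Ioo 0 t, ∃ g', HasDerivAt (g₂ i) g' s ∧ ‖g'‖ ≤ r')
    (hd₃ : ∀ i ∈ G, ∀ s ∈ Ioo 0 t, ∃ g', HasDerivAt (g₃ i) g' s ∧ ‖g'‖ ≤ r')
    (hr₁ : ∀ i ∈ G, ∀ s ∈ Ioo 0 t, ‖g₁ i s‖ ≤ r) (hr₂ : ∀ i ∈ G, ∀ s ∈ Ioo 0 t, ‖g₂ i s‖ ≤ r)
    (hr₃ : ∀ i ∈ G, ∀ s ∈ Ioo 0 t, ‖g₃ i s‖ ≤ r)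
    (hK₁ : ∀ i ∈ G, ‖g₁ i 0‖ ≤ K) (hK₂ : ∀ i ∈ G, ‖g₂ i 0‖ ≤ K) (hK₃ : ∀ i ∈ G, ‖g₃ i 0‖ ≤ K) :
    ‖y t‖ ≤ ‖y 0‖ + ε * (G.card * (2 / δ * S.convBound * K * K * K)) +
      ε * (R + G.card * (2 / δ * S.convBound * (3 * (r' * r * r)))) * t := by
  classical
  have hκ : 0 ≤ 2 / δ * S.convBound := mul_nonneg (by positivity) S.convBound_nonneg
  have hex : ∀ i, ∃ c : ℝ → LOne d n, i ∈ G → c t = 0 ∧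
      ‖c 0‖ ≤ 2 / δ * S.convBound * K * K * K ∧ ContinuousOn c (Icc 0 t) ∧
      ∀ s ∈ Ioo 0 t, ∃ e, HasDerivAt c (mulOp volume (cmul n (phase q₀ s))
        (S.conv (mulOp volume (cmul n (phase (q₁ i) (-s))) (g₁ i s))
          (mulOp volume (cmul n (phase (q₂ i) (-s))) (g₂ i s))
          (mulOp volume (cmul n (phase (q₃ i) (-s))) (g₃ i s))) + e) s ∧
        ‖e‖ ≤ 2 / δ * S.convBound * (3 * (r' * r * r)) := by
    intro i
    by_cases hi : i ∈ G
    swap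
    · exact ⟨0, fun h => absurd h hi⟩
    obtain ⟨c, c0, cb, cc, cd⟩ := S.exists_corrector h₀ (h₁ i hi) (h₂ i hi) (h₃ i hi) hδ
      (hlow i hi) (g₁ i) (g₂ i) (g₃ i) t
    refine ⟨c, fun _ => ⟨c0, (cb 0).trans ?_, cc _ (hg₁ i hi) (hg₂ i hi) (hg₃ i hi), fun s hs => ?_⟩⟩
    · have hK : 0 ≤ K := (norm_nonneg _).trans (hK₁ i hi)
      have a1 := hK₁ i hi
      have a2 := hK₂ i hi
      have a3 := hK₃ i hi
      gcongr
    · obtain ⟨d₁, e₁, b₁⟩ := hd₁ i hi s hs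
      obtain ⟨d₂, e₂, b₂⟩ := hd₂ i hi s hs
      obtain ⟨d₃, e₃, b₃⟩ := hd₃ i hi s hs
      obtain ⟨e, he, heb⟩ := cd s d₁ d₂ d₃ e₁ e₂ e₃
      refine ⟨e, he, heb.trans (mul_le_mul_of_nonneg_left ?_ hκ)⟩
      have hr : 0 ≤ r := (norm_nonneg _).trans (hr₁ i hi s hs)
      have hr' : 0 ≤ r' := (norm_nonneg _).trans b₁
      have a1 := hr₁ i hi s hs
      have a2 := hr₂ i hi s hs
      have a3 := hr₃ i hi s hs
      calc _ ≤ r' * r * r + r * r' * r + r * r * r' := by gcongr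
        _ = _ := by ring
  choose c hc using hex
  have hsum : ContinuousOn (fun s => ∑ i ∈ G, c i s) (Icc 0 t) :=
    continuousOn_finsetSum _ fun i hi => (hc i hi).2.2.1
  -- The correctors vanish at time `t`, so this function equals `y` there.
  have hY := norm_sub_le_of_hasDerivAt_Ioo (f := fun s => y s - ε • Pr (∑ i ∈ G, c i s))
    (C := ε * (R + G.card * (2 / δ * S.convBound * (3 * (r' * r * r))))) ht
    (hyc.sub ((Pr.continuous.comp_continuousOn hsum).const_smul ε)) fun s hs => ?_
  · have e1 : ∑ i ∈ G, c i t = 0 := Finset.sum_eq_zero fun i hi => (hc i hi).1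
    have e2 : ‖ε • Pr (∑ i ∈ G, c i 0)‖ ≤ ε * (G.card * (2 / δ * S.convBound * K * K * K)) := by
      rw [norm_smul, Real.norm_of_nonneg hε]
      refine mul_le_mul_of_nonneg_left ((hPr _).trans ((norm_sum_le _ _).trans ?_)) hε
      exact (Finset.sum_le_card_nsmul _ _ _ fun i hi => (hc i hi).2.1).trans_eq (nsmul_eq_mul _ _)
    simp only [e1, map_zero, smul_zero, sub_zero] at hY
    have e3 : ‖y t‖ ≤ ‖y t - (y 0 - ε • Pr (∑ i ∈ G, c i 0))‖ +
        (‖y 0‖ + ‖ε • Pr (∑ i ∈ G, c i 0)‖) := by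
      have := norm_add_le (y t - (y 0 - ε • Pr (∑ i ∈ G, c i 0))) (y 0 - ε • Pr (∑ i ∈ G, c i 0))
      rw [sub_add_cancel] at this
      exact this.trans (by gcongr; exact norm_sub_le _ _)
    linarith
  · have hex : ∀ i, ∃ e, i ∈ G → HasDerivAt (c i) (mulOp volume (cmul n (phase q₀ s))
        (S.conv (mulOp volume (cmul n (phase (q₁ i) (-s))) (g₁ i s))
          (mulOp volume (cmul n (phase (q₂ i) (-s))) (g₂ i s))
          (mulOp volume (cmul n (phase (q₃ i) (-s))) (g₃ i s))) + e) s ∧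
        ‖e‖ ≤ 2 / δ * S.convBound * (3 * (r' * r * r)) := by
      intro i
      by_cases hi : i ∈ G
      · obtain ⟨e, he⟩ := (hc i hi).2.2.2 s hs
        exact ⟨e, fun _ => he⟩
      · exact ⟨0, fun h => absurd h hi⟩
    choose e he using hex
    have hd := (hy s hs).sub ((Pr.hasFDerivAt.comp_hasDerivAt s
      (HasDerivAt.fun_sum fun i hi => (he i hi).1)).const_smul ε)
    refine ⟨_, hd, ?_⟩
    rw [Finset.sum_add_distrib, ← map_sum, map_smul, hPr', ← smul_sub, ← map_sub, sub_add_eq_sub_sub,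
      ← map_sub, norm_smul, Real.norm_of_nonneg hε]
    refine mul_le_mul_of_nonneg_left ((hPr _).trans ((norm_sub_le _ _).trans (add_le_add ?_ ?_))) hε
    · exact (norm_phase_mulOp h₀ s _).trans_le (hN s hs)
    · exact (norm_sum_le _ _).trans ((Finset.sum_le_card_nsmul _ _ _ fun i hi =>
        (he i hi).2).trans_eq (nsmul_eq_mul _ _))

/-! ### Modes of negative index -/

namespace Data.Eigendecomposition

variable [NeZero n] {S : Data d n}

/-- The frequencies of the modes of `u_σ`, `σ = ±1`. -/
def signedFreq (D : S.Eigendecomposition) (σ : ℤ) (ℓ : Fin n) (ε ρ : ℝ) (k : RSpace d) : ℝ :=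
  if 0 < σ then D.freq 1 ℓ ε ρ k else -D.freq 1 ℓ ε ρ (-k)

/-- The modes of `u_σ`, `σ = ±1`, in the rotating frame. -/
def rotMode (D : S.Eigendecomposition) (U : ℤ → ℝ → LOne d n) (σ : ℤ) (ℓ : Fin n) (ε ρ s : ℝ) :
    LOne d n :=
  if 0 < σ then D.mode U 1 ℓ ε ρ s else conjRefl (D.mode U 1 ℓ ε ρ s)

theorem isBddMul_signedFreq (D : S.Eigendecomposition) {C : ℝ} (hL : D.LipschitzBound C) (σ : ℤ)
    (ℓ : Fin n) {ε ρ : ℝ} (hε : 0 < ε) (hρ : 0 ≤ ρ) :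
    IsBddMul volume (D.signedFreq σ ℓ ε ρ) (|C| * d * (ε * ρ) / ε + |D.lam 1 ℓ 0 / ε|) := by
  have h := D.isBddMul_freq hL 1 ℓ hε hρ
  unfold signedFreq
  split_ifs
  · exact h
  · have h' := h.comp_qmp measurePreserving_neg'.quasiMeasurePreserving
    exact ⟨h'.meas.neg, h.nonneg, fun k => (norm_neg _).trans_le (h.bound (-k))⟩

theorem abs_signedFreq_sub_le (D : S.Eigendecomposition) {C : ℝ} (hL : D.LipschitzBound C) {σ : ℤ}
    (hσ : σ = 1 ∨ σ = -1) (ℓ : Fin n) {ε ρ : ℝ} (hε : 0 < ε) (hρ : 0 ≤ ρ) (k : RSpace d) :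
    |D.signedFreq σ ℓ ε ρ k - σ * (D.lam 1 ℓ 0 / ε)| ≤ |C| * d * (ε * ρ) / ε := by
  rcases hσ with rfl | rfl
  · simpa [signedFreq] using D.abs_freq_sub_le hL 1 ℓ hε hρ k
  · have := D.abs_freq_sub_le hL 1 ℓ hε hρ (-k)
    rw [← abs_neg] at this
    refine le_trans (le_of_eq ?_) this
    simp only [signedFreq]
    norm_num
    congr 1
    ring

theorem norm_rotMode (D : S.Eigendecomposition) (U : ℤ → ℝ → LOne d n) (σ : ℤ) (ℓ : Fin n)
    (ε ρ s : ℝ) : ‖D.rotMode U σ ℓ ε ρ s‖ = ‖D.mode U 1 ℓ ε ρ s‖ := by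
  unfold rotMode
  split_ifs
  · rfl
  · exact norm_conjRefl _

theorem continuousOn_rotMode (D : S.Eigendecomposition) {C : ℝ} (hL : D.LipschitzBound C)
    {U : ℤ → ℝ → LOne d n} (σ : ℤ) (ℓ : Fin n) {ε ρ : ℝ} (hε : 0 < ε) (hρ : 0 ≤ ρ) {A : Set ℝ}
    (hU : ContinuousOn (U 1) A) : ContinuousOn (D.rotMode U σ ℓ ε ρ) A := by
  have h := D.continuousOn_mode hL ℓ hε hρ hU
  unfold rotMode
  split_ifs
  · exact h
  · exact conjRefl.continuous.comp_continuousOn h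

theorem hasDerivAt_rotMode (D : S.Eigendecomposition) {C : ℝ} (hL : D.LipschitzBound C)
    {ε τ : ℝ} {p : LOne d n} {U : ℤ → ℝ → LOne d n} (hU : S.IsClassicalSolution 3 ε τ p U)
    (σ : ℤ) (ℓ : Fin n) {ρ : ℝ} (hε : 0 < ε) (hρ : 0 ≤ ρ) {s : ℝ} (hs : s ∈ Ioo 0 τ) :
    ∃ g', HasDerivAt (D.rotMode U σ ℓ ε ρ) g' s ∧ ‖g'‖ ≤ ε * ‖S.nonlin U 1 s‖ := by
  have h := D.hasDerivAt_mode hL hU (j := 1) (by decide) one_pos ℓ hε hρ hs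
  have hb : ‖mulOp volume (cmul n (phase (D.freq 1 ℓ ε ρ) s))
      (ε • D.projOp 1 ℓ ε (cutOp ρ (S.nonlin U 1 s)))‖ ≤ ε * ‖S.nonlin U 1 s‖ := by
    rw [norm_phase_mulOp (D.isBddMul_freq hL 1 ℓ hε hρ), norm_smul, Real.norm_of_nonneg hε.le]
    exact mul_le_mul_of_nonneg_left (D.norm_projOp_cutOp_le 1 ℓ hε.ne' ρ _) hε.le
  unfold rotMode
  split_ifs
  · exact ⟨_, h, hb⟩
  · exact ⟨_, conjRefl.hasFDerivAt.comp_hasDerivAt s h, (norm_conjRefl _).trans_le hb⟩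

/-- The phases are undone and the projections sum to the identity. For `σ = -1`, conjugation
reflects `k` and changes the sign of the frequency, as built into `signedFreq`. -/
theorem sum_rotMode (D : S.Eigendecomposition) {C : ℝ} (hL : D.LipschitzBound C)
    (U : ℤ → ℝ → LOne d n) {σ : ℤ} (hσ : σ = 1 ∨ σ = -1) {ε ρ : ℝ} (hε : 0 < ε) (hρ : 0 ≤ ρ)
    (s : ℝ) :
    ∑ ℓ, mulOp volume (cmul n (phase (D.signedFreq σ ℓ ε ρ) (-s))) (D.rotMode U σ ℓ ε ρ s) =
      cutOp ρ (signedMode U σ s) := by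
  rcases hσ with rfl | rfl
  · have : ∀ ℓ, mulOp volume (cmul n (phase (D.signedFreq 1 ℓ ε ρ) (-s)))
        (D.rotMode U 1 ℓ ε ρ s) = D.projOp 1 ℓ ε (cutOp ρ (U 1 s)) := fun ℓ => by
      rw [← D.phase_neg_mode hL U 1 ℓ hε hρ s]
      rfl
    rw [Finset.sum_congr rfl fun ℓ _ => this ℓ, D.sum_projOp 1 hε.ne']
    rfl
  · have : ∀ ℓ, mulOp volume (cmul n (phase (D.signedFreq (-1) ℓ ε ρ) (-s)))
        (D.rotMode U (-1) ℓ ε ρ s) = conjRefl (D.projOp 1 ℓ ε (cutOp ρ (U 1 s))) := fun ℓ => by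
      rw [← D.phase_neg_mode hL U 1 ℓ hε hρ s,
        conjRefl_cmul (isBddMul_phase (D.isBddMul_freq hL 1 ℓ hε hρ) (-s))
          (isBddMul_phase (D.isBddMul_signedFreq hL (-1) ℓ hε hρ) (-s))]
      · rfl
      · intro k
        simp only [phase, signedFreq, ← Complex.exp_conj]
        congr 1
        simp
    rw [Finset.sum_congr rfl fun ℓ _ => this ℓ, ← map_sum, D.sum_projOp 1 hε.ne', conjRefl_cutOp]
    rfl

end Data.Eigendecomposition

/-! ### Estimates of the nonlinearity -/

theorem mem_modes_three {j : ℤ} (h : j ∈ modes 3) : j = 1 ∨ j = -1 ∨ j = 3 ∨ j = -3 := by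
  obtain ⟨h1, h2⟩ := Finset.mem_filter.1 h
  obtain ⟨h3, h4⟩ := Finset.mem_Icc.1 h1
  obtain ⟨i, rfl⟩ := h2
  push_cast at h3 h4
  omega

theorem mem_modes_of_mem_triples {m : ℕ} {j : ℤ} {J : ℤ × ℤ × ℤ} (h : J ∈ triples m j) :
    J.1 ∈ modes m ∧ J.2.1 ∈ modes m ∧ J.2.2 ∈ modes m := by
  obtain ⟨h1, -⟩ := Finset.mem_filter.1 h
  obtain ⟨h2, h3⟩ := Finset.mem_product.1 h1
  exact ⟨h2, Finset.mem_product.1 h3⟩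

theorem signedMode_neg_one (U : ℤ → ℝ → LOne d n) (s : ℝ) :
    signedMode U (-1) s = conjRefl (U 1 s) := rfl

theorem signedMode_neg_three (U : ℤ → ℝ → LOne d n) (s : ℝ) :
    signedMode U (-3) s = conjRefl (U 3 s) := rfl

namespace Data

theorem norm_conv_le_of_le (S : Data d n) {f₁ f₂ f₃ : LOne d n} {a₁ a₂ a₃ : ℝ} (h₁ : ‖f₁‖ ≤ a₁)
    (h₂ : ‖f₂‖ ≤ a₂) (h₃ : ‖f₃‖ ≤ a₃) :
    ‖S.conv f₁ f₂ f₃‖ ≤ S.convBound * (a₁ * a₂ * a₃) := by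
  have := S.convBound_nonneg
  have b₁ := (norm_nonneg _).trans h₁
  have b₂ := (norm_nonneg _).trans h₂
  calc _ ≤ _ := S.norm_conv_le f₁ f₂ f₃
    _ = S.convBound * (‖f₁‖ * ‖f₂‖ * ‖f₃‖) := by ring
    _ ≤ _ := by gcongr

end Data

namespace Data.Eigendecomposition

variable [NeZero n] {S : Data d n}

/-- The bounds on `u_1` and `u_3` that are propagated in time. -/
structure Controlled (D : S.Eigendecomposition) (U : ℤ → ℝ → LOne d n) (ε R r s : ℝ) : Prop where
  weight_one : ‖weightOp R (U 1 s)‖ ≤ r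
  weight_three : ‖weightOp R (U 3 s)‖ ≤ r
  perp : ‖U 1 s - D.projOp 1 0 ε (U 1 s)‖ ≤ ε * r
  three : ‖U 3 s‖ ≤ ε ^ 2 * r

namespace Controlled

variable {D : S.Eigendecomposition} {U : ℤ → ℝ → LOne d n} {ε R r s : ℝ}

theorem nonneg (h : D.Controlled U ε R r s) : 0 ≤ r := (norm_nonneg _).trans h.weight_one

theorem norm_weightOp_signedMode_le (h : D.Controlled U ε R r s) (hR : 1 ≤ R) {j : ℤ}
    (hj : j ∈ modes 3) : ‖weightOp R (signedMode U j s)‖ ≤ r := by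
  rcases mem_modes_three hj with rfl | rfl | rfl | rfl
  · exact h.weight_one
  · rw [signedMode_neg_one, norm_weightOp_conjRefl hR]
    exact h.weight_one
  · exact h.weight_three
  · rw [signedMode_neg_three, norm_weightOp_conjRefl hR]
    exact h.weight_three

theorem norm_signedMode_le (h : D.Controlled U ε R r s) (hR : 1 ≤ R) {j : ℤ}
    (hj : j ∈ modes 3) : ‖signedMode U j s‖ ≤ r :=
  (norm_le_norm_weightOp hR _).trans (h.norm_weightOp_signedMode_le hR hj)

theorem norm_signedMode_le_of_ne (h : D.Controlled U ε R r s) {j : ℤ} (hj : j ∈ modes 3)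
    (hj1 : ¬(j = 1 ∨ j = -1)) : ‖signedMode U j s‖ ≤ ε ^ 2 * r := by
  rcases mem_modes_three hj with rfl | rfl | rfl | rfl
  · exact absurd (Or.inl rfl) hj1
  · exact absurd (Or.inr rfl) hj1
  · exact h.three
  · rw [signedMode_neg_three, norm_conjRefl]
    exact h.three

theorem norm_weightOp_nonlin_le (h : D.Controlled U ε R r s) (hR : 1 ≤ R) (j : ℤ) :
    ‖weightOp R (S.nonlin U j s)‖ ≤ (triples 3 j).card * (3 * S.convBound * r * r * r) := by
  have hr := h.nonneg
  have hc := S.convBound_nonneg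
  rw [nonlin, map_sum]
  refine (norm_sum_le _ _).trans ((Finset.sum_le_card_nsmul _ _ _ fun J hJ => ?_).trans_eq
    (nsmul_eq_mul _ _))
  obtain ⟨h1, h2, h3⟩ := mem_modes_of_mem_triples hJ
  have b1 := h.norm_weightOp_signedMode_le hR h1
  have b2 := h.norm_weightOp_signedMode_le hR h2
  have b3 := h.norm_weightOp_signedMode_le hR h3
  refine (S.norm_weight_conv_le (isBddMul_weight hR) (one_le_weight hR) (by norm_num)
    (weight_add_le hR) _ _ _).trans ?_
  change 3 * S.convBound * ‖weightOp R _‖ * ‖weightOp R _‖ * ‖weightOp R _‖ ≤ _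
  gcongr

theorem norm_nonlin_le (h : D.Controlled U ε R r s) (hR : 1 ≤ R) (j : ℤ) :
    ‖S.nonlin U j s‖ ≤ (triples 3 j).card * (3 * S.convBound * r * r * r) :=
  (norm_le_norm_weightOp hR _).trans (h.norm_weightOp_nonlin_le hR j)

end Controlled

theorem projOp_projOp_zero (D : S.Eigendecomposition) (j : ℤ) {ℓ : Fin n} (hℓ : ℓ ≠ 0) {ε : ℝ}
    (hε : ε ≠ 0) (f : LOne d n) : D.projOp j ℓ ε (D.projOp j 0 ε f) = 0 := by
  apply Lp.ext
  filter_upwards [coeFn_mulOp (D.isBddMul_rankOneL j ℓ hε) (D.projOp j 0 ε f),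
    coeFn_mulOp (D.isBddMul_rankOneL j 0 hε) f, Lp.coeFn_zero (CSpace n) 1 volume]
    with k h1 h2 h3
  have h4 : (inner ℂ (D.psi j ℓ (ε • k)) (D.psi j 0 (ε • k)) : ℂ) = 0 :=
    (D.orthonormal _).2 hℓ
  rw [h3, projOp, h1, projOp, h2, rankOneL_apply, rankOneL_apply, inner_smul_right, h4, mul_zero,
    zero_smul]
  rfl

theorem cutOp_projOp (D : S.Eigendecomposition) (j : ℤ) (ℓ : Fin n) {ε : ℝ} (hε : ε ≠ 0) (ρ : ℝ)
    (f : LOne d n) : D.projOp j ℓ ε (cutOp ρ f) = cutOp ρ (D.projOp j ℓ ε f) :=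
  D.projOp_cmul j ℓ hε (isBddMul_cut ρ) f

/-- The `ℓ`-th projection annihilates the leading mode. -/
theorem norm_projOp_le_perp (D : S.Eigendecomposition) (j : ℤ) {ℓ : Fin n} (hℓ : ℓ ≠ 0) {ε : ℝ}
    (hε : ε ≠ 0) (f : LOne d n) : ‖D.projOp j ℓ ε f‖ ≤ ‖f - D.projOp j 0 ε f‖ := by
  have h := D.norm_projOp_le j ℓ hε (f - D.projOp j 0 ε f)
  rwa [map_sub, D.projOp_projOp_zero j hℓ hε, sub_zero] at h

/-- The size of the `ℓ`-th mode of `u_1`, relative to that of the first one. -/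
def modeSize (ε : ℝ) (ℓ : Fin n) : ℝ := if ℓ = 0 then 1 else ε

theorem Controlled.norm_rotMode_le {D : S.Eigendecomposition} {U : ℤ → ℝ → LOne d n}
    {ε R r s C : ℝ} (h : D.Controlled U ε R r s) (hR : 1 ≤ R) (hL : D.LipschitzBound C) (σ : ℤ)
    (ℓ : Fin n) {ρ : ℝ} (hε : 0 < ε) (hρ : 0 ≤ ρ) :
    ‖D.rotMode U σ ℓ ε ρ s‖ ≤ modeSize ε ℓ * r := by
  rw [norm_rotMode, D.norm_mode hL U 1 ℓ hε hρ]
  unfold modeSize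
  split_ifs with hℓ
  · rw [one_mul]
    exact (D.norm_projOp_cutOp_le 1 ℓ hε.ne' ρ _).trans
      ((norm_le_norm_weightOp hR _).trans h.weight_one)
  · rw [D.cutOp_projOp 1 ℓ hε.ne']
    exact (norm_cutOp_le _ _).trans ((D.norm_projOp_le_perp 1 hℓ hε.ne' _).trans h.perp)

/-- The number of nonzero indices. -/
def offCount (L : Fin n × Fin n × Fin n) : ℕ :=
  (if L.1 = 0 then 0 else 1) + (if L.2.1 = 0 then 0 else 1) + (if L.2.2 = 0 then 0 else 1)

theorem modeSize_mul (ε : ℝ) (L : Fin n × Fin n × Fin n) :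
    modeSize ε L.1 * modeSize ε L.2.1 * modeSize ε L.2.2 = ε ^ offCount L := by
  unfold modeSize offCount
  split_ifs <;> ring

end Data.Eigendecomposition

/-- The triples in `{±1}³` with sum `j`. -/
def unitTriples (j : ℤ) : Finset (ℤ × ℤ × ℤ) :=
  (triples 3 j).filter fun J =>
    (J.1 = 1 ∨ J.1 = -1) ∧ (J.2.1 = 1 ∨ J.2.1 = -1) ∧ (J.2.2 = 1 ∨ J.2.2 = -1)

/-- The interactions of modes of `u_{±1}` with less than `p` modes other than the first one. -/
def interactions (n : ℕ) [NeZero n] (j : ℤ) (p : ℕ) :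
    Finset ((ℤ × ℤ × ℤ) × Fin n × Fin n × Fin n) :=
  unitTriples j ×ˢ Finset.univ.filter fun L => Data.Eigendecomposition.offCount L < p

namespace Data.Eigendecomposition

variable [NeZero n] {S : Data d n}

/-- The first error comes from cutting off the three factors one by one. The second comes from the
omitted interactions, at most `n³` in number, each with at least `p` factors of size `ε`. -/
theorem Controlled.norm_conv_unit_sub_le {D : S.Eigendecomposition} {U : ℤ → ℝ → LOne d n}
    {ε ρ r s C : ℝ} (h : D.Controlled U ε (1 + ρ ^ 2) r s)
    (hL : D.LipschitzBound C) (hε : ε ∈ Ioc (0 : ℝ) 1) (hρ : 0 < ρ) {p : ℕ} {j : ℤ}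
    {J : ℤ × ℤ × ℤ} (hJ : J ∈ unitTriples j) :
    ‖S.conv (signedMode U J.1 s) (signedMode U J.2.1 s) (signedMode U J.2.2 s) -
      ∑ L with offCount L < p,
        S.conv (mulOp volume (cmul n (phase (D.signedFreq J.1 L.1 ε ρ) (-s)))
            (D.rotMode U J.1 L.1 ε ρ s))
          (mulOp volume (cmul n (phase (D.signedFreq J.2.1 L.2.1 ε ρ) (-s)))
            (D.rotMode U J.2.1 L.2.1 ε ρ s))
          (mulOp volume (cmul n (phase (D.signedFreq J.2.2 L.2.2 ε ρ) (-s)))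
            (D.rotMode U J.2.2 L.2.2 ε ρ s))‖ ≤
      S.convBound * (3 * (ρ ^ 2)⁻¹ * (r * r * r)) +
        n ^ 3 * (S.convBound * (ε ^ p * (r * r * r))) := by
  have hR : 1 ≤ 1 + ρ ^ 2 := le_add_of_nonneg_right (sq_nonneg _)
  have hr := h.nonneg
  have hc := S.convBound_nonneg
  obtain ⟨hJ0, s1, s2, s3⟩ := Finset.mem_filter.1 hJ
  obtain ⟨h1, h2, h3⟩ := mem_modes_of_mem_triples hJ0
  set f : ℤ → Fin n → LOne d n := fun σ ℓ =>
    mulOp volume (cmul n (phase (D.signedFreq σ ℓ ε ρ) (-s))) (D.rotMode U σ ℓ ε ρ s) with hf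
  have hfn : ∀ σ ℓ, ‖f σ ℓ‖ ≤ modeSize ε ℓ * r := fun σ ℓ =>
    (norm_phase_mulOp (D.isBddMul_signedFreq hL σ ℓ hε.1 hρ.le) _ _).trans_le
      (h.norm_rotMode_le hR hL σ ℓ hε.1 hρ.le)
  have hsum : ∀ {σ : ℤ}, σ = 1 ∨ σ = -1 → ∑ ℓ, f σ ℓ = cutOp ρ (signedMode U σ s) := fun hσ =>
    D.sum_rotMode hL U hσ hε.1 hρ.le s
  have e1 : S.conv (cutOp ρ (signedMode U J.1 s)) (cutOp ρ (signedMode U J.2.1 s))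
      (cutOp ρ (signedMode U J.2.2 s)) =
      ∑ L : Fin n × Fin n × Fin n, S.conv (f J.1 L.1) (f J.2.1 L.2.1) (f J.2.2 L.2.2) := by
    rw [← hsum s1, ← hsum s2, ← hsum s3, conv_sum, Fintype.sum_prod_type]
    simp_rw [Fintype.sum_prod_type]
    exact (Finset.sum_comm.trans
      ((Finset.sum_congr rfl fun _ _ => Finset.sum_comm).trans Finset.sum_comm)).symm
  have e2 : S.conv (signedMode U J.1 s) (signedMode U J.2.1 s) (signedMode U J.2.2 s) -
      ∑ L with offCount L < p, S.conv (f J.1 L.1) (f J.2.1 L.2.1) (f J.2.2 L.2.2) =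
      (S.conv (signedMode U J.1 s) (signedMode U J.2.1 s) (signedMode U J.2.2 s) -
        S.conv (cutOp ρ (signedMode U J.1 s)) (cutOp ρ (signedMode U J.2.1 s))
          (cutOp ρ (signedMode U J.2.2 s))) +
      ∑ L with ¬offCount L < p, S.conv (f J.1 L.1) (f J.2.1 L.2.1) (f J.2.2 L.2.2) := by
    rw [e1, ← Finset.sum_filter_add_sum_filter_not Finset.univ fun L => offCount L < p]
    abel
  change ‖_ - ∑ L with offCount L < p, S.conv (f J.1 L.1) (f J.2.1 L.2.1) (f J.2.2 L.2.2)‖ ≤ _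
  rw [e2]
  refine (norm_add_le _ _).trans (add_le_add ?_ ?_)
  · have ht : ∀ {σ : ℤ}, σ ∈ modes 3 →
        ‖signedMode U σ s - cutOp ρ (signedMode U σ s)‖ ≤ (ρ ^ 2)⁻¹ * r := fun hσ =>
      (norm_sub_cutOp_le hρ _).trans
        (mul_le_mul_of_nonneg_left (h.norm_weightOp_signedMode_le hR hσ) (by positivity))
    have hb : ∀ {σ : ℤ}, σ ∈ modes 3 → ‖signedMode U σ s‖ ≤ r := fun hσ =>
      h.norm_signedMode_le hR hσ
    have hb' : ∀ {σ : ℤ}, σ ∈ modes 3 → ‖cutOp ρ (signedMode U σ s)‖ ≤ r := fun hσ =>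
      (norm_cutOp_le _ _).trans (hb hσ)
    refine (S.norm_conv_sub_conv_le _ _ _ _ _ _).trans (mul_le_mul_of_nonneg_left ?_ hc)
    calc _ ≤ (ρ ^ 2)⁻¹ * r * r * r + r * ((ρ ^ 2)⁻¹ * r) * r + r * r * ((ρ ^ 2)⁻¹ * r) := by
          gcongr
          exacts [ht h1, hb h2, hb h3, hb' h1, ht h2, hb h3, hb' h1, hb' h2, ht h3]
      _ = _ := by ring
  · have hcard : ((Finset.univ.filter fun L : Fin n × Fin n × Fin n => ¬offCount L < p).card : ℝ) ≤
        (n : ℝ) ^ 3 := by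
      have := Finset.card_filter_le (Finset.univ : Finset (Fin n × Fin n × Fin n))
        fun L => ¬offCount L < p
      rw [Finset.card_univ, Fintype.card_prod, Fintype.card_prod, Fintype.card_fin] at this
      calc _ ≤ ((n * (n * n) : ℕ) : ℝ) := by exact_mod_cast this
        _ = _ := by push_cast; ring
    refine (norm_sum_le _ _).trans ((Finset.sum_le_card_nsmul _ _
      (S.convBound * (ε ^ p * (r * r * r))) fun L hL' => ?_).trans ?_)
    · refine (S.norm_conv_le_of_le (hfn _ _) (hfn _ _) (hfn _ _)).trans
        (mul_le_mul_of_nonneg_left ?_ hc)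
      have hp : p ≤ offCount L := not_lt.1 (Finset.mem_filter.1 hL').2
      calc _ = (modeSize ε L.1 * modeSize ε L.2.1 * modeSize ε L.2.2) * (r * r * r) := by ring
        _ = ε ^ offCount L * (r * r * r) := by rw [modeSize_mul]
        _ ≤ _ := mul_le_mul_of_nonneg_right (pow_le_pow_of_le_one hε.1.le hε.2 hp) (by positivity)
    · rw [nsmul_eq_mul]
      exact mul_le_mul_of_nonneg_right hcard
        (mul_nonneg hc (mul_nonneg (pow_nonneg hε.1.le _) (by positivity)))

theorem Controlled.norm_conv_not_unit_le {D : S.Eigendecomposition} {U : ℤ → ℝ → LOne d n}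
    {ε R r s : ℝ} (h : D.Controlled U ε R r s) (hR : 1 ≤ R) {j : ℤ}
    {J : ℤ × ℤ × ℤ} (hJ : J ∈ triples 3 j) (hJ' : J ∉ unitTriples j) :
    ‖S.conv (signedMode U J.1 s) (signedMode U J.2.1 s) (signedMode U J.2.2 s)‖ ≤
      S.convBound * (ε ^ 2 * (r * r * r)) := by
  obtain ⟨h1, h2, h3⟩ := mem_modes_of_mem_triples hJ
  have b1 := h.norm_signedMode_le hR h1
  have b2 := h.norm_signedMode_le hR h2
  have b3 := h.norm_signedMode_le hR h3
  by_cases c1 : J.1 = 1 ∨ J.1 = -1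
  · by_cases c2 : J.2.1 = 1 ∨ J.2.1 = -1
    · have c3 : ¬(J.2.2 = 1 ∨ J.2.2 = -1) := fun c3 =>
        hJ' (Finset.mem_filter.2 ⟨hJ, c1, c2, c3⟩)
      exact (S.norm_conv_le_of_le b1 b2 (h.norm_signedMode_le_of_ne h3 c3)).trans_eq (by ring)
    · exact (S.norm_conv_le_of_le b1 (h.norm_signedMode_le_of_ne h2 c2) b3).trans_eq (by ring)
  · exact (S.norm_conv_le_of_le (h.norm_signedMode_le_of_ne h1 c1) b2 b3).trans_eq (by ring)

/-- For `p ≤ 2` both the tails and the terms containing `u_{±3}` are `O(ε²)`, hence `O(ε^p)`. The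
summand `1` in the constant accounts for the triples with an entry `±3`. -/
theorem Controlled.norm_nonlin_sub_le {D : S.Eigendecomposition} {U : ℤ → ℝ → LOne d n}
    {ε ρ₀ r s C : ℝ} (h : D.Controlled U ε (1 + (ρ₀ / ε) ^ 2) r s)
    (hL : D.LipschitzBound C) (hε : ε ∈ Ioc (0 : ℝ) 1) (hρ : 0 < ρ₀) {p : ℕ} (hp : p ≤ 2) (j : ℤ) :
    ‖S.nonlin U j s - ∑ i ∈ interactions n j p,
        S.conv (mulOp volume (cmul n (phase (D.signedFreq i.1.1 i.2.1 ε (ρ₀ / ε)) (-s)))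
            (D.rotMode U i.1.1 i.2.1 ε (ρ₀ / ε) s))
          (mulOp volume (cmul n (phase (D.signedFreq i.1.2.1 i.2.2.1 ε (ρ₀ / ε)) (-s)))
            (D.rotMode U i.1.2.1 i.2.2.1 ε (ρ₀ / ε) s))
          (mulOp volume (cmul n (phase (D.signedFreq i.1.2.2 i.2.2.2 ε (ρ₀ / ε)) (-s)))
            (D.rotMode U i.1.2.2 i.2.2.2 ε (ρ₀ / ε) s))‖ ≤
      ε ^ p * ((triples 3 j).card * (S.convBound * (3 * (ρ₀ ^ 2)⁻¹ + n ^ 3 + 1)) * r ^ 3) := by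
  have hR : 1 ≤ 1 + (ρ₀ / ε) ^ 2 := le_add_of_nonneg_right (sq_nonneg _)
  have hr := h.nonneg
  have hc := S.convBound_nonneg
  have hε2 : ε ^ 2 ≤ ε ^ p := pow_le_pow_of_le_one hε.1.le hε.2 hp
  have hεp : 0 ≤ ε ^ p := pow_nonneg hε.1.le _
  have hε0 := hε.1
  rw [interactions, Finset.sum_product, unitTriples, Finset.sum_filter, nonlin,
    ← Finset.sum_sub_distrib]
  refine (norm_sum_le _ _).trans ((Finset.sum_le_card_nsmul _ _
    (ε ^ p * ((S.convBound * (3 * (ρ₀ ^ 2)⁻¹ + n ^ 3 + 1)) * r ^ 3)) fun J hJ => ?_).trans_eq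
    (by rw [nsmul_eq_mul]; ring))
  by_cases hJ' : J ∈ unitTriples j
  · rw [if_pos (Finset.mem_filter.1 hJ').2]
    refine (h.norm_conv_unit_sub_le hL hε (div_pos hρ hε.1) hJ').trans ?_
    have e : ((ρ₀ / ε) ^ 2)⁻¹ = ε ^ 2 * (ρ₀ ^ 2)⁻¹ := by
      rw [div_pow, inv_div, div_eq_mul_inv]
    rw [e]
    calc S.convBound * (3 * (ε ^ 2 * (ρ₀ ^ 2)⁻¹) * (r * r * r)) +
          n ^ 3 * (S.convBound * (ε ^ p * (r * r * r)))
        ≤ S.convBound * (3 * (ε ^ p * (ρ₀ ^ 2)⁻¹) * (r * r * r)) +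
          n ^ 3 * (S.convBound * (ε ^ p * (r * r * r))) + ε ^ p * (S.convBound * r ^ 3) := by
          refine le_add_of_le_of_nonneg ?_ (by positivity)
          gcongr
      _ = _ := by ring
  · rw [if_neg fun hc => hJ' (Finset.mem_filter.2 ⟨hJ, hc⟩), sub_zero]
    refine (h.norm_conv_not_unit_le hR hJ hJ').trans ?_
    calc S.convBound * (ε ^ 2 * (r * r * r)) ≤ S.convBound * (ε ^ p * (r * r * r)) := by gcongr
      _ ≤ S.convBound * (ε ^ p * (r * r * r)) +
          ε ^ p * ((S.convBound * (3 * (ρ₀ ^ 2)⁻¹ + n ^ 3)) * r ^ 3) :=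
        le_add_of_nonneg_right (by positivity)
      _ = _ := by ring

end Data.Eigendecomposition

namespace Data.Eigendecomposition

variable [NeZero n] {S : Data d n}

/-! ### Resonances -/

/-- This translates non-resonance, a condition on spectra, into one on the `λ_{jℓ}(0)`. -/
theorem lam_mem_spectrum (D : S.Eigendecomposition) (j : ℤ) (ℓ : Fin n) :
    (D.lam j ℓ 0 : ℂ) ∈ spectrum ℂ (S.L (j * S.ω) ((j : ℝ) • S.κ)) := by
  rw [← Matrix.spectrum_toLpLin 2]
  have hne : D.vec ℓ ((j : ℝ) • S.κ) ≠ 0 := norm_ne_zero_iff.1 (by rw [norm_vec]; exact one_ne_zero)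
  have hv : Matrix.toEuclideanLin (S.L (j * S.ω) ((j : ℝ) • S.κ)) (D.vec ℓ ((j : ℝ) • S.κ)) =
      (D.lam j ℓ 0 : ℂ) • D.vec ℓ ((j : ℝ) • S.κ) := by
    rw [toEuclideanLin_L_eq, D.eigen, ← sub_smul, lam, add_zero]
    congr 1
    push_cast
    ring
  exact (Module.End.hasEigenvalue_of_hasEigenvector
    ⟨Module.End.mem_eigenspace_iff.2 hv, hne⟩).mem_spectrum

theorem lam_one_zero (D : S.Eigendecomposition) : D.lam 1 0 0 = 0 := by
  simp [lam, D.ev_kappa]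

theorem lam_one_ne_zero (D : S.Eigendecomposition) (hgap : D.Gap) {ℓ : Fin n} (hℓ : ℓ ≠ 0) :
    D.lam 1 ℓ 0 ≠ 0 := by
  obtain ⟨c, hc, hcb⟩ := hgap
  intro h
  have h1 := hcb ℓ hℓ S.κ
  have h2 : D.lam 1 ℓ 0 = -(S.ω - D.ev ℓ S.κ) := by simp [lam, neg_add_eq_sub]
  rw [h, zero_eq_neg] at h2
  rw [h2, abs_zero] at h1
  linarith

theorem lam_three_ne_zero (D : S.Eigendecomposition) (hres : S.NonResonant) (m : Fin n) :
    D.lam 3 m 0 ≠ 0 := by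
  intro h
  have h1 := D.lam_mem_spectrum 3 m
  rw [h, ofReal_zero] at h1
  exact (spectrum.zero_mem_iff ℂ).1 h1 (by simpa using hres.1)

theorem lam_three_ne_lam_one (D : S.Eigendecomposition) (hres : S.NonResonant) (m ℓ : Fin n) :
    D.lam 3 m 0 ≠ D.lam 1 ℓ 0 := by
  intro h
  have h1 := D.lam_mem_spectrum 3 m
  have h2 := D.lam_mem_spectrum 1 ℓ
  rw [h] at h1
  exact Set.disjoint_left.1 hres.2 (by simpa using h1) (by simpa using h2)

/-- The frequency mismatch of the `m`-th mode of `u_j` with an interaction. -/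
def detuning (D : S.Eigendecomposition) (j : ℤ) (m : Fin n)
    (i : (ℤ × ℤ × ℤ) × Fin n × Fin n × Fin n) : ℝ :=
  D.lam j m 0 - i.1.1 * D.lam 1 i.2.1 0 - i.1.2.1 * D.lam 1 i.2.2.1 0 -
    i.1.2.2 * D.lam 1 i.2.2.2 0

/-- With `p = 1` all three factors are leading modes, for which `λ_{11}(0) = 0`; only `λ_{1m}(0)`
survives. -/
theorem detuning_one_ne_zero (D : S.Eigendecomposition) (hgap : D.Gap) {m : Fin n} (hm : m ≠ 0)
    {i : (ℤ × ℤ × ℤ) × Fin n × Fin n × Fin n} (hi : i ∈ interactions n 1 1) :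
    D.detuning 1 m i ≠ 0 := by
  have h := (Finset.mem_filter.1 (Finset.mem_product.1 hi).2).2
  have hs : i.2.1 = 0 ∧ i.2.2.1 = 0 ∧ i.2.2.2 = 0 := by
    unfold offCount at h
    split_ifs at h <;> simp_all
  rw [detuning, hs.1, hs.2.1, hs.2.2, lam_one_zero]
  simpa using D.lam_one_ne_zero hgap hm

/-- Three signs with sum `3` are all `+1`. With at most one non-leading factor the detuning is
`λ_{3m}(0)` or `λ_{3m}(0) - λ_{1ℓ}(0)`; the two halves of the non-resonance condition exclude zero.
-/
theorem detuning_three_ne_zero (D : S.Eigendecomposition) (hres : S.NonResonant) (m : Fin n)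
    {i : (ℤ × ℤ × ℤ) × Fin n × Fin n × Fin n} (hi : i ∈ interactions n 3 2) :
    D.detuning 3 m i ≠ 0 := by
  obtain ⟨h1, h2⟩ := Finset.mem_product.1 hi
  have h := (Finset.mem_filter.1 h2).2
  obtain ⟨h3, h4⟩ := Finset.mem_filter.1 h1
  have h5 := (Finset.mem_filter.1 h3).2
  have e1 : i.1.1 = 1 := by omega
  have e2 : i.1.2.1 = 1 := by omega
  have e3 : i.1.2.2 = 1 := by omega
  have hm0 := D.lam_three_ne_zero hres m
  have hml := fun ℓ => sub_ne_zero.2 (D.lam_three_ne_lam_one hres m ℓ)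
  rw [detuning, e1, e2, e3]
  unfold offCount at h
  split_ifs at h with c1 c2 c3 c3 c2 c3 c3 <;>
    simp_all [lam_one_zero]

theorem exists_pos_le_abs {ι : Type*} (s : Finset ι) (f : ι → ℝ) :
    ∃ δ > 0, ∀ i ∈ s, f i ≠ 0 → δ ≤ |f i| := by
  classical
  induction s using Finset.induction_on with
  | empty => exact ⟨1, one_pos, by simp⟩
  | insert a s _ ih =>
    obtain ⟨δ, hδ, h⟩ := ih
    by_cases ha : f a = 0
    · refine ⟨δ, hδ, fun i hi h0 => ?_⟩
      rcases Finset.mem_insert.1 hi with rfl | hi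
      · exact absurd ha h0
      · exact h i hi h0
    · refine ⟨min δ |f a|, lt_min hδ (abs_pos.2 ha), fun i hi h0 => ?_⟩
      rcases Finset.mem_insert.1 hi with rfl | hi
      · exact min_le_right _ _
      · exact (min_le_left _ _).trans (h i hi h0)

/-- There are only finitely many interactions, so nonvanishing is uniform. -/
theorem exists_detuning_bound (D : S.Eigendecomposition) (j : ℤ) (p : ℕ) :
    ∃ δ > 0, ∀ m, ∀ i ∈ interactions n j p, D.detuning j m i ≠ 0 → δ ≤ |D.detuning j m i| := by
  obtain ⟨δ, hδ, h⟩ := exists_pos_le_abs (Finset.univ ×ˢ interactions n j p)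
    fun x : Fin n × ((ℤ × ℤ × ℤ) × Fin n × Fin n × Fin n) => D.detuning j x.1 x.2
  exact ⟨δ, hδ, fun m i hi => h (m, i) (Finset.mem_product.2 ⟨Finset.mem_univ _, hi⟩)⟩

/-- Each of the four frequencies differs from its value at `0` by at most `|C| d ρ₀/ε`. Together
these deviations use up at most half of the detuning. -/
theorem le_abs_freq_sub (D : S.Eigendecomposition) {C : ℝ} (hL : D.LipschitzBound C)
    {ε ρ₀ δ₀ : ℝ} (hε : 0 < ε) (hρ : 0 < ρ₀) (hsmall : 4 * (|C| * d * ρ₀) ≤ δ₀) {j : ℤ} {p : ℕ}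
    {m : Fin n} {i : (ℤ × ℤ × ℤ) × Fin n × Fin n × Fin n} (hi : i ∈ interactions n j p)
    (hres : 2 * δ₀ ≤ |D.detuning j m i|) (k₀ k₁ k₂ k₃ : RSpace d) :
    δ₀ / ε ≤ |D.freq j m ε (ρ₀ / ε) k₀ - D.signedFreq i.1.1 i.2.1 ε (ρ₀ / ε) k₁ -
      D.signedFreq i.1.2.1 i.2.2.1 ε (ρ₀ / ε) k₂ -
      D.signedFreq i.1.2.2 i.2.2.2 ε (ρ₀ / ε) k₃| := by
  have hρε : 0 ≤ ρ₀ / ε := by positivity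
  obtain ⟨-, s1, s2, s3⟩ := Finset.mem_filter.1 (Finset.mem_product.1 hi).1
  have b0 := D.abs_freq_sub_le hL j m hε hρε k₀
  have b1 := D.abs_signedFreq_sub_le hL s1 i.2.1 hε hρε k₁
  have b2 := D.abs_signedFreq_sub_le hL s2 i.2.2.1 hε hρε k₂
  have b3 := D.abs_signedFreq_sub_le hL s3 i.2.2.2 hε hρε k₃
  rw [mul_div_cancel₀ _ hε.ne'] at b0 b1 b2 b3
  set Q := D.freq j m ε (ρ₀ / ε) k₀ - D.signedFreq i.1.1 i.2.1 ε (ρ₀ / ε) k₁ -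
      D.signedFreq i.1.2.1 i.2.2.1 ε (ρ₀ / ε) k₂ -
      D.signedFreq i.1.2.2 i.2.2.2 ε (ρ₀ / ε) k₃ with hQ
  have e : D.detuning j m i / ε = D.lam j m 0 / ε - i.1.1 * (D.lam 1 i.2.1 0 / ε) -
      i.1.2.1 * (D.lam 1 i.2.2.1 0 / ε) - i.1.2.2 * (D.lam 1 i.2.2.2 0 / ε) := by
    rw [detuning]
    ring
  have h1 : |D.detuning j m i / ε| ≤ |Q| + 4 * (|C| * d * ρ₀ / ε) := by
    rw [e]
    rw [abs_le] at b0 b1 b2 b3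
    have := le_abs_self Q
    have := neg_abs_le Q
    refine abs_le.2 ⟨?_, ?_⟩ <;> linarith
  rw [abs_div, abs_of_pos hε] at h1
  have h2 : 2 * δ₀ / ε ≤ |D.detuning j m i| / ε := div_le_div_of_nonneg_right hres hε.le
  have h3 : 4 * (|C| * d * ρ₀) / ε ≤ δ₀ / ε := div_le_div_of_nonneg_right hsmall hε.le
  have h4 : 2 * δ₀ / ε = δ₀ / ε + δ₀ / ε := by ring
  have h5 : 4 * (|C| * d * ρ₀) / ε = 4 * (|C| * d * ρ₀ / ε) := by ring
  linarith

/-! ### Estimates of the modes -/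

theorem modeSize_le_one {ε : ℝ} (hε : ε ≤ 1) (ℓ : Fin n) : modeSize ε ℓ ≤ 1 := by
  unfold modeSize
  split_ifs <;> simp [hε]

/-- The constant `A` precedes `ε`, `r`, `t` and the solution. This is possible because `r` enters
only through `ε t r³` (remainder) and `ε t r⁵` (differentiated factors, each derivative costing `ε
r³`), both at most `1`. -/
theorem exists_mode_bound (D : S.Eigendecomposition) {C : ℝ} (hL : D.LipschitzBound C)
    {ρ₀ δ₀ K : ℝ} (hρ : 0 < ρ₀) (hδ : 0 < δ₀) (hsmall : 4 * (|C| * d * ρ₀) ≤ δ₀) (hK : 0 ≤ K)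
    {j : ℤ} (hj : j ∈ modes 3) (hj0 : 0 < j) {p : ℕ} (hp : p ≤ 2) :
    ∃ A ≥ 0, ∀ {ε τ r t : ℝ} {u₀ : LOne d n} {U : ℤ → ℝ → LOne d n} {m : Fin n},
      ε ∈ Ioc (0 : ℝ) 1 → S.IsClassicalSolution 3 ε τ u₀ U → ‖U 1 0‖ ≤ K → t ∈ Icc 0 τ → 1 ≤ r →
      ε * t * r ^ 5 ≤ 1 → (∀ s ∈ Icc 0 t, D.Controlled U ε (1 + (ρ₀ / ε) ^ 2) r s) →
      (∀ i ∈ interactions n j p, 2 * δ₀ ≤ |D.detuning j m i|) →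
      ‖D.mode U j m ε (ρ₀ / ε) t‖ ≤ ‖D.mode U j m ε (ρ₀ / ε) 0‖ + ε ^ p * A := by
  have hc := S.convBound_nonneg
  -- The three summands are the correctors at `t = 0`, the remainder of the nonlinearity, and the
  -- differentiated factors in the correctors.
  refine ⟨(interactions n j p).card * (2 / δ₀ * S.convBound * K * K * K) +
    ((triples 3 j).card * (S.convBound * (3 * (ρ₀ ^ 2)⁻¹ + n ^ 3 + 1)) +
    (interactions n j p).card * (2 / δ₀ * S.convBound *
      (3 * ((triples 3 1).card * (3 * S.convBound))))), by positivity, ?_⟩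
  intro ε τ r t u₀ U m hε hU hUK ht hr htr hctl hres
  have hε0 := hε.1
  have hρε : 0 < ρ₀ / ε := by positivity
  have hR : 1 ≤ 1 + (ρ₀ / ε) ^ 2 := le_add_of_nonneg_right (sq_nonneg _)
  have hct : ∀ {j : ℤ}, j ∈ modes 3 → 0 < j → ContinuousOn (U j) (Icc 0 t) := fun h h0 =>
    hU.continuousOn h h0 ht.2
  have hmem : ∀ s ∈ Ioo 0 t, s ∈ Ioo 0 τ := fun s hs => ⟨hs.1, hs.2.trans_le ht.2⟩
  have hr0 : 0 ≤ r := zero_le_one.trans hr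
  have hcont : ∀ σ ℓ, ContinuousOn (D.rotMode U σ ℓ ε (ρ₀ / ε)) (Icc 0 t) := fun σ ℓ =>
    D.continuousOn_rotMode hL σ ℓ hε0 hρε.le (hct (by decide) one_pos)
  have hder : ∀ σ ℓ, ∀ s ∈ Ioo 0 t, ∃ g', HasDerivAt (D.rotMode U σ ℓ ε (ρ₀ / ε)) g' s ∧
      ‖g'‖ ≤ ε * ((triples 3 1).card * (3 * S.convBound * r * r * r)) := fun σ ℓ s hs => by
    obtain ⟨g', h1, h2⟩ := D.hasDerivAt_rotMode hL hU σ ℓ hε0 hρε.le (hmem s hs)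
    exact ⟨g', h1, h2.trans (mul_le_mul_of_nonneg_left
      ((hctl s (Ioo_subset_Icc_self hs)).norm_nonlin_le hR 1) hε0.le)⟩
  have hbd : ∀ σ ℓ, ∀ s ∈ Ioo 0 t, ‖D.rotMode U σ ℓ ε (ρ₀ / ε) s‖ ≤ r := fun σ ℓ s hs =>
    ((hctl s (Ioo_subset_Icc_self hs)).norm_rotMode_le hR hL σ ℓ hε0 hρε.le).trans
      (mul_le_of_le_one_left hr0 (modeSize_le_one hε.2 ℓ))
  have hK0 : ∀ σ ℓ, ‖D.rotMode U σ ℓ ε (ρ₀ / ε) 0‖ ≤ K := fun σ ℓ => by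
    rw [norm_rotMode, D.norm_mode hL U 1 ℓ hε0 hρε.le]
    exact (D.norm_projOp_cutOp_le 1 ℓ hε0.ne' _ _).trans hUK
  have key := S.norm_le_of_nonresonant (interactions n j p) (ε := ε) (δ := δ₀ / ε)
    (y := D.mode U j m ε (ρ₀ / ε)) (N := S.nonlin U j)
    (g₁ := fun i => D.rotMode U i.1.1 i.2.1 ε (ρ₀ / ε))
    (g₂ := fun i => D.rotMode U i.1.2.1 i.2.2.1 ε (ρ₀ / ε))
    (g₃ := fun i => D.rotMode U i.1.2.2 i.2.2.2 ε (ρ₀ / ε))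
    (Pr := D.projOp j m ε ∘L cutOp (ρ₀ / ε))
    (D.isBddMul_freq hL j m hε0 hρε.le)
    (fun i _ => D.isBddMul_signedFreq hL i.1.1 i.2.1 hε0 hρε.le)
    (fun i _ => D.isBddMul_signedFreq hL i.1.2.1 i.2.2.1 hε0 hρε.le)
    (fun i _ => D.isBddMul_signedFreq hL i.1.2.2 i.2.2.2 hε0 hρε.le)
    hε0.le (by positivity) ht.1
    (fun i hi k₁ k₂ k₃ => D.le_abs_freq_sub hL hε0 hρ hsmall hi (hres i hi) _ k₁ k₂ k₃)
    (fun f => D.norm_projOp_cutOp_le j m hε0.ne' _ f)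
    (fun s f => D.projOp_cutOp_cmul j m hε0.ne' _
      (isBddMul_phase (D.isBddMul_freq hL j m hε0 hρε.le) s) f)
    (D.continuousOn_mode hL m hε0 hρε.le (hct hj hj0))
    (fun s hs => D.hasDerivAt_mode hL hU hj hj0 m hε0 hρε.le (hmem s hs))
    (fun s hs => (hctl s (Ioo_subset_Icc_self hs)).norm_nonlin_sub_le hL hε hρ hp j)
    (fun i _ => hcont _ _) (fun i _ => hcont _ _) (fun i _ => hcont _ _)
    (fun i _ => hder _ _) (fun i _ => hder _ _) (fun i _ => hder _ _)
    (fun i _ => hbd _ _) (fun i _ => hbd _ _) (fun i _ => hbd _ _)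
    (fun i _ => hK0 _ _) (fun i _ => hK0 _ _) (fun i _ => hK0 _ _)
  refine key.trans ?_
  rw [add_assoc]
  refine add_le_add_right ?_ _
  have hε2 : ε ^ 2 ≤ ε ^ p := pow_le_pow_of_le_one hε0.le hε.2 hp
  have hεp : 0 ≤ ε ^ p := pow_nonneg hε0.le _
  have hr3 : ε * t * r ^ 3 ≤ 1 := le_trans
    (mul_le_mul_of_nonneg_left (pow_le_pow_right₀ hr (by norm_num)) (mul_nonneg hε0.le ht.1)) htr
  -- This is the power of `ε` gained by oscillation.
  have e1 : 2 / (δ₀ / ε) = ε * (2 / δ₀) := by field_simp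
  rw [e1]
  set G := ((interactions n j p).card : ℝ)
  set T₁ := ((triples 3 1).card : ℝ)
  set B := ((triples 3 j).card : ℝ) * (S.convBound * (3 * (ρ₀ ^ 2)⁻¹ + n ^ 3 + 1)) with hB
  have hG : 0 ≤ G := Nat.cast_nonneg _
  have hT : 0 ≤ T₁ := Nat.cast_nonneg _
  have hB0 : 0 ≤ B := by positivity
  calc ε * (G * (ε * (2 / δ₀) * S.convBound * K * K * K)) +
        ε * (ε ^ p * (B * r ^ 3) + G * (ε * (2 / δ₀) * S.convBound *
          (3 * (ε * (T₁ * (3 * S.convBound * r * r * r)) * r * r)))) * t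
      = ε ^ 2 * (G * (2 / δ₀ * S.convBound * K * K * K)) + ε ^ p * (B * (ε * t * r ^ 3)) +
        ε ^ 2 * (G * (2 / δ₀ * S.convBound * (3 * (T₁ * (3 * S.convBound)))) *
          (ε * t * r ^ 5)) := by ring
    _ ≤ ε ^ p * (G * (2 / δ₀ * S.convBound * K * K * K)) + ε ^ p * (B * 1) +
        ε ^ p * (G * (2 / δ₀ * S.convBound * (3 * (T₁ * (3 * S.convBound)))) * 1) := by
        gcongr
        exact mul_nonneg (by positivity) (mul_nonneg (mul_nonneg hε0.le ht.1) (by positivity))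
    _ = _ := by ring

/-! ### Initial data -/

theorem norm_psi (D : S.Eigendecomposition) (j : ℤ) (ℓ : Fin n) (θ : RSpace d) :
    ‖D.psi j ℓ θ‖ = 1 :=
  D.norm_vec _ _

/-- Since `p̂₀` is orthogonal to `ψ_{1ℓ}(0)`, only `ψ_{1ℓ}(εk) - ψ_{1ℓ}(0) = O(ε|k|)` contributes,
and `|k| ≤ 1 + |k|²` is absorbed by the `W²` norm. -/
theorem norm_projOp_polarized_le (D : S.Eigendecomposition) (hgap : D.Gap) {K : ℝ} (hK : 0 ≤ K)
    (hpsi : ∀ ℓ θ, ‖D.psi 1 ℓ θ - D.psi 1 ℓ 0‖ ≤ K * ‖θ‖) {p : LOne d n} (hp : MemW 2 p)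
    (hpol : S.Polarized p) {ℓ : Fin n} (hℓ : ℓ ≠ 0) {ε : ℝ} (hε : 0 < ε) :
    ‖D.projOp 1 ℓ ε p‖ ≤ ε * K * wNorm 2 p := by
  have h1 : ‖D.projOp 1 ℓ ε p‖ ≤ ∫ k, ε * K * ((1 + ‖k‖ ^ 2) * ‖p k‖) := by
    rw [L1.norm_eq_integral_norm]
    refine integral_mono_ae (L1.integrable_coeFn _).norm (hp.integrable_weight.const_mul _) ?_
    filter_upwards [coeFn_mulOp (D.isBddMul_rankOneL 1 ℓ hε.ne') p,
      D.rankOneL_polarized hgap hpol hℓ] with k hk hk0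
    have h0 : (inner ℂ (D.psi 1 ℓ 0) (p k) : ℂ) = 0 := by
      rw [← norm_eq_zero, ← norm_rankOneL_apply (D.norm_psi 1 ℓ 0), hk0, norm_zero]
    have h2 : (inner ℂ (D.psi 1 ℓ (ε • k)) (p k) : ℂ) =
        inner ℂ (D.psi 1 ℓ (ε • k) - D.psi 1 ℓ 0) (p k) := by
      rw [inner_sub_left, h0, sub_zero]
    rw [projOp, hk, norm_rankOneL_apply (D.norm_psi 1 ℓ _), h2]
    have hkk : ‖k‖ ≤ 1 + ‖k‖ ^ 2 := by nlinarith [sq_nonneg (‖k‖ - 1)]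
    calc _ ≤ ‖D.psi 1 ℓ (ε • k) - D.psi 1 ℓ 0‖ * ‖p k‖ := norm_inner_le_norm _ _
      _ ≤ (K * (ε * ‖k‖)) * ‖p k‖ := by
        refine mul_le_mul_of_nonneg_right ((hpsi ℓ _).trans_eq ?_) (norm_nonneg _)
        rw [norm_smul, Real.norm_of_nonneg hε.le]
      _ = ε * K * (‖k‖ * ‖p k‖) := by ring
      _ ≤ _ := by gcongr
  rw [integral_const_mul] at h1
  exact h1.trans (mul_le_mul_of_nonneg_left hp.integral_weight_le (by positivity))

end Data.Eigendecomposition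

/-! ### The continuation argument -/

/-- At the first time where `F ≥ r`, the intermediate value theorem gives `F = r`, contradicting the
strict improvement. -/
theorem le_of_bootstrap {F : ℝ → ℝ} {T r : ℝ} (hc : ContinuousOn F (Icc 0 T)) (h0 : F 0 < r)
    (h : ∀ t ∈ Icc 0 T, (∀ s ∈ Icc 0 t, F s ≤ r) → F t < r) : ∀ t ∈ Icc 0 T, F t ≤ r := by
  by_contra! hcon
  obtain ⟨t₁, ht₁, hr₁⟩ := hcon
  have hclosed : IsClosed (Icc 0 T ∩ F ⁻¹' Ici r) := hc.preimage_isClosed_of_isClosed isClosed_Icc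
    isClosed_Ici
  obtain ⟨t₂, ⟨ht₂, hr₂⟩, hmin⟩ := (isCompact_Icc.of_isClosed_subset hclosed
    inter_subset_left).exists_isLeast ⟨t₁, ht₁, hr₁.le⟩
  have hlt : ∀ s ∈ Ico 0 t₂, F s < r := fun s hs => by
    by_contra hge
    exact hs.2.not_ge (hmin ⟨⟨hs.1, hs.2.le.trans ht₂.2⟩, not_lt.1 hge⟩)
  obtain ⟨s, hs, hsr⟩ := intermediate_value_Icc ht₂.1 (hc.mono (Icc_subset_Icc_right ht₂.2))
    ⟨h0.le, hr₂⟩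
  have hst : s = t₂ := by
    by_contra hne
    exact (hlt s ⟨hs.1, lt_of_le_of_ne hs.2 hne⟩).ne hsr
  rw [hst] at hsr
  refine (h t₂ ht₂ fun s hs => ?_).ne hsr
  rcases hs.2.eq_or_lt with rfl | hlt'
  · exact hsr.le
  · exact (hlt s ⟨hs.1, hlt'⟩).le

theorem ofReal_smul_eq (c : ℝ) (f : LOne d n) : (c : ℂ) • f = c • f := by
  apply Lp.ext
  filter_upwards [Lp.coeFn_smul (c : ℂ) f, Lp.coeFn_smul c f] with k h1 h2
  rw [h1, h2, Pi.smul_apply, Pi.smul_apply, Complex.coe_smul]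

namespace Data.Eigendecomposition

variable [NeZero n] {S : Data d n}

theorem norm_le_of_norm_projOp_le (D : S.Eigendecomposition) (j : ℤ) {ε a : ℝ} (hε : ε ≠ 0)
    (ρ : ℝ) {f : LOne d n} (h : ∀ ℓ, ‖D.projOp j ℓ ε (cutOp ρ f)‖ ≤ a) :
    ‖f‖ ≤ n * a + ‖f - cutOp ρ f‖ := by
  have h1 : ‖cutOp ρ f‖ ≤ n * a := by
    rw [← D.sum_projOp j hε (cutOp ρ f)]
    exact (norm_sum_le _ _).trans
      ((Finset.sum_le_card_nsmul _ _ a fun ℓ _ => h ℓ).trans_eq (by simp))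
  have h2 := norm_add_le (cutOp ρ f) (f - cutOp ρ f)
  rw [add_sub_cancel] at h2
  linarith

/-- The factor `2` arises because the tail enters once directly and once through the projection. -/
theorem norm_perp_le_of_norm_projOp_le (D : S.Eigendecomposition) (j : ℤ) {ε a : ℝ} (hε : ε ≠ 0)
    (ρ : ℝ) {f : LOne d n} (ha : 0 ≤ a) (h : ∀ ℓ, ℓ ≠ 0 → ‖D.projOp j ℓ ε (cutOp ρ f)‖ ≤ a) :
    ‖f - D.projOp j 0 ε f‖ ≤ n * a + 2 * ‖f - cutOp ρ f‖ := by
  have e : f - D.projOp j 0 ε f = ∑ ℓ ∈ Finset.univ.erase 0, D.projOp j ℓ ε (cutOp ρ f) +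
      (f - cutOp ρ f) - D.projOp j 0 ε (f - cutOp ρ f) := by
    have h1 := Finset.add_sum_erase Finset.univ (fun ℓ => D.projOp j ℓ ε (cutOp ρ f))
      (Finset.mem_univ 0)
    rw [D.sum_projOp j hε] at h1
    rw [eq_sub_of_add_eq' h1, map_sub]
    abel
  have h1 : ‖∑ ℓ ∈ Finset.univ.erase 0, D.projOp j ℓ ε (cutOp ρ f)‖ ≤ n * a := by
    refine (norm_sum_le _ _).trans ((Finset.sum_le_card_nsmul _ _ a fun ℓ hℓ =>
      h ℓ (Finset.ne_of_mem_erase hℓ)).trans ?_)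
    rw [nsmul_eq_mul]
    refine mul_le_mul_of_nonneg_right (Nat.cast_le.2 ?_) ha
    exact (Finset.card_erase_le).trans_eq (by simp)
  have h2 := D.norm_projOp_le j 0 hε (f - cutOp ρ f)
  rw [e]
  refine (norm_sub_le _ _).trans ?_
  have h3 := norm_add_le (∑ ℓ ∈ Finset.univ.erase 0, D.projOp j ℓ ε (cutOp ρ f)) (f - cutOp ρ f)
  linarith

/-- The scaled norm of the solution, together with weighted norms. -/
def energy (D : S.Eigendecomposition) (U : ℤ → ℝ → LOne d n) (ε R t : ℝ) : ℝ :=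
  2 * ‖D.projOp 1 0 ε (U 1 t)‖ + 2 / ε * ‖U 1 t - D.projOp 1 0 ε (U 1 t)‖ +
    2 / ε ^ 2 * ‖U 3 t‖ + (‖weightOp R (U 1 t)‖ + ‖weightOp R (U 3 t)‖)

theorem continuousOn_energy (D : S.Eigendecomposition) {U : ℤ → ℝ → LOne d n} {A : Set ℝ}
    (h₁ : ContinuousOn (U 1) A) (h₃ : ContinuousOn (U 3) A) (ε R : ℝ) :
    ContinuousOn (D.energy U ε R) A := by
  have hP := (D.projOp 1 0 ε).continuous.comp_continuousOn h₁
  have hW₁ := (weightOp (d := d) (n := n) R).continuous.comp_continuousOn h₁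
  have hW₃ := (weightOp (d := d) (n := n) R).continuous.comp_continuousOn h₃
  exact (((continuousOn_const.mul hP.norm).add (continuousOn_const.mul (h₁.sub hP).norm)).add
    (continuousOn_const.mul h₃.norm)).add (hW₁.norm.add hW₃.norm)

theorem controlled_of_energy_le {D : S.Eigendecomposition} {U : ℤ → ℝ → LOne d n} {ε R r s : ℝ}
    (hε : 0 < ε) (h : D.energy U ε R s ≤ r) : D.Controlled U ε R r s := by
  unfold energy at h
  have a1 : 0 ≤ 2 * ‖D.projOp 1 0 ε (U 1 s)‖ := by positivity
  have a2 : 0 ≤ 2 / ε * ‖U 1 s - D.projOp 1 0 ε (U 1 s)‖ := by positivity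
  have a3 : 0 ≤ 2 / ε ^ 2 * ‖U 3 s‖ := by positivity
  have a4 := norm_nonneg (weightOp R (U 1 s))
  have a5 := norm_nonneg (weightOp R (U 3 s))
  refine ⟨by linarith, by linarith, ?_, ?_⟩
  · have h1 : 2 / ε * ‖U 1 s - D.projOp 1 0 ε (U 1 s)‖ ≤ r := by linarith
    rw [div_mul_eq_mul_div, div_le_iff₀ hε] at h1
    have := norm_nonneg (U 1 s - D.projOp 1 0 ε (U 1 s))
    linarith
  · have h1 : 2 / ε ^ 2 * ‖U 3 s‖ ≤ r := by linarith
    rw [div_mul_eq_mul_div, div_le_iff₀ (by positivity)] at h1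
    have := norm_nonneg (U 3 s)
    linarith

-- The decisive point is that `B` is chosen before `r`: the a priori bound `r` is improved to a
-- fixed constant as long as `ε t r⁵ ≤ 1`. Modes inside the ball are handled by `exists_mode_bound`,
-- the tails by the weighted norms, and the weighted norms by `norm_weightOp_le`.
set_option maxHeartbeats 800000 in
theorem exists_energy_bound (D : S.Eigendecomposition) {C : ℝ} (hL : D.LipschitzBound C)
    (hgap : D.Gap) (hres : S.NonResonant) (M : ℝ) :
    ∃ ρ₀ > 0, ∃ B ≥ 0, ∀ {p₀ p₁ : LOne d n} {ε τ r t : ℝ} {U : ℤ → ℝ → LOne d n},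
      MemW 2 p₀ → MemW 2 p₁ → wNorm 2 p₀ ≤ M → wNorm 2 p₁ ≤ M → S.Polarized p₀ →
      ε ∈ Ioc (0 : ℝ) 1 → S.IsClassicalSolution 3 ε τ (p₀ + (ε : ℂ) • p₁) U → t ∈ Icc 0 τ →
      1 ≤ r → ε * t * r ^ 5 ≤ 1 →
      (∀ s ∈ Icc 0 t, D.Controlled U ε (1 + (ρ₀ / ε) ^ 2) r s) →
      D.energy U ε (1 + (ρ₀ / ε) ^ 2) t ≤ B := by
  obtain ⟨δ₁, hδ₁, hdet₁⟩ := D.exists_detuning_bound 1 1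
  obtain ⟨δ₃, hδ₃, hdet₃⟩ := D.exists_detuning_bound 3 2
  obtain ⟨δ₀, hδ₀⟩ : ∃ x, x = min δ₁ δ₃ / 2 := ⟨_, rfl⟩
  have hδ : 0 < δ₀ := hδ₀ ▸ half_pos (lt_min hδ₁ hδ₃)
  -- The radius is chosen so that four Lipschitz deviations cost at most `δ₀`; the added `1` avoids
  -- a zero denominator.
  obtain ⟨ρ₀, hρ₀⟩ : ∃ x, x = δ₀ / (4 * (|C| * d + 1)) := ⟨_, rfl⟩
  have hρ : 0 < ρ₀ := by rw [hρ₀]; positivity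
  have hsmall : 4 * (|C| * d * ρ₀) ≤ δ₀ := by
    have h1 : δ₀ = 4 * (|C| * d + 1) * ρ₀ := by
      rw [hρ₀]
      field_simp
    have h2 : 4 * (|C| * d + 1) * ρ₀ = 4 * (|C| * d * ρ₀) + 4 * ρ₀ := by ring
    linarith
  have h2δ : 2 * δ₀ = min δ₁ δ₃ := by rw [hδ₀]; ring
  have hMnn : 0 ≤ |M| := abs_nonneg M
  obtain ⟨K, hK, hpsi⟩ := D.exists_psi_lipschitz
  -- As `ε ≤ 1`, the datum `p₀ + ε p₁` is bounded by `2|M|`. The order is `p = 1` for the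
  -- non-leading modes of `u_1` and `p = 2` for `u_3`.
  obtain ⟨A₁, hA₁, hmode₁⟩ := D.exists_mode_bound hL hρ hδ hsmall (K := 2 * |M|) (by positivity)
    (j := 1) (by decide) one_pos (p := 1) (by norm_num)
  obtain ⟨A₃, hA₃, hmode₃⟩ := D.exists_mode_bound hL hρ hδ hsmall (K := 2 * |M|) (by positivity)
    (j := 3) (by decide) (by norm_num) (p := 2) le_rfl
  have hc := S.convBound_nonneg
  obtain ⟨B₁, hB₁⟩ : ∃ x, x = n * (2 * |M| + (triples 3 1).card * (3 * S.convBound)) := ⟨_, rfl⟩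
  obtain ⟨B₃, hB₃⟩ : ∃ x, x = n * ((triples 3 3).card * (3 * S.convBound)) := ⟨_, rfl⟩
  have hB₁0 : 0 ≤ B₁ := by rw [hB₁]; positivity
  have hB₃0 : 0 ≤ B₃ := by rw [hB₃]; positivity
  -- The contributions to a non-leading mode, in units of `ε`: the polarized `p₀`, the perturbation
  -- `ε p₁`, and the evolution.
  obtain ⟨A, hA⟩ : ∃ x, x = K * |M| + |M| + A₁ := ⟨_, rfl⟩
  have hA0 : 0 ≤ A := by rw [hA]; positivity
  refine ⟨ρ₀, hρ, 2 * B₁ + (2 * (n * A) + 4 * ((ρ₀ ^ 2)⁻¹ * B₁)) +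
    (2 * (n * A₃) + 2 * ((ρ₀ ^ 2)⁻¹ * B₃)) + (B₁ + B₃), by positivity, ?_⟩
  intro p₀ p₁ ε τ r t U hp₀ hp₁ hn₀ hn₁ hpol hε hU ht hr htr hctl
  have hε0 := hε.1
  have hR : 1 ≤ 1 + (ρ₀ / ε) ^ 2 := le_add_of_nonneg_right (sq_nonneg _)
  have hρε : 0 < ρ₀ / ε := by positivity
  have hM₀ : wNorm 2 p₀ ≤ |M| := hn₀.trans (le_abs_self M)
  have hM₁ : wNorm 2 p₁ ≤ |M| := hn₁.trans (le_abs_self M)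
  have hr0 : 0 ≤ r := zero_le_one.trans hr
  have hU1 : U 1 0 = p₀ + ε • p₁ := by rw [hU.init_one, ofReal_smul_eq]
  have hU3 : U 3 0 = 0 := hU.init_other 3 (by decide) (by norm_num)
  have hw₀ : ‖weightOp (1 + (ρ₀ / ε) ^ 2) (U 1 0)‖ ≤ 2 * |M| := by
    rw [hU1, map_add, map_smul]
    refine (norm_add_le _ _).trans ?_
    rw [norm_smul, Real.norm_of_nonneg hε0.le]
    have h1 := (norm_weightOp_le_wNorm hR hp₀).trans hM₀
    have h2 := (norm_weightOp_le_wNorm hR hp₁).trans hM₁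
    have h3 := mul_le_of_le_one_left (norm_nonneg (weightOp (1 + (ρ₀ / ε) ^ 2) p₁)) hε.2
    linarith
  have hK₀ : ‖U 1 0‖ ≤ 2 * |M| := (norm_le_norm_weightOp hR _).trans hw₀
  have hεt : 0 ≤ ε * t := mul_nonneg hε0.le ht.1
  have hr3 : ε * t * r ^ 3 ≤ 1 :=
    le_trans (mul_le_mul_of_nonneg_left (pow_le_pow_right₀ hr (by norm_num)) hεt) htr
  have hgrow : ∀ {j : ℤ}, j ∈ modes 3 → 0 < j → ‖weightOp (1 + (ρ₀ / ε) ^ 2) (U j t)‖ ≤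
      n * (‖weightOp (1 + (ρ₀ / ε) ^ 2) (U j 0)‖ + (triples 3 j).card * (3 * S.convBound)) := by
    intro j hj hj0
    refine (D.norm_weightOp_le hL hU hj hj0 hε0 hR ht fun s hs =>
      (hctl s (Ioo_subset_Icc_self hs)).norm_weightOp_nonlin_le hR j).trans ?_
    refine mul_le_mul_of_nonneg_left (add_le_add_right ?_ _) (Nat.cast_nonneg _)
    calc _ = (triples 3 j).card * (3 * S.convBound) * (ε * t * r ^ 3) := by ring
      _ ≤ _ := mul_le_of_le_one_right (by positivity) hr3
  have hW₁ : ‖weightOp (1 + (ρ₀ / ε) ^ 2) (U 1 t)‖ ≤ B₁ := by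
    refine (hgrow (by decide) one_pos).trans ?_
    rw [hB₁]
    gcongr
  have hW₃ : ‖weightOp (1 + (ρ₀ / ε) ^ 2) (U 3 t)‖ ≤ B₃ := by
    refine (hgrow (by decide) (by norm_num)).trans_eq ?_
    rw [hU3, map_zero, norm_zero, zero_add, hB₃]
  have hinv : ((ρ₀ / ε) ^ 2)⁻¹ = ε ^ 2 * (ρ₀ ^ 2)⁻¹ := by
    rw [div_pow, inv_div, div_eq_mul_inv]
  have htail₁ : ‖U 1 t - cutOp (ρ₀ / ε) (U 1 t)‖ ≤ ε ^ 2 * ((ρ₀ ^ 2)⁻¹ * B₁) := by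
    refine (norm_sub_cutOp_le hρε _).trans ?_
    rw [hinv, mul_assoc]
    gcongr
  have htail₃ : ‖U 3 t - cutOp (ρ₀ / ε) (U 3 t)‖ ≤ ε ^ 2 * ((ρ₀ ^ 2)⁻¹ * B₃) := by
    refine (norm_sub_cutOp_le hρε _).trans ?_
    rw [hinv, mul_assoc]
    gcongr
  have hproj₁ : ∀ ℓ, ℓ ≠ 0 → ‖D.projOp 1 ℓ ε (cutOp (ρ₀ / ε) (U 1 t))‖ ≤ ε * A := by
    intro ℓ hℓ
    have h1 := hmode₁ (m := ℓ) hε hU hK₀ ht hr htr hctl fun i hi =>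
      (h2δ.trans_le (min_le_left _ _)).trans (hdet₁ ℓ i hi (D.detuning_one_ne_zero hgap hℓ hi))
    rw [D.norm_mode hL U 1 ℓ hε0 hρε.le, D.norm_mode hL U 1 ℓ hε0 hρε.le, pow_one] at h1
    have h2 : ‖D.projOp 1 ℓ ε (cutOp (ρ₀ / ε) (U 1 0))‖ ≤ ε * (K * |M|) + ε * |M| := by
      rw [D.cutOp_projOp 1 ℓ hε0.ne']
      refine (norm_cutOp_le _ _).trans ?_
      rw [hU1, map_add, map_smul]
      refine (norm_add_le _ _).trans (add_le_add ?_ ?_)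
      · refine (D.norm_projOp_polarized_le hgap hK hpsi hp₀ hpol hℓ hε0).trans ?_
        rw [mul_assoc]
        gcongr
      · rw [norm_smul, Real.norm_of_nonneg hε0.le]
        refine mul_le_mul_of_nonneg_left ((D.norm_projOp_le 1 ℓ hε0.ne' _).trans
          ((norm_le_norm_weightOp hR _).trans ((norm_weightOp_le_wNorm hR hp₁).trans hM₁))) hε0.le
    rw [hA, mul_add, mul_add]
    linarith
  have hproj₃ : ∀ m, ‖D.projOp 3 m ε (cutOp (ρ₀ / ε) (U 3 t))‖ ≤ ε ^ 2 * A₃ := by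
    intro m
    have h1 := hmode₃ (m := m) hε hU hK₀ ht hr htr hctl fun i hi =>
      (h2δ.trans_le (min_le_right _ _)).trans (hdet₃ m i hi (D.detuning_three_ne_zero hres m hi))
    rwa [D.norm_mode hL U 3 m hε0 hρε.le, D.norm_mode hL U 3 m hε0 hρε.le, hU3, map_zero,
      map_zero, norm_zero, zero_add] at h1
  have hperp := D.norm_perp_le_of_norm_projOp_le 1 hε0.ne' (ρ₀ / ε) (mul_nonneg hε0.le hA0) hproj₁
  have hthree := D.norm_le_of_norm_projOp_le 3 hε0.ne' (ρ₀ / ε) hproj₃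
  have e1 : 2 * ‖D.projOp 1 0 ε (U 1 t)‖ ≤ 2 * B₁ :=
    mul_le_mul_of_nonneg_left ((D.norm_projOp_le 1 0 hε0.ne' _).trans
      ((norm_le_norm_weightOp hR _).trans hW₁)) zero_le_two
  have e2 : 2 / ε * ‖U 1 t - D.projOp 1 0 ε (U 1 t)‖ ≤
      2 * (n * A) + 4 * ((ρ₀ ^ 2)⁻¹ * B₁) := by
    rw [div_mul_eq_mul_div, div_le_iff₀ hε0]
    have h1 : ε ^ 2 * ((ρ₀ ^ 2)⁻¹ * B₁) ≤ ε * ((ρ₀ ^ 2)⁻¹ * B₁) :=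
      mul_le_mul_of_nonneg_right (pow_le_of_le_one hε0.le hε.2 two_ne_zero) (by positivity)
    have h2 : (2 * (n * A) + 4 * ((ρ₀ ^ 2)⁻¹ * B₁)) * ε =
      2 * (n * (ε * A)) + 4 * (ε * ((ρ₀ ^ 2)⁻¹ * B₁)) := by ring
    linarith
  have e3 : 2 / ε ^ 2 * ‖U 3 t‖ ≤ 2 * (n * A₃) + 2 * ((ρ₀ ^ 2)⁻¹ * B₃) := by
    rw [div_mul_eq_mul_div, div_le_iff₀ (by positivity)]
    have h2 : (2 * (n * A₃) + 2 * ((ρ₀ ^ 2)⁻¹ * B₃)) * ε ^ 2 =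
      2 * (n * (ε ^ 2 * A₃)) + 2 * (ε ^ 2 * ((ρ₀ ^ 2)⁻¹ * B₃)) := by ring
    linarith
  unfold energy
  linarith

end Data.Eigendecomposition

end Friedrichs
end

/-! ### Main theorem -/

open Friedrichs
theorem proposition5p2 {d n : ℕ} [NeZero n]
    -- the quantities on which `tstar` is allowed to depend, besides `r`
    (tend Cdata CT Cinv Clip : ℝ) (htend : 0 < tend) :
    ∃ tstar : ℝ → ℝ, (∀ r > 0, 0 < tstar r ∧ tstar r ≤ tend) ∧
      ∀ (S : Data d n) (D : S.Eigendecomposition),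
        S.KernelOneDim → D.LipschitzBound Clip → D.Gap → S.NonResonant →
        (∀ a b c, ‖S.TC a b c‖ ≤ CT * ‖a‖ * ‖b‖ * ‖c‖) →
        (∀ ℓ, ℓ ≠ 0 → |D.lam 1 ℓ 0|⁻¹ ≤ Cinv) →
        ∃ r₀ > 0, ∀ r ≥ r₀, ∃ C > 0,
          ∀ p₀ p₁ : LOne d n, MemW 2 p₀ → MemW 2 p₁ →
            wNorm 2 p₀ ≤ Cdata → wNorm 2 p₁ ≤ Cdata → S.Polarized p₀ →
          ∀ ε ∈ Set.Ioc (0 : ℝ) 1, ∀ U : ℤ → ℝ → LOne d n,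
            S.IsClassicalSolution 3 ε (tend / ε) (p₀ + (ε : ℂ) • p₁) U →
          ∀ t ∈ Set.Icc 0 (tstar r / ε),
            scaledNorm ε (D.z ε U 1 t) (D.z ε U 3 t) ≤ ENNReal.ofReal r ∧
            normL1 (fun k => D.PEpsPerp ε k (U 1 t k))
              = normL1 (fun k => PPerp (D.z ε U 1 t k)) ∧
            normL1 (fun k => D.PEpsPerp ε k (U 1 t k)) ≤ ENNReal.ofReal (C * ε) ∧
            normL1 (U 3 t) = normL1 (D.z ε U 3 t) ∧
            normL1 (U 3 t) ≤ ENNReal.ofReal (C * ε ^ 2) := by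
  -- The choice `r⁻⁵` makes `ε t r⁵ ≤ 1` for `t ≤ t⋆/ε`.
  refine ⟨fun r => min tend (r ^ 5)⁻¹, fun r hr => ⟨lt_min htend (by positivity), min_le_left _ _⟩,
    fun S D _ hL hgap hres _ _ => ?_⟩
  obtain ⟨ρ₀, hρ, B, hB, hbound⟩ := D.exists_energy_bound hL hgap hres Cdata
  -- The threshold ensures `1 ≤ r` and the strict inequality `B < r` needed for continuation; the
  -- final constant `C` is `r` itself.
  refine ⟨B + 1, by positivity, fun r hr => ⟨r, by linarith, ?_⟩⟩
  intro p₀ p₁ hp₀ hp₁ hn₀ hn₁ hpol ε hε U hU t ht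
  have hε0 := hε.1
  have hr1 : 1 ≤ r := by linarith
  have hT : min tend (r ^ 5)⁻¹ / ε ≤ tend / ε := div_le_div_of_nonneg_right (min_le_left _ _) hε0.le
  have htime : ∀ s ∈ Icc 0 (min tend (r ^ 5)⁻¹ / ε), ε * s * r ^ 5 ≤ 1 := fun s hs => by
    have h1 : ε * s ≤ (r ^ 5)⁻¹ := by
      rw [mul_comm, ← le_div_iff₀ hε0]
      exact hs.2.trans (div_le_div_of_nonneg_right (min_le_right _ _) hε0.le)
    calc _ ≤ (r ^ 5)⁻¹ * r ^ 5 := mul_le_mul_of_nonneg_right h1 (by positivity)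
      _ = 1 := inv_mul_cancel₀ (by positivity)
  have henergy : ∀ s ∈ Icc 0 (min tend (r ^ 5)⁻¹ / ε),
      D.energy U ε (1 + (ρ₀ / ε) ^ 2) s ≤ r := by
    refine le_of_bootstrap (D.continuousOn_energy (hU.continuousOn (by decide) one_pos hT)
      (hU.continuousOn (by decide) (by norm_num) hT) _ _) ?_ fun s hs hle => ?_
    -- At `t = 0` the smallness condition is void, so the a priori bound may be the initial energy
    -- itself; the lemma then yields that this energy is at most `B`.
    · have := hbound (t := 0) (r := max 1 (D.energy U ε (1 + (ρ₀ / ε) ^ 2) 0)) hp₀ hp₁ hn₀ hn₁ hpol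
        hε hU ⟨le_rfl, by positivity⟩ (le_max_left _ _) (by simp) fun s hs => by
          rw [le_antisymm hs.2 hs.1]
          exact Data.Eigendecomposition.controlled_of_energy_le hε0 (le_max_right _ _)
      linarith
    · have := hbound hp₀ hp₁ hn₀ hn₁ hpol hε hU ⟨hs.1, hs.2.trans hT⟩ hr1 (htime s hs) fun s' hs' =>
        Data.Eigendecomposition.controlled_of_energy_le hε0 (hle s' hs')
      linarith
  have hE := henergy t ht
  have hctl := Data.Eigendecomposition.controlled_of_energy_le hε0 hE
  refine ⟨?_, D.normL1_PEpsPerp_eq ε U t, ?_, (D.normL1_z ε U 3 t).symm, ?_⟩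
  · rw [D.scaledNorm_z hε0]
    refine ENNReal.ofReal_le_ofReal (le_trans ?_ hE)
    exact le_add_of_nonneg_right (by positivity)
  · rw [D.normL1_PEpsPerp hε0.ne']
    exact ENNReal.ofReal_le_ofReal (hctl.perp.trans_eq (mul_comm _ _))
  · rw [normL1_coe]
    exact ENNReal.ofReal_le_ofReal (hctl.three.trans_eq (mul_comm _ _))
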